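/- Let $n\ge 2$, $s\ge 1$ and $1\le p\le n$. There exist a bounded domain $\Omega\subset\mathbb{R}^n$ and a point $x_0\in\Omega$ such that: (i) $\Omega$ is an $s$-John domain with center $x_0$: there is a constant $C$ such that every $x\in\Omega$ can be joined to $x_0$ by a rectifiable curve $\gamma:[0,1]\to\Omega$, $\gamma(0)=x$, $\gamma(1)=x_0$, with $C\,d(\gamma(t),\partial\Omega)\ge \ell(\gamma([0,t]))^s$ for all $0<t\le 1$. (ii) $\Omega$ is Gromov hyperbolic in the quasihyperbolic metric $k(x,y)=\inf_\gamma\int_\gamma \frac{|dz|}{d(z,\partial\Omega)}$ (infimum over rectifiable curves in $\Omega$ from $x$ to $y$): $(\Omega,k)$ is a geodesic space, and for some $\delta<\infty$ all its geodesic triangles are $\delta$-thin, i.e. each side lies in the $\delta$-neighbourhood of the union of the two other sides. (iii) For every Whitney decomposition $\mathbb{W}$ of $\Omega$ and every cube $Q_0\in\mathbb{W}$ containing $x_0$ there is a sequence of compact sets $E_j\subset\Omega$, each disjoint from $Q_0$, such that for every $q$ with $0<q<\min\{(n-1)s+1-p,\ \log_2(2^n-1)\}$ there is a constant $c>0$ with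 $\mathcal{H}^q_\infty(E_j)\ge c$ for all $j$, and $\mathrm{cap}_p(E_j,Q_0,\Omega)\to 0$ as $j\to\infty$. Here a Whitney decomposition of $\Omega$ is a collection of closed cubes $Q\subset\Omega$ with edges parallel to the coordinate axes and pairwise disjoint interiors, whose union is $\Omega$, whose diameters belong to $\{2^{-j}:j\in\mathbb{Z}\}$, and which satisfy $\mathrm{diam}(Q)\le \mathrm{dist}(Q,\partial\Omega)\le 4\,\mathrm{diam}(Q)$. The Hausdorff $q$-content is $\mathcal{H}^q_\infty(E)=\inf\sum_i r_i^q$, the infimum being taken over all countable coverings of $E$ by balls $B(x_i,r_i)$. The $p$-capacity is $\mathrm{cap}_p(E,F,\Omega)=\inf_u\int_\Omega|\nabla u|^p\,dx$, the infimum being taken over all continuous $u\in W^{1,p}_{\mathrm{loc}}(\Omega)$ with $u\le 0$ on $E$ and $u\ge 1$ on $F$. -/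

import Mathlib

open Set Filter Topology MeasureTheory
open scoped ENNReal NNReal ContDiff

noncomputable section

/-- A bounded domain in `ℝⁿ`: a nonempty, open, connected, bounded set. -/
def IsBoundedDomain {n : ℕ} (Ω : Set (EuclideanSpace ℝ (Fin n))) : Prop :=
  IsOpen Ω ∧ IsConnected Ω ∧ Bornology.IsBounded Ω

/-- `Ω` is an `s`-John domain with John center `x₀`: there is a constant `C` such that every
`x ∈ Ω` can be joined to `x₀` by a rectifiable curve `γ : [0,1] → Ω` with
`l(γ([0,t]))ˢ ≤ C d(γ(t), ∂Ω)` for all `0 < t ≤ 1`. -/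
def IsSJohnDomain {n : ℕ} (s : ℝ) (Ω : Set (EuclideanSpace ℝ (Fin n)))
    (x₀ : EuclideanSpace ℝ (Fin n)) : Prop :=
  IsBoundedDomain Ω ∧ x₀ ∈ Ω ∧
    ∃ C : ℝ, ∀ x ∈ Ω, ∃ γ : ℝ → EuclideanSpace ℝ (Fin n),
      ContinuousOn γ (Icc 0 1) ∧ MapsTo γ (Icc 0 1) Ω ∧ γ 0 = x ∧ γ 1 = x₀ ∧
      BoundedVariationOn γ (Icc 0 1) ∧
      ∀ t ∈ Ioc (0 : ℝ) 1,
        (eVariationOn γ (Icc 0 t)).toReal ^ s ≤ C * Metric.infDist (γ t) (frontier Ω)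

/-- The quasihyperbolic distance in `Ω`: the infimum of `∫_γ |dz| / d(z, ∂Ω)` over the rectifiable
curves `γ` in `Ω` from `x` to `y`, each of them parametrized by arc length on `[0, L]`. -/
def qhDist {n : ℕ} (Ω : Set (EuclideanSpace ℝ (Fin n)))
    (x y : EuclideanSpace ℝ (Fin n)) : ℝ≥0∞ :=
  ⨅ (L : ℝ) (γ : ℝ → EuclideanSpace ℝ (Fin n))
    (_ : 0 ≤ L ∧ HasUnitSpeedOn γ (Icc 0 L) ∧ MapsTo γ (Icc 0 L) Ω ∧ γ 0 = x ∧ γ L = y),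
    ∫⁻ t in Icc 0 L, (ENNReal.ofReal (Metric.infDist (γ t) (frontier Ω)))⁻¹

/-- `γ : [0, ℓ] → Ω` is a quasihyperbolic geodesic from `x` to `y`. -/
def IsQHGeodesic {n : ℕ} (Ω : Set (EuclideanSpace ℝ (Fin n)))
    (x y : EuclideanSpace ℝ (Fin n)) (ℓ : ℝ) (γ : ℝ → EuclideanSpace ℝ (Fin n)) : Prop :=
  0 ≤ ℓ ∧ MapsTo γ (Icc 0 ℓ) Ω ∧ γ 0 = x ∧ γ ℓ = y ∧
    ∀ a ∈ Icc (0 : ℝ) ℓ, ∀ b ∈ Icc (0 : ℝ) ℓ, qhDist Ω (γ a) (γ b) = ENNReal.ofReal |a - b|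

/-- `Ω` is Gromov hyperbolic in the quasihyperbolic metric: the space `(Ω, k)` is geodesic, and
for some `δ < ∞` all geodesic triangles in it are `δ`-thin (each side lies in the
`δ`-neighbourhood of the union of the two others). -/
def IsGromovHyperbolicDomain {n : ℕ} (Ω : Set (EuclideanSpace ℝ (Fin n))) : Prop :=
  (∀ x ∈ Ω, ∀ y ∈ Ω, ∃ ℓ γ, IsQHGeodesic Ω x y ℓ γ) ∧
  ∃ δ : ℝ, 0 ≤ δ ∧ ∀ x ∈ Ω, ∀ y ∈ Ω, ∀ z ∈ Ω, ∀ ℓ₁ ℓ₂ ℓ₃ γ₁ γ₂ γ₃,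
    IsQHGeodesic Ω x y ℓ₁ γ₁ → IsQHGeodesic Ω y z ℓ₂ γ₂ → IsQHGeodesic Ω z x ℓ₃ γ₃ →
    ∀ u ∈ γ₁ '' Icc 0 ℓ₁, ∃ v ∈ γ₂ '' Icc 0 ℓ₂ ∪ γ₃ '' Icc 0 ℓ₃,
      qhDist Ω u v ≤ ENNReal.ofReal δ

/-- The Hausdorff `q`-content (`q > 0`): the infimum of `∑ rᵢ ^ q` over all countable coverings
of `E` by balls `B(xᵢ, rᵢ)`. Radius `0` gives the empty ball, so finite coverings are included. -/
def hausdorffContent {n : ℕ} (q : ℝ) (E : Set (EuclideanSpace ℝ (Fin n))) : ℝ≥0∞ :=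
  ⨅ (x : ℕ → EuclideanSpace ℝ (Fin n)) (r : ℕ → ℝ≥0)
    (_ : E ⊆ ⋃ i, Metric.ball (x i) (r i)), ∑' i, (r i : ℝ≥0∞) ^ q

/-- `G` is the weak (distributional) gradient of `u` on the open set `Ω`. -/
def IsWeakGradient {n : ℕ} (Ω : Set (EuclideanSpace ℝ (Fin n)))
    (u : EuclideanSpace ℝ (Fin n) → ℝ)
    (G : EuclideanSpace ℝ (Fin n) → EuclideanSpace ℝ (Fin n)) : Prop :=
  LocallyIntegrableOn u Ω ∧ LocallyIntegrableOn G Ω ∧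
    ∀ φ : EuclideanSpace ℝ (Fin n) → ℝ, ContDiff ℝ ∞ φ → HasCompactSupport φ → tsupport φ ⊆ Ω →
      ∀ i : Fin n, ∫ x in Ω, u x * fderiv ℝ φ x (EuclideanSpace.single i 1) =
        -∫ x in Ω, G x i * φ x

/-- `u ∈ W^{1,p}_loc(Ω)` with weak gradient `G`. -/
def MemW1pLoc {n : ℕ} (p : ℝ) (Ω : Set (EuclideanSpace ℝ (Fin n)))
    (u : EuclideanSpace ℝ (Fin n) → ℝ)
    (G : EuclideanSpace ℝ (Fin n) → EuclideanSpace ℝ (Fin n)) : Prop :=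
  IsWeakGradient Ω u G ∧ ∀ K ⊆ Ω, IsCompact K →
    MemLp u (ENNReal.ofReal p) (volume.restrict K) ∧
    MemLp G (ENNReal.ofReal p) (volume.restrict K)

/-- The `p`-capacity `cap_p(E, F, Ω)`: the infimum of `∫_Ω |∇u|^p` over all continuous
`u ∈ W^{1,p}_loc(Ω)` with `u ≤ 0` on `E` and `u ≥ 1` on `F`. -/
def capacity {n : ℕ} (p : ℝ) (E F Ω : Set (EuclideanSpace ℝ (Fin n))) : ℝ≥0∞ :=
  ⨅ (u : EuclideanSpace ℝ (Fin n) → ℝ)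
    (G : EuclideanSpace ℝ (Fin n) → EuclideanSpace ℝ (Fin n))
    (_ : ContinuousOn u Ω ∧ MemW1pLoc p Ω u G ∧ (∀ x ∈ E, u x ≤ 0) ∧ (∀ x ∈ F, 1 ≤ u x)),
    ∫⁻ x in Ω, ‖G x‖ₑ ^ p

/-- A closed cube with edges (of positive length) parallel to the coordinate axes. -/
def IsClosedCube {n : ℕ} (Q : Set (EuclideanSpace ℝ (Fin n))) : Prop :=
  ∃ (a : EuclideanSpace ℝ (Fin n)) (l : ℝ), 0 < l ∧ Q = {x | ∀ i, x i ∈ Icc (a i) (a i + l)}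

/-- The distance between two nonempty sets. -/
def setDist {n : ℕ} (A B : Set (EuclideanSpace ℝ (Fin n))) : ℝ :=
  sInf (image2 dist A B)

/-- `W` is a Whitney decomposition of `Ω`. -/
def IsWhitneyDecomposition {n : ℕ} (Ω : Set (EuclideanSpace ℝ (Fin n)))
    (W : Set (Set (EuclideanSpace ℝ (Fin n)))) : Prop :=
  (∀ Q ∈ W, IsClosedCube Q ∧ Q ⊆ Ω) ∧
  W.Pairwise (fun Q R => Disjoint (interior Q) (interior R)) ∧
  ⋃₀ W = Ω ∧
  (∀ Q ∈ W, ∃ j : ℤ, Metric.diam Q = (2 : ℝ) ^ (-j)) ∧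
  ∀ Q ∈ W, Metric.diam Q ≤ setDist Q (frontier Ω) ∧ setDist Q (frontier Ω) ≤ 4 * Metric.diam Q

end

/-! ### Distance to the boundary -/

/-! The domain is a self-similar tree of chambers and corridors. Above a cube of side `r` sit `m ^
n` cubes of side `θ * r`, with `θ = 1 / (8 * m)`, each joined to the large cube by a vertical
corridor, and the construction is repeated in every small cube. A corridor leaving a chamber of side
`r = θ ^ l` has length comparable to `r` and narrows to a width comparable to `r ^ s`.
`exists_pattern` shows that all chambers and corridors fit without touching.

John condition: on the way to the root the elapsed length is at most a constant times the scale `r`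
reached, because scales decay geometrically, while the narrowest passage met there still has width
about `r ^ s` (`Pattern.isSJohnDomain`).

Hyperbolicity: after subdivision of the corridors the domain is a union of convex boxes of bounded
shape, neighbours overlapping substantially and all others separated, and the adjacency graph is a
tree (`BoxTree`). Between two points one guesses a quasihyperbolic geodesic: rise from each point
towards the centre of its box, then follow the tree path of centres. These sets form slim triangles,
since tree paths do, and a system of slim connected sets must stay close to the geodesics
(`IsPathGuess.exists_thin`). Existence of geodesics is a compactness argument.

Capacity against content: let `lam` be the minimum in the theorem and let `E j` be a union of balls
in chambers of one generation, `N` in number and of scale `r`. A function that climbs from 0 to 1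
along each of the `N` corridors has energy about `N * r * (r ^ s) ^ (n - 1) / r ^ p = N * r ^ ((n -
1) * s + 1 - p)` (`Pattern.exists_capacity_core_le`). Lebesgue measure on the balls is spread evenly
over the tree of words, so the mass distribution principle bounds the `q`-content from below as soon
as `N * r ^ q` is bounded below (`Pattern.exists_le_hausdorffContent`). Since `lam < n`, there are
enough letters, for large `m`, to arrange `N` of order `r ^ (-lam) / j` in generation `j`
(`exists_letters`). The factor `1 / j` sends the capacity to zero even at the critical exponent and
is harmless for the content when `q < lam`, so one sequence serves all `q`. -/

theorem infDist_frontier_le_dist {E : Type*} [NormedAddCommGroup E] [NormedSpace ℝ E] {Ω : Set E}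
    {x z : E} (hx : x ∈ Ω) (hz : z ∉ Ω) : Metric.infDist x (frontier Ω) ≤ dist x z := by
  have hpre : IsPreconnected (segment ℝ x z) := (convex_segment x z).isPreconnected
  -- The segment is connected; if it missed the frontier it would be covered by the disjoint open
  -- sets `interior Ω` and `(closure Ω)ᶜ`, so its endpoint `z` would be in `Ω`.
  obtain ⟨w, hw, hwf⟩ : (segment ℝ x z ∩ frontier Ω).Nonempty := by
    by_contra hne
    rw [not_nonempty_iff_eq_empty] at hne
    have := hpre.subset_left_of_subset_union (u := interior Ω) (v := (closure Ω)ᶜ)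
      isOpen_interior isClosed_closure.isOpen_compl
      (disjoint_compl_right.mono_left interior_subset_closure)
      (fun w hw => by
        by_contra hcon
        simp only [mem_union, mem_compl_iff, not_or, not_not] at hcon
        exact (hne ▸ (⟨hw, hcon.2, hcon.1⟩ : w ∈ segment ℝ x z ∩ frontier Ω) : w ∈ (∅ : Set E)))
      ⟨x, left_mem_segment ℝ x z, by
        by_contra hcon
        exact (hne ▸ (⟨left_mem_segment ℝ x z, subset_closure hx, hcon⟩ :
          x ∈ segment ℝ x z ∩ frontier Ω) : x ∈ (∅ : Set E))⟩
    exact hz (interior_subset (this (right_mem_segment ℝ x z)))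
  refine (Metric.infDist_le_dist_of_mem hwf).trans ?_
  rw [segment_eq_image'] at hw
  obtain ⟨t, ht, rfl⟩ := hw
  rw [dist_eq_norm, dist_eq_norm]
  have : x - (x + t • (z - x)) = t • (x - z) := by module
  rw [this, norm_smul, Real.norm_eq_abs, abs_of_nonneg ht.1]
  exact mul_le_of_le_one_left (norm_nonneg _) ht.2

theorem le_infDist_frontier_of_ball_subset {E : Type*} [PseudoMetricSpace E] {Ω : Set E}
    (ho : IsOpen Ω) (hf : (frontier Ω).Nonempty) {x : E} {ρ : ℝ} (h : Metric.ball x ρ ⊆ Ω) :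
    ρ ≤ Metric.infDist x (frontier Ω) := by
  rw [Metric.le_infDist hf]
  intro w hw
  by_contra hlt
  have hwΩ : w ∈ Ω := h (by rw [Metric.mem_ball, dist_comm]; exact not_le.1 hlt)
  rw [ho.frontier_eq] at hw
  exact hw.2 hwΩ

theorem infDist_frontier_pos {E : Type*} [PseudoMetricSpace E] {Ω : Set E}
    (ho : IsOpen Ω) (hf : (frontier Ω).Nonempty) {x : E} (hx : x ∈ Ω) :
    0 < Metric.infDist x (frontier Ω) := by
  obtain ⟨ε, hε, hb⟩ := Metric.isOpen_iff.1 ho x hx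
  exact hε.trans_le (le_infDist_frontier_of_ball_subset ho hf hb)

theorem ball_infDist_frontier_subset {E : Type*} [NormedAddCommGroup E] [NormedSpace ℝ E]
    {Ω : Set E} {x : E} (hx : x ∈ Ω) : Metric.ball x (Metric.infDist x (frontier Ω)) ⊆ Ω := by
  intro z hz
  by_contra hzΩ
  have := infDist_frontier_le_dist hx hzΩ
  rw [Metric.mem_ball, dist_comm] at hz
  linarith

/-! ### Unit speed curves -/

section UnitSpeed

variable {E : Type*} [PseudoEMetricSpace E] {f g : ℝ → E}

theorem HasUnitSpeedOn.congr {s : Set ℝ} (h : HasUnitSpeedOn f s) (hfg : EqOn f g s) :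
    HasUnitSpeedOn g s := by
  intro x hx y hy
  rw [← eVariationOn.congr (hfg.mono inter_subset_left)]
  exact h hx hy

theorem HasUnitSpeedOn.mono {s t : Set ℝ} (h : HasUnitSpeedOn f t) (hst : s ⊆ t) [s.OrdConnected] 
    [t.OrdConnected] : HasUnitSpeedOn f s := by
  intro x hx y hy
  have h1 : s ∩ Icc x y = t ∩ Icc x y := by
    rw [inter_eq_right.2 (Set.OrdConnected.out ‹_› hx hy),
      inter_eq_right.2 (Set.OrdConnected.out ‹_› (hst hx) (hst hy))]
  rw [h1]
  exact h (hst hx) (hst hy)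

theorem HasUnitSpeedOn.comp_const_add {c d : ℝ} (h : HasUnitSpeedOn f (Icc c d)) (a : ℝ) :
    HasUnitSpeedOn (fun t => f (a + t)) (Icc (c - a) (d - a)) := by
  intro x hx y hy
  have hm : MonotoneOn (fun t : ℝ => a + t) (Icc (c - a) (d - a) ∩ Icc x y) :=
    fun u _ v _ huv => by simpa using huv
  have := eVariationOn.comp_eq_of_monotoneOn f (fun t : ℝ => a + t) hm
  rw [show (fun t => f (a + t)) = f ∘ (fun t : ℝ => a + t) from rfl, this, image_inter
    (add_right_injective a), image_const_add_Icc, image_const_add_Icc, add_sub_cancel,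
    add_sub_cancel, h ⟨by linarith [hx.1], by linarith [hx.2]⟩ ⟨by linarith [hy.1], by linarith [hy.2]⟩]
  ring_nf

theorem HasUnitSpeedOn.comp_const_sub {c d : ℝ} (h : HasUnitSpeedOn f (Icc c d)) (a : ℝ) :
    HasUnitSpeedOn (fun t => f (a - t)) (Icc (a - d) (a - c)) := by
  intro x hx y hy
  have hm : AntitoneOn (fun t : ℝ => a - t) (Icc (a - d) (a - c) ∩ Icc x y) :=
    fun u _ v _ huv => sub_le_sub_left huv a
  have := eVariationOn.comp_eq_of_antitoneOn f (fun t : ℝ => a - t) hm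
  rw [show (fun t => f (a - t)) = f ∘ (fun t : ℝ => a - t) from rfl, this, image_inter
    (sub_right_injective), image_const_sub_Icc, image_const_sub_Icc, sub_sub_cancel,
    sub_sub_cancel, h ⟨by linarith [hy.2], by linarith [hy.1]⟩ ⟨by linarith [hx.2], by linarith [hx.1]⟩]
  ring_nf

theorem edist_le_of_hasUnitSpeedOn {s : Set ℝ} (h : HasUnitSpeedOn f s) {a b : ℝ}
    (ha : a ∈ s) (hb : b ∈ s) (hab : a ≤ b) : edist (f a) (f b) ≤ ENNReal.ofReal (b - a) := by
  have := h ha hb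
  rw [NNReal.coe_one, one_mul] at this
  rw [← this]
  exact eVariationOn.edist_le f ⟨ha, le_rfl, hab⟩ ⟨hb, hab, le_rfl⟩

/-- The variation sums of an isometric embedding are those of the identity, which is monotone. -/
theorem hasUnitSpeedOn_of_edist_eq {s : Set ℝ}
    (h : ∀ a ∈ s, ∀ b ∈ s, edist (f a) (f b) = edist a b) : HasUnitSpeedOn f s := by
  rw [HasUnitSpeedOn, hasConstantSpeedOnWith_iff_ordered]
  intro x hx y hy hxy
  have h1 : eVariationOn f (s ∩ Icc x y) = eVariationOn (fun t : ℝ => t) (s ∩ Icc x y) := by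
    unfold eVariationOn
    congr 1
    ext p
    refine Finset.sum_congr rfl fun i _ => ?_
    rw [h _ (p.2.2.2 _).1 _ (p.2.2.2 _).1]
  rw [h1, NNReal.coe_one, one_mul]
  exact (monotoneOn_id (s := s)).eVariationOn_eq hx hy

end UnitSpeed

theorem setLIntegral_Icc_const_add (f : ℝ → ℝ≥0∞) (a c d : ℝ) :
    ∫⁻ t in Icc (c - a) (d - a), f (a + t) = ∫⁻ t in Icc c d, f t := by
  have h := (measurePreserving_add_left (volume : Measure ℝ) a).setLIntegral_comp_preimage_emb
    (MeasurableEquiv.addLeft a).measurableEmbedding f (Icc c d)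
  rw [← h, preimage_const_add_Icc]

theorem setLIntegral_Icc_const_sub (f : ℝ → ℝ≥0∞) (a c d : ℝ) :
    ∫⁻ t in Icc (a - d) (a - c), f (a - t) = ∫⁻ t in Icc c d, f t := by
  have h := (Measure.measurePreserving_sub_left (volume : Measure ℝ) a).setLIntegral_comp_preimage_emb
    (MeasurableEquiv.subLeft a).measurableEmbedding f (Icc c d)
  rw [← h, preimage_const_sub_Icc]

/-! ### The quasihyperbolic distance -/

section QH

variable {n : ℕ} {Ω : Set (EuclideanSpace ℝ (Fin n))}

/-- An arc length parametrized curve in `Ω` from `x` to `y` of length `L`. -/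
def IsQHCurve (Ω : Set (EuclideanSpace ℝ (Fin n))) (x y : EuclideanSpace ℝ (Fin n)) (L : ℝ)
    (γ : ℝ → EuclideanSpace ℝ (Fin n)) : Prop :=
  0 ≤ L ∧ HasUnitSpeedOn γ (Icc 0 L) ∧ MapsTo γ (Icc 0 L) Ω ∧ γ 0 = x ∧ γ L = y

/-- The quasihyperbolic density. -/
noncomputable def qhDensity (Ω : Set (EuclideanSpace ℝ (Fin n))) (z : EuclideanSpace ℝ (Fin n)) :
    ℝ≥0∞ := (ENNReal.ofReal (Metric.infDist z (frontier Ω)))⁻¹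

variable {x y z : EuclideanSpace ℝ (Fin n)} {L : ℝ} {γ : ℝ → EuclideanSpace ℝ (Fin n)}

theorem qhDist_le_lintegral (h : IsQHCurve Ω x y L γ) :
    qhDist Ω x y ≤ ∫⁻ t in Icc 0 L, qhDensity Ω (γ t) :=
  iInf_le_of_le L (iInf_le_of_le γ (iInf_le_of_le h le_rfl))

theorem exists_isQHCurve_of_qhDist_lt {a : ℝ≥0∞} (h : qhDist Ω x y < a) :
    ∃ L γ, IsQHCurve Ω x y L γ ∧ ∫⁻ t in Icc 0 L, qhDensity Ω (γ t) < a := by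
  unfold qhDist at h
  simp only [iInf_lt_iff] at h
  obtain ⟨L, γ, hγ, hlt⟩ := h
  exact ⟨L, γ, hγ, hlt⟩

theorem le_qhDist {a : ℝ≥0∞}
    (h : ∀ L γ, IsQHCurve Ω x y L γ → a ≤ ∫⁻ t in Icc 0 L, qhDensity Ω (γ t)) :
    a ≤ qhDist Ω x y :=
  le_iInf fun L => le_iInf fun γ => le_iInf fun hγ => h L γ hγ

theorem IsQHCurve.sub (h : IsQHCurve Ω x y L γ) {a b : ℝ} (ha : 0 ≤ a) (hab : a ≤ b) (hb : b ≤ L) :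
    IsQHCurve Ω (γ a) (γ b) (b - a) (fun t => γ (a + t)) := by
  refine ⟨sub_nonneg.2 hab, ?_, ?_, by simp, by simp⟩
  · have := (h.2.1.mono (Icc_subset_Icc ha hb)).comp_const_add a
    rwa [sub_self] at this
  · intro t ht
    exact h.2.2.1 ⟨by linarith [ht.1], by linarith [ht.2]⟩

theorem IsQHCurve.qhDist_sub_le (h : IsQHCurve Ω x y L γ) {a b : ℝ} (ha : 0 ≤ a) (hab : a ≤ b)
    (hb : b ≤ L) : qhDist Ω (γ a) (γ b) ≤ ∫⁻ t in Icc a b, qhDensity Ω (γ t) := by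
  refine (qhDist_le_lintegral (h.sub ha hab hb)).trans_eq ?_
  have := setLIntegral_Icc_const_add (fun t => qhDensity Ω (γ t)) a a b
  rwa [sub_self] at this

theorem IsQHCurve.reverse (h : IsQHCurve Ω x y L γ) : IsQHCurve Ω y x L (fun t => γ (L - t)) := by
  refine ⟨h.1, ?_, fun t ht => h.2.2.1 ⟨by linarith [ht.2], by linarith [ht.1]⟩, by simp [h.2.2.2.2],
    by simp [h.2.2.2.1]⟩
  have := h.2.1.comp_const_sub L
  rwa [sub_self, sub_zero] at this

theorem qhDist_comm_le : qhDist Ω x y ≤ qhDist Ω y x := by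
  refine le_qhDist fun L γ h => (qhDist_le_lintegral h.reverse).trans_eq ?_
  have := setLIntegral_Icc_const_sub (fun t => qhDensity Ω (γ t)) L 0 L
  rwa [sub_self, sub_zero] at this

theorem qhDist_comm : qhDist Ω x y = qhDist Ω y x := le_antisymm qhDist_comm_le qhDist_comm_le

theorem IsQHCurve.trans {L₁ L₂ : ℝ} {γ₁ γ₂ : ℝ → EuclideanSpace ℝ (Fin n)}
    (h₁ : IsQHCurve Ω x y L₁ γ₁) (h₂ : IsQHCurve Ω y z L₂ γ₂) :
    ∃ γ, IsQHCurve Ω x z (L₁ + L₂) γ ∧ ∫⁻ t in Icc 0 (L₁ + L₂), qhDensity Ω (γ t) ≤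
      (∫⁻ t in Icc 0 L₁, qhDensity Ω (γ₁ t)) + ∫⁻ t in Icc 0 L₂, qhDensity Ω (γ₂ t) := by
  obtain ⟨hL₁, hs₁, hm₁, hx, hy⟩ := h₁
  obtain ⟨hL₂, hs₂, hm₂, hy', hz⟩ := h₂
  set γ : ℝ → EuclideanSpace ℝ (Fin n) := fun t => if t ≤ L₁ then γ₁ t else γ₂ (-L₁ + t) with hγ
  have e₁ : EqOn γ₁ γ (Icc 0 L₁) := fun t ht => by simp [hγ, ht.2]
  have e₂ : EqOn (fun t => γ₂ (-L₁ + t)) γ (Icc L₁ (L₁ + L₂)) := fun t ht => by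
    -- At the junction `t = L₁` the glued curve is defined by its first branch, so the common
    -- endpoint `y` is needed there.
    rcases ht.1.eq_or_lt with h | h
    · simp [hγ, ← h, hy, hy']
    · simp [hγ, not_le.2 h]
  have hs₂' := hs₂.comp_const_add (-L₁)
  rw [zero_sub, neg_neg, sub_neg_eq_add, add_comm] at hs₂'
  have hu : Icc 0 L₁ ∪ Icc L₁ (L₁ + L₂) = Icc 0 (L₁ + L₂) :=
    Icc_union_Icc_eq_Icc hL₁ (by linarith)
  refine ⟨γ, ⟨by linarith, (hs₁.congr e₁).Icc_Icc (hs₂'.congr e₂), ?_, ?_, ?_⟩, ?_⟩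
  · rw [← hu]
    rintro t (ht | ht)
    · rw [← e₁ ht]; exact hm₁ ht
    · rw [← e₂ ht]; exact hm₂ ⟨by linarith [ht.1], by linarith [ht.2]⟩
  · rw [← e₁ ⟨le_rfl, hL₁⟩, hx]
  · rw [← e₂ ⟨by linarith, le_rfl⟩]; simp [hz]
  · rw [← hu]
    refine (lintegral_union_le _ _ _).trans (add_le_add (le_of_eq ?_) (le_of_eq ?_))
    · exact setLIntegral_congr_fun measurableSet_Icc fun t ht => by simp only [← e₁ ht]
    · rw [← setLIntegral_Icc_const_add _ (-L₁) 0 L₂, zero_sub, neg_neg, sub_neg_eq_add, add_comm L₂]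
      exact setLIntegral_congr_fun measurableSet_Icc fun t ht => by simp only [← e₂ ht]

theorem qhDist_triangle : qhDist Ω x z ≤ qhDist Ω x y + qhDist Ω y z := by
  by_contra hlt
  rw [not_le] at hlt
  obtain ⟨a, b, ha, hb, hab⟩ : ∃ a b, qhDist Ω x y < a ∧ qhDist Ω y z < b ∧ a + b ≤ qhDist Ω x z := by
    have h1 : qhDist Ω x y ≠ ⊤ := fun h => by simp [h] at hlt
    have h2 : qhDist Ω y z ≠ ⊤ := fun h => by simp [h] at hlt
    obtain ⟨c, hc, hc'⟩ := exists_between hlt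
    obtain ⟨ε, hε, hε'⟩ := ENNReal.lt_iff_exists_add_pos_lt.1 hlt
    have hε2 : ((ε / 2 : ℝ≥0) : ℝ≥0∞) ≠ 0 := by simpa using hε.ne'
    refine ⟨_, _, ENNReal.lt_add_right h1 hε2, ENNReal.lt_add_right h2 hε2, ?_⟩
    calc _ = qhDist Ω x y + qhDist Ω y z + ((ε / 2 + ε / 2 : ℝ≥0) : ℝ≥0∞) := by push_cast; ring
      _ ≤ _ := by rw [add_halves]; exact hε'.le
  obtain ⟨L₁, γ₁, h₁, hl₁⟩ := exists_isQHCurve_of_qhDist_lt ha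
  obtain ⟨L₂, γ₂, h₂, hl₂⟩ := exists_isQHCurve_of_qhDist_lt hb
  obtain ⟨γ, h, hl⟩ := h₁.trans h₂
  have := (qhDist_le_lintegral h).trans hl
  exact absurd (this.trans_lt (ENNReal.add_lt_add hl₁ hl₂)) (not_lt.2 hab)

theorem IsQHCurve.dist_le (h : IsQHCurve Ω x y L γ) {t : ℝ} (ht : t ∈ Icc 0 L) :
    dist x (γ t) ≤ t := by
  have := edist_le_of_hasUnitSpeedOn h.2.1 ⟨le_rfl, h.1⟩ ht ht.1
  rw [h.2.2.2.1, sub_zero, edist_dist] at this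
  exact (ENNReal.ofReal_le_ofReal_iff ht.1).1 this

/-- The distance to the frontier is 1-Lipschitz, so after length `t` the density is at least `1 / (d
+ t)`, whose integral is the logarithm. This is the source of all Euclidean bounds drawn from
quasihyperbolic ones. -/
theorem IsQHCurve.log_le_lintegral (h : IsQHCurve Ω x y L γ)
    (hd : 0 < Metric.infDist x (frontier Ω)) :
    ENNReal.ofReal (Real.log (1 + L / Metric.infDist x (frontier Ω))) ≤
      ∫⁻ t in Icc 0 L, qhDensity Ω (γ t) := by
  set d := Metric.infDist x (frontier Ω) with hdef
  have h1 : ∀ t ∈ Icc 0 L, ENNReal.ofReal (d + t)⁻¹ ≤ qhDensity Ω (γ t) := by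
    intro t ht
    rw [ENNReal.ofReal_inv_of_pos (by linarith [ht.1]), qhDensity]
    refine ENNReal.inv_le_inv.2 (ENNReal.ofReal_le_ofReal ?_)
    calc _ ≤ Metric.infDist x (frontier Ω) + dist (γ t) x := Metric.infDist_le_infDist_add_dist
      _ ≤ d + t := by rw [dist_comm]; gcongr; exact h.dist_le ht
  refine le_trans (le_of_eq ?_) (setLIntegral_mono' measurableSet_Icc h1)
  have hcont : ContinuousOn (fun t : ℝ => (d + t)⁻¹) (Icc 0 L) :=
    ContinuousOn.inv₀ (by fun_prop) fun t ht => by linarith [ht.1]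
  rw [← ofReal_integral_eq_lintegral_ofReal hcont.integrableOn_Icc]
  · congr 1
    rw [integral_Icc_eq_integral_Ioc, ← intervalIntegral.integral_of_le h.1]
    have := intervalIntegral.integral_comp_add_left (a := 0) (b := L) (fun t : ℝ => t⁻¹) d
    rw [this, integral_inv_of_pos (by linarith) (by linarith [h.1])]
    congr 1
    field_simp
    ring
  · filter_upwards [ae_restrict_mem measurableSet_Icc] with t ht
    exact inv_nonneg.2 (by linarith [ht.1])

theorem IsQHCurve.length_le (h : IsQHCurve Ω x y L γ)
    (hd : 0 < Metric.infDist x (frontier Ω)) {ρ : ℝ} (hρ : 0 ≤ ρ)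
    (hl : ∫⁻ t in Icc 0 L, qhDensity Ω (γ t) ≤ ENNReal.ofReal ρ) :
    L ≤ (Real.exp ρ - 1) * Metric.infDist x (frontier Ω) := by
  have := (h.log_le_lintegral hd).trans hl
  rw [ENNReal.ofReal_le_ofReal_iff hρ, Real.log_le_iff_le_exp (by have := h.1; positivity)] at this
  rw [← div_le_iff₀ hd]
  linarith

/-- The inequality is strict because the bound is read off from a competing curve, and the infimum
need not be attained. -/
theorem dist_le_of_qhDist_lt (hd : 0 < Metric.infDist x (frontier Ω)) {ρ : ℝ} (hρ : 0 ≤ ρ)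
    (h : qhDist Ω x y < ENNReal.ofReal ρ) :
    dist x y ≤ (Real.exp ρ - 1) * Metric.infDist x (frontier Ω) := by
  obtain ⟨L, γ, hγ, hl⟩ := exists_isQHCurve_of_qhDist_lt h
  have := hγ.dist_le ⟨hγ.1, le_rfl⟩
  rw [hγ.2.2.2.2] at this
  exact this.trans (hγ.length_le hd hρ hl.le)

theorem infDist_frontier_le_of_qhDist_lt (hd : 0 < Metric.infDist y (frontier Ω)) {ρ : ℝ}
    (hρ : 0 ≤ ρ) (h : qhDist Ω x y < ENNReal.ofReal ρ) :
    Metric.infDist x (frontier Ω) ≤ Real.exp ρ * Metric.infDist y (frontier Ω) := by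
  have h1 := dist_le_of_qhDist_lt hd hρ (by rwa [qhDist_comm])
  have h2 : Metric.infDist x (frontier Ω) ≤ Metric.infDist y (frontier Ω) + dist x y :=
    Metric.infDist_le_infDist_add_dist
  rw [dist_comm] at h1
  linarith

theorem isQHCurve_segment (hseg : segment ℝ x y ⊆ Ω) :
    ∃ γ, IsQHCurve Ω x y (dist x y) γ ∧ MapsTo γ (Icc 0 (dist x y)) (segment ℝ x y) := by
  rcases eq_or_ne x y with rfl | hxy
  · refine ⟨fun _ => x, ⟨dist_nonneg, ?_, fun t _ => hseg (left_mem_segment ℝ x x), rfl, rfl⟩,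
      fun t _ => left_mem_segment ℝ x x⟩
    rw [dist_self, Icc_self]
    exact hasConstantSpeedOnWith_of_subsingleton _ subsingleton_singleton _
  · have hpos : 0 < dist x y := dist_pos.2 hxy
    have hn : ‖y - x‖ = dist x y := by rw [dist_comm, dist_eq_norm]
    have hm : MapsTo (fun t : ℝ => x + (t / dist x y) • (y - x)) (Icc 0 (dist x y))
        (segment ℝ x y) := by
      intro t ht
      rw [segment_eq_image']
      exact ⟨t / dist x y, ⟨div_nonneg ht.1 hpos.le, (div_le_one hpos).2 ht.2⟩, rfl⟩
    refine ⟨_, ⟨hpos.le, hasUnitSpeedOn_of_edist_eq ?_, fun t ht => hseg (hm ht), by simp, ?_⟩, hm⟩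
    · intro a _ b _
      rw [edist_dist, edist_dist, dist_eq_norm, Real.dist_eq]
      congr 1
      have : x + (a / dist x y) • (y - x) - (x + (b / dist x y) • (y - x))
          = ((a - b) / dist x y) • (y - x) := by module
      rw [this, norm_smul, hn, Real.norm_eq_abs, abs_div, abs_of_pos hpos]
      field_simp
    · simp only [div_self hpos.ne', one_smul, add_sub_cancel]

theorem qhDist_le_of_segment {ρ : ℝ} (hρ : 0 < ρ) (hseg : segment ℝ x y ⊆ Ω)
    (h : ∀ w ∈ segment ℝ x y, ρ ≤ Metric.infDist w (frontier Ω)) :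
    qhDist Ω x y ≤ ENNReal.ofReal (dist x y / ρ) := by
  obtain ⟨γ, hγ, hm⟩ := isQHCurve_segment hseg
  refine (qhDist_le_lintegral hγ).trans ?_
  have h1 : ∀ t ∈ Icc 0 (dist x y), qhDensity Ω (γ t) ≤ (ENNReal.ofReal ρ)⁻¹ := fun t ht =>
    ENNReal.inv_le_inv.2 (ENNReal.ofReal_le_ofReal (h _ (hm ht)))
  refine (setLIntegral_mono' measurableSet_Icc h1).trans_eq ?_
  rw [setLIntegral_const, Real.volume_Icc, sub_zero, ENNReal.ofReal_div_of_pos hρ, mul_comm,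
    div_eq_mul_inv]

/-- A point near `w` differs from it by a small vector `e`; translating both endpoints by `e` keeps
them in `V`, and convexity does the rest. -/
theorem ball_subset_of_mem_segment {E : Type*} [NormedAddCommGroup E] [NormedSpace ℝ E] {V : Set E}
    (hV : Convex ℝ V) {x y w : E} {ρ : ℝ} (hx : Metric.ball x ρ ⊆ V) (hy : Metric.ball y ρ ⊆ V)
    (hw : w ∈ segment ℝ x y) : Metric.ball w ρ ⊆ V := by
  obtain ⟨a, b, ha, hb, hab, rfl⟩ := hw
  intro v hv
  rw [Metric.mem_ball, dist_eq_norm] at hv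
  set e := v - (a • x + b • y)
  have h1 : x + e ∈ V := hx (by simpa [dist_eq_norm] using hv)
  have h2 : y + e ∈ V := hy (by simpa [dist_eq_norm] using hv)
  have : v = a • (x + e) + b • (y + e) := by
    have h3 : a • (x + e) + b • (y + e) = a • x + b • y + (a + b) • e := by module
    rw [h3, hab, one_smul]; simp [e]
  rw [this]
  exact hV h1 h2 ha hb hab

theorem qhDist_le_of_convex (ho : IsOpen Ω) (hf : (frontier Ω).Nonempty)
    {V : Set (EuclideanSpace ℝ (Fin n))} (hV : Convex ℝ V) (hVΩ : V ⊆ Ω) {ρ : ℝ} (hρ : 0 < ρ)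
    (hx : Metric.ball x ρ ⊆ V) (hy : Metric.ball y ρ ⊆ V) :
    qhDist Ω x y ≤ ENNReal.ofReal (dist x y / ρ) := by
  have hb := fun w hw => ball_subset_of_mem_segment hV hx hy (w := w) hw
  exact qhDist_le_of_segment hρ (fun w hw => hVΩ (hb w hw (Metric.mem_ball_self hρ)))
    fun w hw => le_infDist_frontier_of_ball_subset ho hf ((hb w hw).trans hVΩ)

theorem qhDist_le_of_dist_le_half (ho : IsOpen Ω) (hf : (frontier Ω).Nonempty) (hx : x ∈ Ω)
    (h : dist x y ≤ Metric.infDist x (frontier Ω) / 2) :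
    qhDist Ω x y ≤ ENNReal.ofReal (2 * dist x y / Metric.infDist x (frontier Ω)) := by
  have hd := infDist_frontier_pos ho hf hx
  set d := Metric.infDist x (frontier Ω)
  have hsub := ball_infDist_frontier_subset hx
  refine (qhDist_le_of_convex ho hf (convex_ball x d) hsub (half_pos hd)
    (Metric.ball_subset_ball (by linarith)) (Metric.ball_subset_ball' ?_)).trans_eq ?_
  · rw [dist_comm]; linarith
  · congr 1; field_simp

theorem qhDist_self (hx : x ∈ Ω) : qhDist Ω x x = 0 := by
  have h : IsQHCurve Ω x x 0 (fun _ => x) := ⟨le_rfl, by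
    rw [Icc_self]
    exact hasConstantSpeedOnWith_of_subsingleton _ subsingleton_singleton _, fun _ _ => hx, rfl, rfl⟩
  have := qhDist_le_lintegral h
  simpa using this

end QH

/-! ### Guessing geodesics -/

section Guess

variable {X : Type*} {K : X → X → ℝ} {S : Set X}

/-- `γ : [0, ℓ] → S` is a geodesic for `K`. -/
def IsGeodOn (K : X → X → ℝ) (S : Set X) (ℓ : ℝ) (γ : ℝ → X) : Prop :=
  0 ≤ ℓ ∧ MapsTo γ (Icc 0 ℓ) S ∧ ∀ a ∈ Icc (0 : ℝ) ℓ, ∀ b ∈ Icc (0 : ℝ) ℓ, K (γ a) (γ b) = |a - b|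

theorem IsGeodOn.sub {ℓ : ℝ} {γ : ℝ → X} (h : IsGeodOn K S ℓ γ) {a b : ℝ} (ha : 0 ≤ a)
    (hab : a ≤ b) (hb : b ≤ ℓ) : IsGeodOn K S (b - a) (fun t => γ (a + t)) := by
  refine ⟨sub_nonneg.2 hab, fun t ht => h.2.1 ⟨by linarith [ht.1], by linarith [ht.2]⟩,
    fun s hs t ht => ?_⟩
  rw [h.2.2 _ ⟨by linarith [hs.1], by linarith [hs.2]⟩ _ ⟨by linarith [ht.1], by linarith [ht.2]⟩]
  congr 1; ring

theorem IsGeodOn.reverse {ℓ : ℝ} {γ : ℝ → X} (h : IsGeodOn K S ℓ γ) :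
    IsGeodOn K S ℓ (fun t => γ (ℓ - t)) := by
  refine ⟨h.1, fun t ht => h.2.1 ⟨by linarith [ht.2], by linarith [ht.1]⟩, fun s hs t ht => ?_⟩
  rw [h.2.2 _ ⟨by linarith [hs.2], by linarith [hs.1]⟩ _ ⟨by linarith [ht.2], by linarith [ht.1]⟩,
    abs_sub_comm]
  congr 1; ring

/-- A system of slim, coarsely connected sets `η x y` joining pairs of points. -/
structure IsPathGuess (K : X → X → ℝ) (S : Set X) (η : X → X → Set X) (ε h : ℝ) : Prop where
  nonneg : ∀ x ∈ S, ∀ y ∈ S, 0 ≤ K x y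
  symm : ∀ x ∈ S, ∀ y ∈ S, K x y = K y x
  triangle : ∀ x ∈ S, ∀ y ∈ S, ∀ z ∈ S, K x z ≤ K x y + K y z
  self : ∀ x ∈ S, K x x = 0
  eps_pos : 0 < ε
  h_nonneg : 0 ≤ h
  sub : ∀ x ∈ S, ∀ y ∈ S, η x y ⊆ S
  small : ∀ x ∈ S, ∀ y ∈ S, K x y ≤ ε → ∀ w ∈ η x y, K w x ≤ h
  slim : ∀ x ∈ S, ∀ y ∈ S, ∀ z ∈ S, ∀ w ∈ η x y, ∃ w' ∈ η x z ∪ η z y, K w w' ≤ h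
  chain : ∀ x ∈ S, ∀ y ∈ S, ∃ (N : ℕ) (f : ℕ → X), f 0 = x ∧ f N = y ∧ (∀ i ≤ N, f i ∈ η x y) ∧
    ∀ i < N, K (f i) (f (i + 1)) ≤ h

variable {η : X → X → Set X} {ε h : ℝ}

/-- Bisect the geodesic `m` times. Each bisection costs one application of slimness, and pieces of
length at most `ε` are handled by `small`. The bound is only logarithmic in the length; the next
lemmas remove that dependence. -/
theorem IsPathGuess.exists_near_of_length_le (H : IsPathGuess K S η ε h) {ℓ : ℝ} {γ : ℝ → X}
    (hγ : IsGeodOn K S ℓ γ) (m : ℕ) : ∀ a b : ℝ, 0 ≤ a → a ≤ b → b ≤ ℓ → b - a ≤ 2 ^ m * ε →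
    ∀ w ∈ η (γ a) (γ b), ∃ c ∈ Icc a b, K w (γ c) ≤ h * (m + 1) := by
  induction m with
  | zero =>
    intro a b ha hab hb hle w hw
    refine ⟨a, ⟨le_rfl, hab⟩, ?_⟩
    have := H.small _ (hγ.2.1 ⟨ha, hab.trans hb⟩) _ (hγ.2.1 ⟨ha.trans hab, hb⟩) (by
      rw [hγ.2.2 _ ⟨ha, hab.trans hb⟩ _ ⟨ha.trans hab, hb⟩, abs_sub_comm,
        abs_of_nonneg (sub_nonneg.2 hab)]
      simpa using hle) w hw
    simpa using this
  | succ m ih =>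
    intro a b ha hab hb hle w hw
    rw [pow_succ] at hle
    have hc1 : a ≤ (a + b) / 2 := by linarith
    have hc2 : (a + b) / 2 ≤ b := by linarith
    have haS := hγ.2.1 (⟨ha, hab.trans hb⟩ : a ∈ Icc 0 ℓ)
    have hbS := hγ.2.1 (⟨ha.trans hab, hb⟩ : b ∈ Icc 0 ℓ)
    have hcS := hγ.2.1 (⟨ha.trans hc1, hc2.trans hb⟩ : (a + b) / 2 ∈ Icc 0 ℓ)
    have hwS := H.sub _ haS _ hbS hw
    obtain ⟨w', hw', hk⟩ := H.slim _ haS _ hbS _ hcS w hw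
    push_cast
    rcases hw' with hw' | hw'
    · obtain ⟨c, hc, hcK⟩ := ih _ _ ha hc1 (hc2.trans hb) (by linarith) w' hw'
      refine ⟨c, ⟨hc.1, hc.2.trans hc2⟩, ?_⟩
      have := H.triangle w hwS w' (H.sub _ haS _ hcS hw') (γ c)
        (hγ.2.1 ⟨ha.trans hc.1, hc.2.trans (hc2.trans hb)⟩)
      linarith
    · obtain ⟨c, hc, hcK⟩ := ih _ _ (ha.trans hc1) hc2 hb (by linarith) w' hw'
      refine ⟨c, ⟨hc1.trans hc.1, hc.2⟩, ?_⟩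
      have := H.triangle w hwS w' (H.sub _ hcS _ hbS hw') (γ c)
        (hγ.2.1 ⟨(ha.trans hc1).trans hc.1, hc.2.trans hb⟩)
      linarith

/-- With `m` the least integer such that `2 ^ m * ε` dominates `8 * t + 2`, the inequality `t ≤ h *
(m + 3)` says that `t` is at most logarithmic in itself, hence bounded. Here `8 * t + 2` is the
length of the window cut out around a nearest point below, and `m + 3` counts the `m + 1` steps of
the bisection bound and two further slimness steps. -/
theorem exists_bound_of_le_mul_log {ε h : ℝ} (hε : 0 < ε) : ∃ t₁ : ℝ, ∀ t : ℝ, 0 ≤ t →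
    ∃ m : ℕ, 8 * t + 2 ≤ 2 ^ m * ε ∧ (t ≤ h * (m + 3) → t ≤ t₁) := by
  have hlim : Tendsto (fun m : ℕ => (8 * h * (m + 4) + 2) / 2 ^ m) atTop (𝓝 0) := by
    have h1 : Tendsto (fun m : ℕ => (m : ℝ) ^ 1 / 2 ^ m) atTop (𝓝 0) :=
      tendsto_pow_const_div_const_pow_of_one_lt 1 (by norm_num)
    have h2 : Tendsto (fun m : ℕ => (m : ℝ) ^ 0 / 2 ^ m) atTop (𝓝 0) :=
      tendsto_pow_const_div_const_pow_of_one_lt 0 (by norm_num)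
    have h3 := (h1.const_mul (8 * h)).add (h2.const_mul (32 * h + 2))
    simp only [mul_zero, add_zero] at h3
    refine h3.congr fun m => ?_
    field_simp
    ring
  obtain ⟨m₀, hm₀⟩ := eventually_atTop.1 (hlim.eventually (gt_mem_nhds hε))
  have hex : ∀ t : ℝ, ∃ m : ℕ, 8 * t + 2 ≤ 2 ^ m * ε := by
    intro t
    obtain ⟨m, hm⟩ := pow_unbounded_of_one_lt ((8 * t + 2) / ε) (one_lt_two)
    exact ⟨m, ((div_lt_iff₀ hε).1 hm).le⟩
  refine ⟨max (|h| * (m₀ + 3)) 0, fun t ht => ?_⟩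
  classical
  refine ⟨Nat.find (hex t), Nat.find_spec (hex t), fun hle => ?_⟩
  set m := Nat.find (hex t) with hm
  rcases le_or_gt m m₀ with hmm | hmm
  · refine hle.trans (le_max_of_le_left ?_)
    have : (m : ℝ) ≤ m₀ := by exact_mod_cast hmm
    gcongr
    exact le_abs_self h
  · exfalso
    have hnot := Nat.find_min (hex t) (m := m - 1) (by omega)
    have hbd := hm₀ (m - 1) (by omega)
    rw [div_lt_iff₀ (by positivity)] at hbd
    rw [not_le] at hnot
    have : ((m - 1 : ℕ) : ℝ) = m - 1 := by rw [Nat.cast_sub (by omega)]; simp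
    rw [this] at hbd
    linarith

/-- Bootstrapping: a point `w` of the guess at distance `t` from the geodesic is compared with
guesses over three pieces, a window of length about `8 * t` around a point nearly nearest to `w` and
the two remainders. The window gives the logarithmic bound. The remainders are at distance at least
`3 * t` from `w`, so any bound valid for them yields a third of it for `t`, up to constants. -/
theorem IsPathGuess.exists_bound_guess_near_geodesic (H : IsPathGuess K S η ε h) :
    ∃ t₀ : ℝ, 0 ≤ t₀ ∧ ∀ ℓ γ, IsGeodOn K S ℓ γ → ∀ w ∈ η (γ 0) (γ ℓ),
      ∃ c ∈ Icc 0 ℓ, K w (γ c) ≤ t₀ := by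
  obtain ⟨t₁, ht₁⟩ := exists_bound_of_le_mul_log (h := h) H.eps_pos
  have hh := H.h_nonneg
  set C := max t₁ 0 + 3 * h + 2 with hC
  have ht₁C : t₁ ≤ max t₁ 0 := le_max_left _ _
  have h0C : 0 ≤ max t₁ 0 := le_max_right _ _
  -- The hypothesis concerns all geodesics of length at most `D`, because it is applied to the two
  -- outer pieces of `γ`.
  have improve : ∀ D β : ℝ, 0 ≤ β →
      (∀ ℓ γ, IsGeodOn K S ℓ γ → ℓ ≤ D → ∀ w ∈ η (γ 0) (γ ℓ), ∃ c ∈ Icc 0 ℓ, K w (γ c) ≤ C + β) →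
      ∀ ℓ γ, IsGeodOn K S ℓ γ → ℓ ≤ D → ∀ w ∈ η (γ 0) (γ ℓ), ∃ c ∈ Icc 0 ℓ,
        K w (γ c) ≤ C + β / 3 := by
    intro D β hβ hB ℓ γ hγ hℓ w hw
    have h0S : γ 0 ∈ S := hγ.2.1 ⟨le_rfl, hγ.1⟩
    have hℓS : γ ℓ ∈ S := hγ.2.1 ⟨hγ.1, le_rfl⟩
    have hwS := H.sub _ h0S _ hℓS hw
    set I := (fun c => K w (γ c)) '' Icc 0 ℓ with hI
    have hIne : I.Nonempty := ⟨_, mem_image_of_mem _ ⟨le_rfl, hγ.1⟩⟩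
    have hIbd : BddBelow I := ⟨0, by rintro _ ⟨c, hc, rfl⟩; exact H.nonneg _ hwS _ (hγ.2.1 hc)⟩
    set t := sInf I with ht
    have ht0 : 0 ≤ t := le_csInf hIne (by
      rintro _ ⟨c, hc, rfl⟩; exact H.nonneg _ hwS _ (hγ.2.1 hc))
    have htle : ∀ c ∈ Icc 0 ℓ, t ≤ K w (γ c) := fun c hc => csInf_le hIbd (mem_image_of_mem _ hc)
    obtain ⟨_, ⟨c₀, hc₀, rfl⟩, hlt⟩ := exists_lt_of_csInf_lt hIne (lt_add_one t)
    refine ⟨c₀, hc₀, hlt.le.trans ?_⟩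
    suffices hs : t ≤ t₁ ∨ t ≤ 3 * h ∨ 3 * t ≤ C + β + 2 * h by
      rcases hs with hs | hs | hs <;> linarith
    set R := 4 * t + 1 with hR
    -- The parameter distance `4 * t + 1` is at most `K (γ c) w + K w (γ c₀)`, and the last term is
    -- less than `t + 1`.
    have hfar : ∀ c ∈ Icc 0 ℓ, R ≤ |c - c₀| → 3 * t ≤ K w (γ c) := by
      intro c hc hRc
      have h1 := H.triangle _ (hγ.2.1 hc) _ hwS _ (hγ.2.1 hc₀)
      rw [hγ.2.2 _ hc _ hc₀, H.symm _ (hγ.2.1 hc) _ hwS] at h1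
      simp only at hlt
      linarith
    set a := max 0 (c₀ - R) with ha
    set b := min ℓ (c₀ + R) with hb
    have ha0 : 0 ≤ a := le_max_left _ _
    have hbℓ : b ≤ ℓ := min_le_left _ _
    have hac : a ≤ c₀ := max_le hc₀.1 (by linarith)
    have hcb : c₀ ≤ b := le_min hc₀.2 (by linarith)
    have haI : a ∈ Icc 0 ℓ := ⟨ha0, hac.trans hc₀.2⟩
    have hbI : b ∈ Icc 0 ℓ := ⟨hc₀.1.trans hcb, hbℓ⟩
    have haS := hγ.2.1 haI
    have hbS := hγ.2.1 hbI
    have hself : ∀ u ∈ S, K u u ≤ ε := fun u hu => (H.self u hu).le.trans H.eps_pos.le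
    obtain ⟨w₁, hw₁, hk₁⟩ := H.slim _ h0S _ hℓS _ haS w hw
    rcases hw₁ with hw₁ | hw₁
    · have hw₁S := H.sub _ h0S _ haS hw₁
      rcases le_or_gt (c₀ - R) 0 with hle | hgt
      · have ha' : a = 0 := max_eq_left hle
        rw [ha'] at hw₁
        have h1 := H.small _ h0S _ h0S (hself _ h0S) _ hw₁
        have h2 := H.triangle _ hwS _ hw₁S _ h0S
        have h3 := htle 0 ⟨le_rfl, hγ.1⟩
        right; left; linarith
      · have ha' : a = c₀ - R := max_eq_right hgt.le
        obtain ⟨c, hc, hcK⟩ := hB a γ (by simpa using hγ.sub le_rfl ha0 haI.2) (haI.2.trans hℓ) w₁ hw₁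
        have hcI : c ∈ Icc 0 ℓ := ⟨hc.1, hc.2.trans haI.2⟩
        have h1 := hfar c hcI (by rw [abs_sub_comm]; exact (le_abs_self _).trans' (by linarith [hc.2]))
        have h2 := H.triangle _ hwS _ hw₁S _ (hγ.2.1 hcI)
        right; right; linarith
    · have hw₁S := H.sub _ haS _ hℓS hw₁
      obtain ⟨w₂, hw₂, hk₂⟩ := H.slim _ haS _ hℓS _ hbS w₁ hw₁
      rcases hw₂ with hw₂ | hw₂
      · have hw₂S := H.sub _ haS _ hbS hw₂
        obtain ⟨m, hm, hmt⟩ := ht₁ t ht0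
        have hba : b - a ≤ 2 * R := by
          have h1 : b ≤ c₀ + R := min_le_right _ _
          have h2 : c₀ - R ≤ a := le_max_right _ _
          linarith
        obtain ⟨c, hc, hcK⟩ := H.exists_near_of_length_le hγ m a b ha0 (hac.trans hcb) hbℓ
          (by linarith) w₂ hw₂
        have hcI : c ∈ Icc 0 ℓ := ⟨ha0.trans hc.1, hc.2.trans hbℓ⟩
        have h1 := H.triangle _ hwS _ hw₁S _ (hγ.2.1 hcI)
        have h2 := H.triangle _ hw₁S _ hw₂S _ (hγ.2.1 hcI)
        have h3 := htle c hcI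
        left; exact hmt (by linarith)
      · have hw₂S := H.sub _ hbS _ hℓS hw₂
        rcases le_or_gt ℓ (c₀ + R) with hle | hgt
        · have hb' : b = ℓ := min_eq_left hle
          rw [hb'] at hw₂
          have h0 := H.small _ hℓS _ hℓS (hself _ hℓS) _ hw₂
          have h1 := H.triangle _ hwS _ hw₁S _ hℓS
          have h2 := H.triangle _ hw₁S _ hw₂S _ hℓS
          have h3 := htle ℓ ⟨hγ.1, le_rfl⟩
          right; left; linarith
        · have hb' : b = c₀ + R := min_eq_right hgt.le
          obtain ⟨c, hc, hcK⟩ := hB (ℓ - b) (fun t => γ (b + t)) (hγ.sub hbI.1 hbℓ le_rfl)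
            (by linarith [hbI.1]) w₂ (by simpa using hw₂)
          have hcI : b + c ∈ Icc 0 ℓ := ⟨by linarith [hc.1, hbI.1], by linarith [hc.2]⟩
          have h0 := hfar _ hcI ((le_abs_self _).trans' (by linarith [hc.1]))
          have h1 := H.triangle _ hwS _ hw₁S _ (hγ.2.1 hcI)
          have h2 := H.triangle _ hw₁S _ hw₂S _ (hγ.2.1 hcI)
          right; right; linarith
  refine ⟨C + 1, by linarith, fun ℓ γ hγ w hw => ?_⟩
  obtain ⟨m, hm⟩ : ∃ m : ℕ, ℓ ≤ 2 ^ m * ε := by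
    obtain ⟨m, hm⟩ := pow_unbounded_of_one_lt (ℓ / ε) (one_lt_two)
    exact ⟨m, ((div_lt_iff₀ H.eps_pos).1 hm).le⟩
  -- The induction starts from the logarithmic bound for length at most `ℓ`. Its excess over `C` is
  -- divided by 3 at each step, so in the limit only a constant independent of `ℓ` remains.
  have hmain : ∀ k : ℕ, ∀ ℓ' γ', IsGeodOn K S ℓ' γ' → ℓ' ≤ ℓ → ∀ w ∈ η (γ' 0) (γ' ℓ'),
      ∃ c ∈ Icc 0 ℓ', K w (γ' c) ≤ C + h * (m + 1) / 3 ^ k := by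
    intro k
    induction k with
    | zero =>
      intro ℓ' γ' hγ' hℓ' w hw
      obtain ⟨c, hc, hcK⟩ := H.exists_near_of_length_le hγ' m 0 ℓ' le_rfl hγ'.1 le_rfl
        (by linarith) w hw
      exact ⟨c, hc, by simp only [pow_zero, div_one]; linarith⟩
    | succ k ih =>
      have := improve ℓ _ (by positivity) ih
      rw [pow_succ, ← div_div]
      exact this
  obtain ⟨k, hk⟩ := pow_unbounded_of_one_lt (h * (m + 1)) (by norm_num : (1 : ℝ) < 3)
  obtain ⟨c, hc, hcK⟩ := hmain k ℓ γ hγ le_rfl w hw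
  refine ⟨c, hc, hcK.trans ?_⟩
  have : h * (m + 1) / 3 ^ k ≤ 1 := (div_le_one (by positivity)).2 hk.le
  linarith

/-- A discrete connectedness argument: along the chain in the guess there is a last moment before
the nearby geodesic points jump beyond `c`. The points `γ a` and `γ b` on the two sides of `c` are
then within `2 * t₀ + h` of each other, and `γ c` lies between them. If no jump occurs, `c` is close
to the end of the geodesic. -/
theorem IsPathGuess.exists_guess_near {t₀ : ℝ} (H : IsPathGuess K S η ε h) (ht₀ : 0 ≤ t₀)
    {ℓ : ℝ} {γ : ℝ → X} (hγ : IsGeodOn K S ℓ γ)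
    (hnear : ∀ w ∈ η (γ 0) (γ ℓ), ∃ c ∈ Icc 0 ℓ, K w (γ c) ≤ t₀) {c : ℝ} (hc : c ∈ Icc 0 ℓ) :
    ∃ w ∈ η (γ 0) (γ ℓ), K (γ c) w ≤ 3 * t₀ + h := by
  have hh := H.h_nonneg
  have h0S : γ 0 ∈ S := hγ.2.1 ⟨le_rfl, hγ.1⟩
  have hℓS : γ ℓ ∈ S := hγ.2.1 ⟨hγ.1, le_rfl⟩
  have hcS := hγ.2.1 hc
  obtain ⟨N, f, hf0, hfN, hfη, hfK⟩ := H.chain _ h0S _ hℓS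
  have hfS : ∀ i ≤ N, f i ∈ S := fun i hi => H.sub _ h0S _ hℓS (hfη i hi)
  have key : (∃ i < N, (∃ a ∈ Icc 0 c, K (f i) (γ a) ≤ t₀) ∧
      ¬ ∃ a ∈ Icc 0 c, K (f (i + 1)) (γ a) ≤ t₀) ∨ ∃ a ∈ Icc 0 c, K (f N) (γ a) ≤ t₀ := by
    by_contra hcon
    push Not at hcon
    obtain ⟨h1, h2⟩ := hcon
    have : ∀ i ≤ N, ∃ a ∈ Icc 0 c, K (f i) (γ a) ≤ t₀ := by
      intro i
      induction i with
      | zero => exact fun _ => ⟨0, ⟨le_rfl, hc.1⟩, by rw [hf0, H.self _ h0S]; exact ht₀⟩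
      | succ i ih =>
        intro hi
        obtain ⟨a, ha, ha'⟩ := ih (by omega)
        exact h1 i (by omega) ⟨a, ha, ha'⟩
    obtain ⟨a, ha, ha'⟩ := this N le_rfl
    exact absurd ha' (not_le.2 (h2 a ha))
  rcases key with ⟨i, hi, ⟨a, ha, haK⟩, hnot⟩ | ⟨a, ha, haK⟩
  · obtain ⟨b, hb, hbK⟩ := hnear _ (hfη (i + 1) hi)
    have hcb : c < b := by
      by_contra hle
      exact hnot ⟨b, ⟨hb.1, not_lt.1 hle⟩, hbK⟩
    have haI : a ∈ Icc 0 ℓ := ⟨ha.1, ha.2.trans hc.2⟩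
    have haS := hγ.2.1 haI
    have hbS := hγ.2.1 hb
    have hi' := hfS i hi.le
    have hi1 := hfS (i + 1) hi
    have h1 := H.triangle _ haS _ hi' _ hbS
    have h2 := H.triangle _ hi' _ hi1 _ hbS
    have h3 := hfK i hi
    rw [hγ.2.2 _ haI _ hb, abs_sub_comm, H.symm _ haS _ hi'] at h1
    have h4 := le_abs_self (b - a)
    have h5 := H.triangle _ hcS _ haS _ hi'
    rw [hγ.2.2 _ hc _ haI, abs_of_nonneg (by linarith [ha.2]), H.symm _ haS _ hi'] at h5
    exact ⟨f i, hfη i hi.le, by linarith⟩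
  · rw [hfN, hγ.2.2 _ ⟨hγ.1, le_rfl⟩ _ ⟨ha.1, ha.2.trans hc.2⟩] at haK
    have h4 := le_abs_self (ℓ - a)
    refine ⟨f N, hfη N le_rfl, ?_⟩
    rw [hfN, hγ.2.2 _ hc _ ⟨hγ.1, le_rfl⟩, abs_sub_comm, abs_of_nonneg (by linarith [hc.2])]
    linarith [ha.2]

/-- Move from the side to its guess, then by slimness to the guess of another side, then back to
that geodesic: the costs are `3 * t₀ + h`, `h` and `t₀`. -/
theorem IsPathGuess.exists_thin (H : IsPathGuess K S η ε h) :
    ∃ δ : ℝ, 0 ≤ δ ∧ ∀ ℓ₁ ℓ₂ ℓ₃ γ₁ γ₂ γ₃, IsGeodOn K S ℓ₁ γ₁ → IsGeodOn K S ℓ₂ γ₂ →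
      IsGeodOn K S ℓ₃ γ₃ → γ₁ ℓ₁ = γ₂ 0 → γ₂ ℓ₂ = γ₃ 0 → γ₃ ℓ₃ = γ₁ 0 →
      ∀ u ∈ γ₁ '' Icc 0 ℓ₁, ∃ v ∈ γ₂ '' Icc 0 ℓ₂ ∪ γ₃ '' Icc 0 ℓ₃, K u v ≤ δ := by
  obtain ⟨t₀, ht₀, hnear⟩ := H.exists_bound_guess_near_geodesic
  have hh := H.h_nonneg
  refine ⟨4 * t₀ + 2 * h, by linarith, ?_⟩
  rintro ℓ₁ ℓ₂ ℓ₃ γ₁ γ₂ γ₃ h₁ h₂ h₃ h12 h23 h31 _ ⟨c, hc, rfl⟩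
  obtain ⟨w, hw, hwK⟩ := H.exists_guess_near ht₀ h₁ (hnear _ _ h₁) hc
  have hx : γ₁ 0 ∈ S := h₁.2.1 ⟨le_rfl, h₁.1⟩
  have hy : γ₁ ℓ₁ ∈ S := h₁.2.1 ⟨h₁.1, le_rfl⟩
  have hz : γ₃ 0 ∈ S := h₃.2.1 ⟨le_rfl, h₃.1⟩
  have hwS := H.sub _ hx _ hy hw
  have hcS := h₁.2.1 hc
  obtain ⟨w', hw', hwK'⟩ := H.slim _ hx _ hy _ hz w hw
  rcases hw' with hw' | hw'
  · have hwS' := H.sub _ hx _ hz hw'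
    obtain ⟨b, hb, hbK⟩ := hnear _ _ h₃.reverse w' (by simpa [h31] using hw')
    have hbI : ℓ₃ - b ∈ Icc 0 ℓ₃ := ⟨by linarith [hb.2], by linarith [hb.1]⟩
    have hbS := h₃.2.1 hbI
    refine ⟨γ₃ (ℓ₃ - b), Or.inr (mem_image_of_mem _ hbI), ?_⟩
    have := H.triangle _ hcS _ hwS _ hbS
    have := H.triangle _ hwS _ hwS' _ hbS
    linarith
  · have hwS' := H.sub _ hz _ hy hw'
    obtain ⟨b, hb, hbK⟩ := hnear _ _ h₂.reverse w' (by simpa [h23, h12] using hw')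
    have hbI : ℓ₂ - b ∈ Icc 0 ℓ₂ := ⟨by linarith [hb.2], by linarith [hb.1]⟩
    have hbS := h₂.2.1 hbI
    refine ⟨γ₂ (ℓ₂ - b), Or.inl (mem_image_of_mem _ hbI), ?_⟩
    have := H.triangle _ hcS _ hwS _ hbS
    have := H.triangle _ hwS _ hwS' _ hbS
    linarith

end Guess

/-! ### Quasihyperbolic geodesics -/

section QHGeodesic

variable {n : ℕ} {Ω : Set (EuclideanSpace ℝ (Fin n))}

/-- Intersecting with `closure Ω` instead of `Ω` changes nothing, since frontier points have
distance zero to the frontier. -/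
theorem isCompact_le_infDist_frontier (ho : IsOpen Ω) (hb : Bornology.IsBounded Ω) {δ : ℝ}
    (hδ : 0 < δ) : IsCompact {z | z ∈ Ω ∧ δ ≤ Metric.infDist z (frontier Ω)} := by
  have hcl : {z | z ∈ Ω ∧ δ ≤ Metric.infDist z (frontier Ω)} =
      closure Ω ∩ {z | δ ≤ Metric.infDist z (frontier Ω)} := by
    ext z
    refine ⟨fun h => ⟨subset_closure h.1, h.2⟩, fun h => ⟨?_, h.2⟩⟩
    by_contra hz
    have : z ∈ frontier Ω := by rw [ho.frontier_eq]; exact ⟨h.1, hz⟩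
    have h0 := Metric.infDist_zero_of_mem this
    have := h.2
    simp only [mem_ofPred_eq, h0] at this
    linarith
  rw [hcl]
  refine Metric.isCompact_of_isClosed_isBounded
    (isClosed_closure.inter (isClosed_le continuous_const (Metric.continuous_infDist_pt _))) ?_
  exact hb.closure.subset inter_subset_left

variable {x y : EuclideanSpace ℝ (Fin n)}

/-- The quasihyperbolic distance as a real number. -/
noncomputable def qhK (Ω : Set (EuclideanSpace ℝ (Fin n))) (x y : EuclideanSpace ℝ (Fin n)) : ℝ :=
  (qhDist Ω x y).toReal

theorem qhK_nonneg : 0 ≤ qhK Ω x y := ENNReal.toReal_nonneg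

theorem qhK_comm : qhK Ω x y = qhK Ω y x := by rw [qhK, qhDist_comm, qhK]

theorem qhK_self (hx : x ∈ Ω) : qhK Ω x x = 0 := by rw [qhK, qhDist_self hx, ENNReal.toReal_zero]

theorem qhK_le_of_qhDist_le {a : ℝ} (ha : 0 ≤ a) (h : qhDist Ω x y ≤ ENNReal.ofReal a) :
    qhK Ω x y ≤ a := ENNReal.toReal_le_of_le_ofReal ha h

variable (hfin : ∀ x ∈ Ω, ∀ y ∈ Ω, qhDist Ω x y ≠ ⊤)

include hfin

theorem ofReal_qhK (hx : x ∈ Ω) (hy : y ∈ Ω) : ENNReal.ofReal (qhK Ω x y) = qhDist Ω x y :=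
  ENNReal.ofReal_toReal (hfin x hx y hy)

theorem qhK_triangle {z : EuclideanSpace ℝ (Fin n)} (hx : x ∈ Ω) (hy : y ∈ Ω) (hz : z ∈ Ω) :
    qhK Ω x z ≤ qhK Ω x y + qhK Ω y z := by
  rw [qhK, qhK, qhK, ← ENNReal.toReal_add (hfin x hx y hy) (hfin y hy z hz)]
  exact ENNReal.toReal_mono (ENNReal.add_ne_top.2 ⟨hfin x hx y hy, hfin y hy z hz⟩) qhDist_triangle

theorem continuousOn_qhK (ho : IsOpen Ω) (hf : (frontier Ω).Nonempty) :
    ContinuousOn (fun p : EuclideanSpace ℝ (Fin n) × EuclideanSpace ℝ (Fin n) => qhK Ω p.1 p.2)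
      (Ω ×ˢ Ω) := by
  have key : ∀ x ∈ Ω, ∀ ε > 0, ∃ r > 0, ∀ y, dist y x < r → y ∈ Ω ∧ qhK Ω x y < ε := by
    intro x hx ε hε
    have hd := infDist_frontier_pos ho hf hx
    set d := Metric.infDist x (frontier Ω) with hddef
    refine ⟨min (d / 2) (ε * d / 4), by positivity, fun y hy => ?_⟩
    have h1 : dist x y < d / 2 := by rw [dist_comm]; exact hy.trans_le (min_le_left _ _)
    have h2 : dist x y < ε * d / 4 := by rw [dist_comm]; exact hy.trans_le (min_le_right _ _)
    refine ⟨ball_infDist_frontier_subset hx (by rw [Metric.mem_ball, dist_comm]; linarith), ?_⟩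
    refine (qhK_le_of_qhDist_le (by positivity) (qhDist_le_of_dist_le_half ho hf hx h1.le)).trans_lt ?_
    rw [div_lt_iff₀ hd]
    nlinarith
  rw [Metric.continuousOn_iff]
  rintro ⟨x, y⟩ ⟨hx, hy⟩ ε hε
  obtain ⟨r₁, hr₁, h₁⟩ := key x hx (ε / 2) (half_pos hε)
  obtain ⟨r₂, hr₂, h₂⟩ := key y hy (ε / 2) (half_pos hε)
  refine ⟨min r₁ r₂, lt_min hr₁ hr₂, ?_⟩
  rintro ⟨x', y'⟩ ⟨hx', hy'⟩ hdist
  rw [Prod.dist_eq, max_lt_iff] at hdist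
  have k₁ := (h₁ x' (hdist.1.trans_le (min_le_left _ _))).2
  have k₂ := (h₂ y' (hdist.2.trans_le (min_le_right _ _))).2
  have t₁ := qhK_triangle hfin hx' hx hy'
  have t₂ := qhK_triangle hfin hx hy hy'
  have t₃ := qhK_triangle hfin hx hx' hy
  have t₄ := qhK_triangle hfin hx' hy' hy
  rw [qhK_comm (x := x') (y := x)] at t₁
  rw [qhK_comm (x := y') (y := y)] at t₄
  rw [Real.dist_eq, abs_lt]
  constructor <;> simp only <;> linarith

/-- Take a curve whose quasihyperbolic length `F L` exceeds the distance `D` by less than `ε`, and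
parametrize it proportionally to that length on `[0, D]`. The proportionality factor is at most `1 +
ε / D`. -/
theorem exists_almost_geodesic (ho : IsOpen Ω) (hf : (frontier Ω).Nonempty) (hx : x ∈ Ω)
    (hy : y ∈ Ω) {ε : ℝ} (hε : 0 < ε) (hD : 0 < qhK Ω x y) :
    ∃ f : ℝ → EuclideanSpace ℝ (Fin n), (∀ a, f a ∈ Ω) ∧ f 0 = x ∧ f (qhK Ω x y) = y ∧
      ∀ a ∈ Icc 0 (qhK Ω x y), ∀ b ∈ Icc 0 (qhK Ω x y), qhK Ω (f a) (f b) ≤ |a - b| + ε := by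
  set D := qhK Ω x y with hDdef
  obtain ⟨L, γ, hγ, hlt⟩ := exists_isQHCurve_of_qhDist_lt (Ω := Ω) (x := x) (y := y)
    (a := ENNReal.ofReal (D + ε)) (by
      rw [← ofReal_qhK hfin hx hy]
      exact (ENNReal.ofReal_lt_ofReal_iff (by linarith)).2 (by linarith))
  have hcont : ContinuousOn γ (Icc 0 L) := by
    have : LipschitzOnWith 1 γ (Icc 0 L) := by
      intro s hs t ht
      rw [ENNReal.coe_one, one_mul]
      rcases le_total s t with h | h
      · refine (edist_le_of_hasUnitSpeedOn hγ.2.1 hs ht h).trans_eq ?_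
        rw [edist_dist, Real.dist_eq, abs_sub_comm, abs_of_nonneg (sub_nonneg.2 h)]
      · rw [edist_comm]
        refine (edist_le_of_hasUnitSpeedOn hγ.2.1 ht hs h).trans_eq ?_
        rw [edist_dist, Real.dist_eq, abs_of_nonneg (sub_nonneg.2 h)]
    exact this.continuousOn
  set g : ℝ → ℝ := fun t => (Metric.infDist (γ t) (frontier Ω))⁻¹ with hg
  have hdpos : ∀ t ∈ Icc 0 L, 0 < Metric.infDist (γ t) (frontier Ω) := fun t ht =>
    infDist_frontier_pos ho hf (hγ.2.2.1 ht)
  have hgcont : ContinuousOn g (Icc 0 L) :=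
    ((Metric.continuous_infDist_pt _).comp_continuousOn hcont).inv₀ fun t ht => (hdpos t ht).ne'
  have hgint : ∀ a b, 0 ≤ a → a ≤ b → b ≤ L →
      ∫⁻ t in Icc a b, qhDensity Ω (γ t) = ENNReal.ofReal (∫ t in a..b, g t) := by
    intro a b ha hab hb
    have hsub : Icc a b ⊆ Icc 0 L := Icc_subset_Icc ha hb
    rw [intervalIntegral.integral_of_le hab, ← integral_Icc_eq_integral_Ioc,
      ofReal_integral_eq_lintegral_ofReal (hgcont.mono hsub).integrableOn_Icc]
    · refine setLIntegral_congr_fun measurableSet_Icc fun t ht => ?_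
      simp only [qhDensity, hg]
      rw [ENNReal.ofReal_inv_of_pos (hdpos t (hsub ht))]
    · filter_upwards [ae_restrict_mem measurableSet_Icc] with t ht
      exact inv_nonneg.2 (hdpos t (hsub ht)).le
  have hii : ∀ a b, 0 ≤ a → a ≤ b → b ≤ L → IntervalIntegrable g volume a b := by
    intro a b ha hab hb
    refine (hgcont.mono ?_).intervalIntegrable
    rw [uIcc_of_le hab]
    exact Icc_subset_Icc ha hb
  set F : ℝ → ℝ := fun t => ∫ s in (0 : ℝ)..t, g s with hF
  have hL := hγ.1
  have hFcont : ContinuousOn F (Icc 0 L) := by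
    have := intervalIntegral.continuousOn_primitive_interval (μ := volume) (f := g) (a := 0) (b := L)
      (by rw [uIcc_of_le hL]; exact hgcont.integrableOn_Icc)
    rwa [uIcc_of_le hL] at this
  have hF0 : F 0 = 0 := by simp [hF]
  have hsub : ∀ a b, 0 ≤ a → a ≤ b → b ≤ L → qhK Ω (γ a) (γ b) ≤ |F a - F b| := by
    intro a b ha hab hb
    have h1 := hγ.qhDist_sub_le ha hab hb
    rw [hgint a b ha hab hb] at h1
    have h2 : F b - F a = ∫ t in a..b, g t :=
      intervalIntegral.integral_interval_sub_left (hii 0 b le_rfl (ha.trans hab) hb)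
        (hii 0 a le_rfl ha (hab.trans hb))
    rw [← h2] at h1
    refine (qhK_le_of_qhDist_le (abs_nonneg _) (h1.trans (ENNReal.ofReal_le_ofReal ?_)))
    rw [abs_sub_comm]
    exact le_abs_self _
  have hsub' : ∀ a ∈ Icc 0 L, ∀ b ∈ Icc 0 L, qhK Ω (γ a) (γ b) ≤ |F a - F b| := by
    intro a ha b hb
    rcases le_total a b with h | h
    · exact hsub a b ha.1 h hb.2
    · rw [qhK_comm, abs_sub_comm]; exact hsub b a hb.1 h ha.2
  have hFL : F L < D + ε := by
    have : ∫⁻ t in Icc 0 L, qhDensity Ω (γ t) = ENNReal.ofReal (F L) := hgint 0 L le_rfl hL le_rfl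
    rw [this] at hlt
    exact (ENNReal.ofReal_lt_ofReal_iff (by linarith)).1 hlt
  have hFLD : D ≤ F L := by
    have h1 := hsub' 0 ⟨le_rfl, hL⟩ L ⟨hL, le_rfl⟩
    have h2 : 0 ≤ F L := intervalIntegral.integral_nonneg hL fun t ht => inv_nonneg.2 (hdpos t ht).le
    rwa [hγ.2.2.2.1, hγ.2.2.2.2, hF0, zero_sub, abs_neg, abs_of_nonneg h2] at h1
  have hex : ∀ a ∈ Icc 0 D, ∃ t ∈ Icc 0 L, F t = a * (F L / D) := by
    intro a ha
    have := intermediate_value_Icc hL hFcont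
    rw [hF0] at this
    refine this ⟨by have := ha.1; have : 0 ≤ F L := by linarith
                    positivity, ?_⟩
    rw [← mul_div_assoc, div_le_iff₀ hD, mul_comm]
    exact mul_le_mul_of_nonneg_left ha.2 (by linarith)
  -- The endpoints are prescribed in the choice of parameters, so that the almost geodesic starts at
  -- `x` and ends at `y` exactly.
  have hex' : ∀ a : ℝ, ∃ t ∈ Icc 0 L, (a ∈ Icc 0 D → F t = a * (F L / D)) ∧ (a = 0 → t = 0) ∧
      (a = D → t = L) := by
    intro a
    by_cases h0 : a = 0
    · exact ⟨0, ⟨le_rfl, hL⟩, fun _ => by simp [h0, hF0], fun _ => rfl,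
        fun h => absurd (h0.symm.trans h) hD.ne⟩
    by_cases h1 : a = D
    · exact ⟨L, ⟨hL, le_rfl⟩, fun _ => by rw [h1, mul_div_cancel₀ _ hD.ne'], fun h => absurd h h0,
        fun _ => rfl⟩
    by_cases h2 : a ∈ Icc 0 D
    · obtain ⟨t, ht, ht'⟩ := hex a h2
      exact ⟨t, ht, fun _ => ht', fun h => absurd h h0, fun h => absurd h h1⟩
    · exact ⟨0, ⟨le_rfl, hL⟩, fun h => absurd h h2, fun h => absurd h h0, fun h => absurd h h1⟩
  choose τ hτ hτF hτ0 hτD using hex'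
  refine ⟨fun a => γ (τ a), fun a => hγ.2.2.1 (hτ a), ?_, ?_, fun a ha b hb => ?_⟩
  · simp only [hτ0 0 rfl, hγ.2.2.2.1]
  · simp only [hτD D rfl, hγ.2.2.2.2]
  · refine (hsub' _ (hτ a) _ (hτ b)).trans ?_
    rw [hτF a ha, hτF b hb, ← sub_mul, abs_mul, abs_of_nonneg (div_nonneg (by linarith) hD.le)]
    have h1 : F L / D ≤ 1 + ε / D := by
      rw [div_le_iff₀ hD, add_mul, div_mul_cancel₀ _ hD.ne']; linarith
    have h2 : |a - b| ≤ D := abs_sub_le_iff.2 ⟨by linarith [ha.2, hb.1], by linarith [ha.1, hb.2]⟩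
    calc |a - b| * (F L / D) ≤ |a - b| * (1 + ε / D) := by gcongr
      _ = |a - b| + |a - b| * (ε / D) := by ring
      _ ≤ |a - b| + D * (ε / D) := by gcongr
      _ = |a - b| + ε := by rw [mul_div_cancel₀ _ hD.ne']

theorem eq_of_qhK_eq_zero (ho : IsOpen Ω) (hf : (frontier Ω).Nonempty) (hx : x ∈ Ω) (hy : y ∈ Ω)
    (h : qhK Ω x y = 0) : x = y := by
  have hd := infDist_frontier_pos ho hf hx
  have h0 : qhDist Ω x y = 0 := by rw [← ofReal_qhK hfin hx hy, h, ENNReal.ofReal_zero]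
  have h1 : ∀ ρ > 0, dist x y ≤ (Real.exp ρ - 1) * Metric.infDist x (frontier Ω) := fun ρ hρ =>
    dist_le_of_qhDist_lt hd hρ.le (by rw [h0]; exact ENNReal.ofReal_pos.2 hρ)
  have h2 : Tendsto (fun ρ : ℝ => (Real.exp ρ - 1) * Metric.infDist x (frontier Ω)) (𝓝[>] 0) (𝓝 0) := by
    have : Continuous fun ρ : ℝ => (Real.exp ρ - 1) * Metric.infDist x (frontier Ω) := by fun_prop
    have := this.tendsto 0
    simp only [Real.exp_zero, sub_self, zero_mul] at this
    exact this.mono_left nhdsWithin_le_nhds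
  have h3 := ge_of_tendsto h2 (by filter_upwards [self_mem_nhdsWithin] with ρ hρ using h1 ρ hρ)
  exact dist_le_zero.1 h3

/-- Almost geodesics with error `1 / (k + 1)` form nested nonempty closed sets in a product of
copies of a compact set, so by Tychonoff's theorem they have a common element. No equicontinuity is
needed: the limit inequality already makes this map 1-Lipschitz for `qhK`. -/
theorem exists_isQHGeodesic (ho : IsOpen Ω) (hb : Bornology.IsBounded Ω)
    (hf : (frontier Ω).Nonempty) (hx : x ∈ Ω) (hy : y ∈ Ω) : ∃ ℓ γ, IsQHGeodesic Ω x y ℓ γ := by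
  set D := qhK Ω x y with hD
  rcases (qhK_nonneg (Ω := Ω) (x := x) (y := y)).eq_or_lt with h0 | hDpos
  · have hxy := eq_of_qhK_eq_zero hfin ho hf hx hy h0.symm
    refine ⟨0, fun _ => x, le_rfl, fun _ _ => hx, rfl, hxy, fun a ha b hb => ?_⟩
    rw [Icc_self, mem_singleton_iff] at ha hb
    simp [ha, hb, qhDist_self hx]
  have hdx := infDist_frontier_pos ho hf hx
  -- Almost geodesics stay within quasihyperbolic distance `D + 1` of `x`; the extra 1 gives the
  -- strict inequality needed to keep them at Euclidean distance `δ` from the frontier.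
  set δ := Real.exp (-(D + 2)) * Metric.infDist x (frontier Ω) with hδ
  have hδpos : 0 < δ := by positivity
  set C := {z | z ∈ Ω ∧ δ ≤ Metric.infDist z (frontier Ω)} with hC
  have hCc : IsCompact C := isCompact_le_infDist_frontier ho hb hδpos
  have hCmem : ∀ z ∈ Ω, qhK Ω x z ≤ D + 1 → z ∈ C := by
    intro z hz hk
    refine ⟨hz, ?_⟩
    have := infDist_frontier_le_of_qhDist_lt (x := x) (infDist_frontier_pos ho hf hz)
      (ρ := D + 2) (by linarith) (by
        rw [← ofReal_qhK hfin hx hz]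
        exact (ENNReal.ofReal_lt_ofReal_iff (by linarith)).2 (by linarith))
    rw [hδ, Real.exp_neg, inv_mul_le_iff₀ (Real.exp_pos _)]
    exact this
  let I := Icc (0 : ℝ) D
  have h0I : (0 : ℝ) ∈ I := ⟨le_rfl, hDpos.le⟩
  have hDI : D ∈ I := ⟨hDpos.le, le_rfl⟩
  let P : Set (I → EuclideanSpace ℝ (Fin n)) := Set.pi univ fun _ => C
  have hP : IsCompact P := isCompact_univ_pi fun _ => hCc
  let G : ℕ → Set (I → EuclideanSpace ℝ (Fin n)) := fun k =>
    {f | f ∈ P ∧ f ⟨0, h0I⟩ = x ∧ f ⟨D, hDI⟩ = y ∧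
      ∀ a b : I, qhK Ω (f a) (f b) ≤ |(a : ℝ) - b| + 1 / ((k : ℝ) + 1)}
  have hGclosed : ∀ k, IsClosed (G k) := by
    intro k
    have e : G k = ({f | f ⟨0, h0I⟩ = x} ∩ {f | f ⟨D, hDI⟩ = y}) ∩ (P ∩ ⋂ a : I, ⋂ b : I,
        {f | f ∈ P ∧ qhK Ω (f a) (f b) ≤ |(a : ℝ) - b| + 1 / ((k : ℝ) + 1)}) := by
      ext f
      simp only [G, mem_ofPred_eq, mem_inter_iff, mem_iInter]
      constructor
      · rintro ⟨h1, h2, h3, h4⟩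
        exact ⟨⟨h2, h3⟩, h1, fun a b => ⟨h1, h4 a b⟩⟩
      · rintro ⟨⟨h2, h3⟩, h1, h4⟩
        exact ⟨h1, h2, h3, fun a b => (h4 a b).2⟩
    rw [e]
    refine ((isClosed_eq (continuous_apply _) continuous_const).inter
      (isClosed_eq (continuous_apply _) continuous_const)).inter
      (hP.isClosed.inter (isClosed_iInter fun a => isClosed_iInter fun b => ?_))
    have hc : ContinuousOn (fun f : I → EuclideanSpace ℝ (Fin n) => qhK Ω (f a) (f b)) P := by
      refine (continuousOn_qhK hfin ho hf).comp
        (f := fun f : I → EuclideanSpace ℝ (Fin n) => (f a, f b)) ?_ ?_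
      · exact ((continuous_apply a).prodMk (continuous_apply b)).continuousOn
      · exact fun f hf => ⟨(hf a trivial).1, (hf b trivial).1⟩
    exact hc.preimage_isClosed_of_isClosed hP.isClosed isClosed_Iic
  have hGne : ∀ k, (G k).Nonempty := by
    intro k
    have hk : (0 : ℝ) < 1 / ((k : ℝ) + 1) := by positivity
    have hk1 : 1 / ((k : ℝ) + 1) ≤ 1 := (div_le_one (by positivity)).2 (by
      have : (0 : ℝ) ≤ k := Nat.cast_nonneg k
      linarith)
    obtain ⟨f, hfΩ, hf0, hfD, hfK⟩ := exists_almost_geodesic hfin ho hf hx hy hk hDpos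
    refine ⟨fun a => f a, fun a _ => hCmem _ (hfΩ _) ?_, hf0, hfD, fun a b => hfK a a.2 b b.2⟩
    have := hfK 0 h0I a a.2
    rw [hf0, zero_sub, abs_neg, abs_of_nonneg a.2.1] at this
    linarith [a.2.2]
  have hGanti : ∀ k, G (k + 1) ⊆ G k := by
    rintro k f ⟨h1, h2, h3, h4⟩
    refine ⟨h1, h2, h3, fun a b => (h4 a b).trans ?_⟩
    push_cast
    gcongr
    linarith
  obtain ⟨f, hf'⟩ := IsCompact.nonempty_iInter_of_sequence_nonempty_isCompact_isClosed G hGanti hGne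
    (hP.of_isClosed_subset (hGclosed 0) fun f hf => hf.1) hGclosed
  rw [mem_iInter] at hf'
  have hfP : f ∈ P := (hf' 0).1
  have hfΩ : ∀ a, f a ∈ Ω := fun a => (hfP a trivial).1
  have hfle : ∀ a b : I, qhK Ω (f a) (f b) ≤ |(a : ℝ) - b| := by
    intro a b
    have hl : Tendsto (fun k : ℕ => |(a : ℝ) - b| + 1 / ((k : ℝ) + 1)) atTop (𝓝 (|(a : ℝ) - b| + 0)) :=
      tendsto_const_nhds.add tendsto_one_div_add_atTop_nhds_zero_nat
    rw [add_zero] at hl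
    exact ge_of_tendsto' hl fun k => (hf' k).2.2.2 a b
  -- A 1-Lipschitz map whose endpoints are at distance exactly `D` cannot lose length anywhere: `D ≤
  -- a + K (f a) (f b) + (D - b)`.
  have hfeq' : ∀ a b : I, (a : ℝ) ≤ b → qhK Ω (f a) (f b) = |(a : ℝ) - b| := by
    intro a b hab
    refine le_antisymm (hfle a b) ?_
    have t₁ := qhK_triangle hfin (hfΩ ⟨0, h0I⟩) (hfΩ a) (hfΩ ⟨D, hDI⟩)
    have t₂ := qhK_triangle hfin (hfΩ a) (hfΩ b) (hfΩ ⟨D, hDI⟩)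
    rw [(hf' 0).2.1, (hf' 0).2.2.1, ← hD] at t₁
    rw [(hf' 0).2.2.1] at t₂
    have l₁ := hfle ⟨0, h0I⟩ a
    have l₂ := hfle b ⟨D, hDI⟩
    rw [(hf' 0).2.1, zero_sub, abs_neg, abs_of_nonneg a.2.1] at l₁
    rw [(hf' 0).2.2.1, abs_sub_comm, abs_of_nonneg (sub_nonneg.2 b.2.2)] at l₂
    rw [abs_sub_comm, abs_of_nonneg (sub_nonneg.2 hab)]
    linarith
  have hfeq : ∀ a b : I, qhK Ω (f a) (f b) = |(a : ℝ) - b| := by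
    intro a b
    rcases le_total (a : ℝ) b with h | h
    · exact hfeq' a b h
    · rw [qhK_comm, abs_sub_comm]; exact hfeq' b a h
  refine ⟨D, fun t => f (projIcc 0 D hDpos.le t), hDpos.le, fun t _ => hfΩ _, ?_, ?_, ?_⟩
  · simp only [projIcc_left]; exact (hf' 0).2.1
  · simp only [projIcc_right]; exact (hf' 0).2.2.1
  · intro a ha b hb
    change qhDist Ω (f (projIcc 0 D hDpos.le a)) (f (projIcc 0 D hDpos.le b)) = _
    rw [projIcc_of_mem _ ha, projIcc_of_mem _ hb, ← ofReal_qhK hfin (hfΩ _) (hfΩ _), hfeq]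

theorem isGromovHyperbolicDomain_of_isPathGuess (ho : IsOpen Ω) (hb : Bornology.IsBounded Ω)
    (hf : (frontier Ω).Nonempty)
    {η : EuclideanSpace ℝ (Fin n) → EuclideanSpace ℝ (Fin n) → Set (EuclideanSpace ℝ (Fin n))}
    {ε h : ℝ} (H : IsPathGuess (qhK Ω) Ω η ε h) : IsGromovHyperbolicDomain Ω := by
  refine ⟨fun x hx y hy => exists_isQHGeodesic hfin ho hb hf hx hy, ?_⟩
  obtain ⟨δ, hδ, hthin⟩ := H.exists_thin
  have conv : ∀ {x y ℓ γ}, IsQHGeodesic Ω x y ℓ γ → IsGeodOn (qhK Ω) Ω ℓ γ := by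
    intro x y ℓ γ hγ
    refine ⟨hγ.1, hγ.2.1, fun a ha b hb => ?_⟩
    rw [qhK, hγ.2.2.2.2 a ha b hb, ENNReal.toReal_ofReal (abs_nonneg _)]
  refine ⟨δ, hδ, ?_⟩
  intro x _ y _ z _ ℓ₁ ℓ₂ ℓ₃ γ₁ γ₂ γ₃ h₁ h₂ h₃ u hu
  obtain ⟨v, hv, hk⟩ := hthin _ _ _ _ _ _ (conv h₁) (conv h₂) (conv h₃)
    (h₁.2.2.2.1.trans h₂.2.2.1.symm) (h₂.2.2.2.1.trans h₃.2.2.1.symm)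
    (h₃.2.2.2.1.trans h₁.2.2.1.symm) u hu
  have huΩ : u ∈ Ω := by
    obtain ⟨a, ha, rfl⟩ := hu
    exact h₁.2.1 ha
  have hvΩ : v ∈ Ω := by
    rcases hv with ⟨a, ha, rfl⟩ | ⟨a, ha, rfl⟩
    · exact h₂.2.1 ha
    · exact h₃.2.1 ha
  refine ⟨v, hv, ?_⟩
  rw [← ofReal_qhK hfin huΩ hvΩ]
  exact ENNReal.ofReal_le_ofReal hk

end QHGeodesic

/-! ### Trees of boxes -/

section Box

variable {n : ℕ}

/-- The open box with corners `lo` and `hi`. -/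
def openBox (lo hi : Fin n → ℝ) : Set (EuclideanSpace ℝ (Fin n)) :=
  {x | ∀ k, x k ∈ Ioo (lo k) (hi k)}

theorem isOpen_openBox (lo hi : Fin n → ℝ) : IsOpen (openBox lo hi) := by
  have : openBox lo hi = ⋂ k, {x : EuclideanSpace ℝ (Fin n) | x k ∈ Ioo (lo k) (hi k)} := by
    ext x; simp [openBox]
  rw [this]
  exact isOpen_iInter_of_finite fun k => isOpen_Ioo.preimage (EuclideanSpace.proj k).continuous

theorem convex_openBox (lo hi : Fin n → ℝ) : Convex ℝ (openBox lo hi) := by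
  intro x hx y hy a b ha hb hab k
  simpa using (convex_Ioo (lo k) (hi k)) (hx k) (hy k) ha hb hab

theorem dist_le_dist_of_coord {x y z w : EuclideanSpace ℝ (Fin n)}
    (h : ∀ k, |x k - y k| ≤ |z k - w k|) : dist x y ≤ dist z w := by
  rw [EuclideanSpace.dist_eq, EuclideanSpace.dist_eq]
  refine Real.sqrt_le_sqrt (Finset.sum_le_sum fun k _ => ?_)
  rw [Real.dist_eq, Real.dist_eq]
  exact pow_le_pow_left₀ (abs_nonneg _) (h k) 2

theorem abs_coord_sub_le_dist (x y : EuclideanSpace ℝ (Fin n)) (k : Fin n) :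
    |x k - y k| ≤ dist x y := by
  rw [dist_eq_norm]
  exact PiLp.norm_apply_le (x - y) k

/-- Two intersecting boxes are linearly connected through their intersection. -/
theorem exists_mem_inter_openBox {lo hi lo' hi' : Fin n → ℝ}
    {x y g : EuclideanSpace ℝ (Fin n)} (hx : x ∈ openBox lo hi) (hy : y ∈ openBox lo' hi')
    (hg : g ∈ openBox lo hi ∩ openBox lo' hi') :
    ∃ z ∈ openBox lo hi ∩ openBox lo' hi', dist x z ≤ dist x y ∧ dist z y ≤ dist x y := by
  have hk : ∀ k, ∃ c : ℝ, (c ∈ Ioo (lo k) (hi k) ∧ c ∈ Ioo (lo' k) (hi' k)) ∧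
      |x k - c| ≤ |x k - y k| ∧ |c - y k| ≤ |x k - y k| := by
    intro k
    have h1 := hx k
    have h2 := hy k
    have h3 := hg.1 k
    have h4 := hg.2 k
    by_cases hxk : x k ∈ Ioo (lo' k) (hi' k)
    · exact ⟨x k, ⟨h1, hxk⟩, by simp, le_rfl⟩
    by_cases hyk : y k ∈ Ioo (lo k) (hi k)
    · exact ⟨y k, ⟨hyk, h2⟩, le_rfl, by simp⟩
    -- If neither coordinate lies in the other interval, the common part of the two intervals
    -- separates them, so `g k` is between `x k` and `y k`.
    refine ⟨g k, ⟨h3, h4⟩, ?_⟩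
    rcases le_total (x k) (y k) with hxy | hxy
    · have hxg : x k ≤ g k := by
        by_contra hlt
        exact hxk ⟨by linarith [h4.1], by linarith [h2.2]⟩
      have hgy : g k ≤ y k := by
        by_contra hlt
        exact hyk ⟨by linarith [h1.1], by linarith [h3.2]⟩
      rw [abs_of_nonpos (by linarith), abs_of_nonpos (by linarith), abs_of_nonpos (by linarith)]
      constructor <;> linarith
    · have hgx : g k ≤ x k := by
        by_contra hlt
        exact hxk ⟨by linarith [h2.1], by linarith [h4.2]⟩
      have hyg : y k ≤ g k := by
        by_contra hlt
        exact hyk ⟨by linarith [h3.1], by linarith [h1.2]⟩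
      rw [abs_of_nonneg (by linarith), abs_of_nonneg (by linarith), abs_of_nonneg (by linarith)]
      constructor <;> linarith
  choose c hc hc' using hk
  exact ⟨WithLp.toLp 2 c, ⟨fun k => (hc k).1, fun k => (hc k).2⟩,
    dist_le_dist_of_coord fun k => (hc' k).1, dist_le_dist_of_coord fun k => (hc' k).2⟩

end Box

theorem Relation.ReflTransGen.symm_of_symm {α : Type*} {r : α → α → Prop} {a b : α}
    (h : Relation.ReflTransGen r a b) (hr : ∀ a b, r a b → r b a) : Relation.ReflTransGen r b a := by
  induction h with
  | refl => exact .refl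
  | tail _ h ih => exact .head (hr _ _ h) ih

/-- A convex combination of a point of a convex set and the centre of a ball in it. -/
theorem ball_lift_subset {E : Type*} [NormedAddCommGroup E] [NormedSpace ℝ E] {V : Set E}
    (hV : Convex ℝ V) {x q : E} {ρ s : ℝ} (hx : x ∈ V) (hq : Metric.ball q ρ ⊆ V) (hs : 0 ≤ s)
    (hs1 : s ≤ 1) : Metric.ball (x + s • (q - x)) (s * ρ) ⊆ V := by
  rcases hs.eq_or_lt with rfl | hs0
  · simp
  intro w hw
  rw [Metric.mem_ball, dist_eq_norm] at hw
  have h1 : q + s⁻¹ • (w - (x + s • (q - x))) ∈ V := by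
    apply hq
    rw [Metric.mem_ball, dist_eq_norm, add_sub_cancel_left, norm_smul, norm_inv, Real.norm_eq_abs,
      abs_of_pos hs0, inv_mul_lt_iff₀ hs0]
    exact hw
  have h2 : w = (1 - s) • x + s • (q + s⁻¹ • (w - (x + s • (q - x)))) := by
    rw [smul_add, smul_inv_smul₀ hs0.ne']
    module
  rw [h2]
  exact hV hx h1 (by linarith) hs0.le (by ring)

/-- A rooted tree of open boxes of comparable sizes, neighbouring boxes overlapping substantially
and other boxes being separated from each other. -/
structure BoxTree (n : ℕ) (I : Type*) where
  root : I
  parent : I → I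
  depth : I → ℕ
  lo : I → Fin n → ℝ
  hi : I → Fin n → ℝ
  q : I → EuclideanSpace ℝ (Fin n)
  g : I → EuclideanSpace ℝ (Fin n)
  sz : I → ℝ
  Λ : ℝ
  c : ℝ
  eq_root : ∀ i, depth i = 0 → i = root
  depth_root : depth root = 0
  depth_parent : ∀ i, depth i ≠ 0 → depth (parent i) + 1 = depth i
  one_le_Λ : 1 ≤ Λ
  c_pos : 0 < c
  c_mul_Λ : c * Λ ≤ 1
  sz_pos : ∀ i, 0 < sz i
  ball_subset : ∀ i, Metric.ball (q i) (sz i) ⊆ openBox (lo i) (hi i)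
  dist_le : ∀ i, ∀ x ∈ openBox (lo i) (hi i), dist x (q i) ≤ Λ * sz i
  sz_le_parent : ∀ i, depth i ≠ 0 → sz i ≤ Λ * sz (parent i)
  sz_parent_le : ∀ i, depth i ≠ 0 → sz (parent i) ≤ Λ * sz i
  gate_subset : ∀ i, depth i ≠ 0 → Metric.ball (g i) (sz i / Λ) ⊆
    openBox (lo i) (hi i) ∩ openBox (lo (parent i)) (hi (parent i))
  -- Together with the overlaps required by `gate_subset`, this lets the Euclidean geometry of the
  -- union follow the tree: two points closer than a fraction of the sizes of their boxes lie in
  -- equal or adjacent boxes.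
  sep : ∀ i j, i ≠ j → ¬ (depth i ≠ 0 ∧ parent i = j) → ¬ (depth j ≠ 0 ∧ parent j = i) →
    ∀ x ∈ openBox (lo i) (hi i), ∀ y ∈ openBox (lo j) (hi j), c * max (sz i) (sz j) ≤ dist x y
  -- Boundary points near every box make the distance to the frontier at most comparable to the size
  -- of the box.
  off : ∀ i, ∃ z, (∀ j, z ∉ openBox (lo j) (hi j)) ∧ dist z (q i) ≤ Λ * sz i

namespace BoxTree

variable {n : ℕ} {I : Type*} (T : BoxTree n I)

/-- The box at the node `i`. -/
def V (i : I) : Set (EuclideanSpace ℝ (Fin n)) := openBox (T.lo i) (T.hi i)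

/-- The union of the boxes. -/
def domain : Set (EuclideanSpace ℝ (Fin n)) := ⋃ i, T.V i

/-- Adjacency in the tree. -/
def Adj (i j : I) : Prop := (T.depth i ≠ 0 ∧ T.parent i = j) ∨ (T.depth j ≠ 0 ∧ T.parent j = i)

theorem Adj.symm {T : BoxTree n I} {i j : I} (h : T.Adj i j) : T.Adj j i := Or.symm h

/-- `i` is an ancestor of `a`. -/
def Desc (i a : I) : Prop := ∃ m, T.parent^[m] a = i ∧ T.depth a = T.depth i + m

theorem Desc.refl (i : I) : T.Desc i i := ⟨0, rfl, rfl⟩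

/-- The only edge that leaves the subtree below `i` is the one from `i` to its parent. -/
theorem eq_of_adj_of_desc {i a b : I} (ha : T.Desc i a) (hab : T.Adj a b) (hb : ¬ T.Desc i b) :
    a = i ∧ T.parent i = b := by
  obtain ⟨m, hm, hd⟩ := ha
  rcases hab with ⟨h0, rfl⟩ | ⟨h0, rfl⟩
  · rcases m with _ | m
    · exact ⟨hm, by rw [← hm]; rfl⟩
    · exact absurd ⟨m, hm, by have := T.depth_parent a h0; omega⟩ hb
  · exact absurd ⟨m + 1, hm, by have := T.depth_parent b h0; omega⟩ hb

/-- One step in the tree that avoids `l`. -/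
def Avoid (l i j : I) : Prop := T.Adj i j ∧ i ≠ l ∧ j ≠ l

/-- The vertices of the tree path from `i` to `j`. -/
def Seg (i j : I) : Set I := {l | l = i ∨ l = j ∨ ¬ Relation.ReflTransGen (T.Avoid l) i j}

theorem left_mem_seg (i j : I) : i ∈ T.Seg i j := Or.inl rfl

theorem right_mem_seg (i j : I) : j ∈ T.Seg i j := Or.inr (Or.inl rfl)

theorem seg_comm (i j : I) : T.Seg i j = T.Seg j i := by
  have : ∀ i j, T.Seg i j ⊆ T.Seg j i := by
    rintro i j l (h | h | h)
    · exact Or.inr (Or.inl h)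
    · exact Or.inl h
    · refine Or.inr (Or.inr fun h' => h ?_)
      exact h'.symm_of_symm fun _ _ h => ⟨h.1.symm, h.2.2, h.2.1⟩
  exact (this i j).antisymm (this j i)

/-- Two walks avoiding `l` can be concatenated. This is the thinness of triangles in a tree, and it
follows at once from the description of `Seg` by cut vertices. -/
theorem seg_subset_union (i j h : I) : T.Seg i j ⊆ T.Seg i h ∪ T.Seg h j := by
  intro l hl
  by_contra hcon
  simp only [Seg, mem_union, mem_ofPred_eq, not_or, not_not] at hcon
  obtain ⟨⟨h1, h2, h3⟩, h4, h5, h6⟩ := hcon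
  rcases hl with h | h | h
  · exact h1 h
  · exact h5 h
  · exact h (h3.trans h6)

theorem seg_subset_pair {i j : I} (h : i = j ∨ T.Adj i j) : T.Seg i j ⊆ {i, j} := by
  rintro l (hl | hl | hl)
  · exact Or.inl hl
  · exact Or.inr hl
  · by_contra hcon
    simp only [mem_insert_iff, mem_singleton_iff, not_or] at hcon
    apply hl
    rcases h with rfl | h
    · exact Relation.ReflTransGen.refl
    · exact Relation.ReflTransGen.single ⟨h, Ne.symm hcon.1, Ne.symm hcon.2⟩

/-- Since `j` is not below `i`, a walk from `i` to `j` that avoids `l` must leave the subtree of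
`i`, hence pass through the parent of `i`; the remainder of the walk avoids `l` as well. -/
theorem seg_parent_subset {i j : I} (hij : i ≠ j) (hd : T.depth j ≤ T.depth i) :
    T.Seg (T.parent i) j ⊆ T.Seg i j := by
  intro l hl
  by_contra hcon
  simp only [Seg, mem_ofPred_eq, not_or, not_not] at hcon
  obtain ⟨h1, h2, h3⟩ := hcon
  have hj : ¬ T.Desc i j := by
    rintro ⟨m, hm, hm'⟩
    obtain rfl : m = 0 := by omega
    exact hij hm.symm
  have key : ∀ a, Relation.ReflTransGen (T.Avoid l) a j → T.Desc i a →
      T.parent i ≠ l ∧ Relation.ReflTransGen (T.Avoid l) (T.parent i) j := by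
    intro a ha
    induction ha using Relation.ReflTransGen.head_induction_on with
    | refl => exact fun h => absurd h hj
    | head hab hbj ih =>
      intro hda
      rename_i a b
      by_cases hdb : T.Desc i b
      · exact ih hdb
      · obtain ⟨rfl, rfl⟩ := T.eq_of_adj_of_desc hda hab.1 hdb
        exact ⟨hab.2.2, hbj⟩
  obtain ⟨h4, h5⟩ := key i h3 (Desc.refl T i)
  rcases hl with h | h | h
  · exact h4 h.symm
  · exact h2 h
  · exact h h5

/-- Induction on the sum of the depths: the deeper endpoint is replaced by its parent. -/
theorem reflTransGen_seg (i j : I) :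
    Relation.ReflTransGen (fun a b => T.Adj a b ∧ a ∈ T.Seg i j ∧ b ∈ T.Seg i j) i j := by
  induction hN : T.depth i + T.depth j using Nat.strong_induction_on generalizing i j with
  | _ N ih =>
    rcases eq_or_ne i j with rfl | hij
    · exact Relation.ReflTransGen.refl
    have step : ∀ i j : I, i ≠ j → T.depth j ≤ T.depth i → T.depth i + T.depth j = N →
        Relation.ReflTransGen (fun a b => T.Adj a b ∧ a ∈ T.Seg i j ∧ b ∈ T.Seg i j) i j := by
      intro i j hij hd hN
      have h0 : T.depth i ≠ 0 := fun h0 => hij (by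
        rw [T.eq_root i h0, T.eq_root j (by omega)])
      have hdp := T.depth_parent i h0
      have hsub := T.seg_parent_subset hij hd
      have := ih _ (by omega) (T.parent i) j rfl
      refine Relation.ReflTransGen.head ⟨Or.inl ⟨h0, rfl⟩, T.left_mem_seg i j,
        hsub (T.left_mem_seg _ _)⟩ (this.lift id fun a b h => ⟨h.1, hsub h.2.1, hsub h.2.2⟩)
    rcases le_total (T.depth j) (T.depth i) with hd | hd
    · exact step i j hij hd hN
    · have := step j i hij.symm hd (by omega)
      rw [seg_comm] at this
      exact this.symm_of_symm fun a b h => ⟨h.1.symm, h.2.2, h.2.1⟩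

/-! #### Basic geometry -/

theorem Λ_pos : 0 < T.Λ := lt_of_lt_of_le one_pos T.one_le_Λ

theorem c_le_one : T.c ≤ 1 := by
  have := T.c_mul_Λ
  have := T.one_le_Λ
  have := T.c_pos
  nlinarith

theorem isOpen_domain : IsOpen T.domain := isOpen_iUnion fun _ => isOpen_openBox _ _

theorem V_subset_domain (i : I) : T.V i ⊆ T.domain := subset_iUnion T.V i

theorem q_mem (i : I) : T.q i ∈ T.V i := T.ball_subset i (Metric.mem_ball_self (T.sz_pos i))

theorem frontier_nonempty : (frontier T.domain).Nonempty := by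
  rw [nonempty_frontier_iff]
  refine ⟨⟨_, T.V_subset_domain _ (T.q_mem T.root)⟩, fun h => ?_⟩
  obtain ⟨z, hz, -⟩ := T.off T.root
  have : z ∈ T.domain := h ▸ mem_univ z
  obtain ⟨j, hj⟩ := mem_iUnion.1 this
  exact hz j hj

theorem infDist_le {i : I} {x : EuclideanSpace ℝ (Fin n)} (hx : x ∈ T.V i) :
    Metric.infDist x (frontier T.domain) ≤ 2 * T.Λ * T.sz i := by
  obtain ⟨z, hz, hd⟩ := T.off i
  have hzΩ : z ∉ T.domain := fun h => by
    obtain ⟨j, hj⟩ := mem_iUnion.1 h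
    exact hz j hj
  have h1 := infDist_frontier_le_dist (T.V_subset_domain i hx) hzΩ
  have h2 := T.dist_le i x hx
  have h3 := dist_triangle x (T.q i) z
  rw [dist_comm (T.q i)] at h3
  linarith

theorem eq_or_adj_of_dist_lt {i j : I} {x y : EuclideanSpace ℝ (Fin n)} (hx : x ∈ T.V i)
    (hy : y ∈ T.V j) (h : dist x y < T.c * max (T.sz i) (T.sz j)) : i = j ∨ T.Adj i j := by
  by_contra hcon
  simp only [Adj, not_or] at hcon
  exact absurd (T.sep i j hcon.1 hcon.2.1 hcon.2.2 x hx y hy) (not_le.2 h)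

theorem sz_le_of_adj {i j : I} (h : i = j ∨ T.Adj i j) : T.sz i ≤ T.Λ * T.sz j := by
  rcases h with rfl | ⟨h0, rfl⟩ | ⟨h0, rfl⟩
  · exact le_mul_of_one_le_left (T.sz_pos i).le T.one_le_Λ
  · exact T.sz_le_parent i h0
  · exact T.sz_parent_le j h0

theorem exists_gate {i j : I} (h : i = j ∨ T.Adj i j) :
    ∃ g, Metric.ball g (min (T.sz i) (T.sz j) / T.Λ) ⊆ T.V i ∩ T.V j := by
  have hΛ := T.Λ_pos
  rcases h with rfl | ⟨h0, rfl⟩ | ⟨h0, rfl⟩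
  · refine ⟨T.q i, ?_⟩
    rw [min_self, inter_self]
    exact (Metric.ball_subset_ball (div_le_self (T.sz_pos i).le T.one_le_Λ)).trans (T.ball_subset i)
  · refine ⟨T.g i, (Metric.ball_subset_ball ?_).trans (T.gate_subset i h0)⟩
    gcongr
    exact min_le_left _ _
  · refine ⟨T.g j, (Metric.ball_subset_ball ?_).trans ((T.gate_subset j h0).trans (inter_comm _ _).subset)⟩
    gcongr
    exact min_le_right _ _

/-- The point `x` moved towards the centre of the box `i` at scale `t`. -/
noncomputable def lift (i : I) (x : EuclideanSpace ℝ (Fin n)) (t : ℝ) :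
    EuclideanSpace ℝ (Fin n) := x + (t / T.sz i) • (T.q i - x)

theorem lift_zero (i : I) (x : EuclideanSpace ℝ (Fin n)) : T.lift i x 0 = x := by simp [lift]

theorem lift_sz (i : I) (x : EuclideanSpace ℝ (Fin n)) : T.lift i x (T.sz i) = T.q i := by
  simp [lift, div_self (T.sz_pos i).ne']

variable {i j : I} {x y : EuclideanSpace ℝ (Fin n)} {t t' : ℝ}

/-- At scale `t` the lifted point has a ball of radius `t` around it in the box, while by
`dist_lift_le` it has moved by at most `Λ * t`. So the lifting segment leaves the frontier as inside
a cone, which makes it a coarse quasihyperbolic geodesic. -/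
theorem ball_lift_subset (hx : x ∈ T.V i) (ht : 0 ≤ t) (ht' : t ≤ T.sz i) :
    Metric.ball (T.lift i x t) t ⊆ T.V i := by
  have := _root_.ball_lift_subset (convex_openBox _ _) hx (T.ball_subset i)
    (div_nonneg ht (T.sz_pos i).le) ((div_le_one (T.sz_pos i)).2 ht')
  rwa [div_mul_cancel₀ _ (T.sz_pos i).ne'] at this

theorem lift_mem (hx : x ∈ T.V i) (ht : 0 ≤ t) (ht' : t ≤ T.sz i) : T.lift i x t ∈ T.V i := by
  rcases ht.eq_or_lt with rfl | h
  · rwa [T.lift_zero]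
  · exact T.ball_lift_subset hx ht ht' (Metric.mem_ball_self h)

theorem dist_lift_le (hx : x ∈ T.V i) (ht : 0 ≤ t) : dist (T.lift i x t) x ≤ T.Λ * t := by
  have hsz := T.sz_pos i
  rw [lift, dist_eq_norm, add_sub_cancel_left, norm_smul, Real.norm_eq_abs,
    abs_of_nonneg (div_nonneg ht hsz.le), ← dist_eq_norm, dist_comm]
  calc t / T.sz i * dist x (T.q i) ≤ t / T.sz i * (T.Λ * T.sz i) := by
        gcongr; exact T.dist_le i x hx
    _ = T.Λ * t := by field_simp

theorem qhDist_le_of_balls {ρ : ℝ} (hρ : 0 < ρ) (hx : Metric.ball x ρ ⊆ T.V i)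
    (hy : Metric.ball y ρ ⊆ T.V i) : qhDist T.domain x y ≤ ENNReal.ofReal (dist x y / ρ) :=
  qhDist_le_of_convex T.isOpen_domain T.frontier_nonempty (convex_openBox _ _)
    (T.V_subset_domain i) hρ hx hy

theorem qhDist_ne_top_of_mem (hx : x ∈ T.V i) (hy : y ∈ T.V i) : qhDist T.domain x y ≠ ⊤ := by
  obtain ⟨ε, hε, hεV⟩ := Metric.isOpen_iff.1 (isOpen_openBox _ _) x hx
  obtain ⟨δ, hδ, hδV⟩ := Metric.isOpen_iff.1 (isOpen_openBox _ _) y hy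
  have := T.qhDist_le_of_balls (i := i) (lt_min hε hδ)
    ((Metric.ball_subset_ball (min_le_left ε δ)).trans hεV)
    ((Metric.ball_subset_ball (min_le_right ε δ)).trans hδV)
  exact (this.trans_lt ENNReal.ofReal_lt_top).ne

theorem qhDist_ne_top : ∀ x ∈ T.domain, ∀ y ∈ T.domain, qhDist T.domain x y ≠ ⊤ := by
  have hroot : ∀ N i, T.depth i = N → ∀ x ∈ T.V i, qhDist T.domain x (T.q T.root) ≠ ⊤ := by
    intro N
    induction N with
    | zero =>
      intro i hi x hx
      obtain rfl := T.eq_root i hi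
      exact T.qhDist_ne_top_of_mem hx (T.q_mem _)
    | succ N ih =>
      intro i hi x hx
      have h0 : T.depth i ≠ 0 := by omega
      have hg := T.gate_subset i h0 (Metric.mem_ball_self (div_pos (T.sz_pos i) T.Λ_pos))
      have h1 := T.qhDist_ne_top_of_mem hx hg.1
      have h2 := ih (T.parent i) (by have := T.depth_parent i h0; omega) _ hg.2
      exact ((qhDist_triangle).trans_lt (ENNReal.add_lt_top.2 ⟨h1.lt_top, h2.lt_top⟩)).ne
  intro x hx y hy
  obtain ⟨i, hi⟩ := mem_iUnion.1 hx
  obtain ⟨j, hj⟩ := mem_iUnion.1 hy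
  have h1 := hroot _ i rfl x hi
  have h2 := hroot _ j rfl y hj
  rw [qhDist_comm] at h2
  exact ((qhDist_triangle).trans_lt (ENNReal.add_lt_top.2 ⟨h1.lt_top, h2.lt_top⟩)).ne

theorem qhK_le_of_balls {ρ : ℝ} (hρ : 0 < ρ) (hx : Metric.ball x ρ ⊆ T.V i)
    (hy : Metric.ball y ρ ⊆ T.V i) : qhK T.domain x y ≤ dist x y / ρ :=
  qhK_le_of_qhDist_le (by positivity) (T.qhDist_le_of_balls hρ hx hy)

/-- The constant in the Harnack type estimate for lifted points. -/
noncomputable def harnack (a : ℝ) : ℝ := T.Λ * (2 * a + 2 * T.Λ * a + 4 * T.Λ)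

theorem harnack_nonneg {a : ℝ} (ha : 0 ≤ a) : 0 ≤ T.harnack a := by
  have := T.Λ_pos
  unfold harnack
  positivity

theorem harnack_mono {a b : ℝ} (hab : a ≤ b) : T.harnack a ≤ T.harnack b := by
  have := T.Λ_pos
  unfold harnack
  gcongr

/-- A Harnack chain through the overlap of the two boxes: a point `z` of the overlap close to `x`
and `y` is pushed towards the centre of the gate at scale `τ`, and the result is joined to both
lifted points by segments inside the convex boxes, with balls of radius `τ / Λ` around all points.
-/
theorem qhK_lift_le {a τ : ℝ} (hij : i = j ∨ T.Adj i j) (hx : x ∈ T.V i) (hy : y ∈ T.V j)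
    (hτ : 0 < τ) (h1 : τ ≤ t) (h2 : t ≤ a * τ) (h3 : τ ≤ t') (h4 : t' ≤ a * τ)
    (hd : dist x y ≤ a * τ) (hti : t ≤ T.sz i) (htj : t' ≤ T.sz j) :
    qhK T.domain (T.lift i x t) (T.lift j y t') ≤ T.harnack a := by
  have hΛ := T.Λ_pos
  have hΛ1 := T.one_le_Λ
  obtain ⟨g, hg⟩ := T.exists_gate hij
  set m := min (T.sz i) (T.sz j) with hm
  have hm0 : 0 < m := lt_min (T.sz_pos i) (T.sz_pos j)
  have hτm : τ ≤ m := le_min (h1.trans hti) (h3.trans htj)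
  have hgmem := hg (Metric.mem_ball_self (by positivity))
  obtain ⟨z, hz, hxz, hzy⟩ := exists_mem_inter_openBox hx hy hgmem
  set z' := z + (τ / m) • (g - z) with hz'
  have hzball : Metric.ball z' (τ / T.Λ) ⊆ T.V i ∩ T.V j := by
    have := _root_.ball_lift_subset ((convex_openBox _ _).inter (convex_openBox _ _)) hz hg
      (div_nonneg hτ.le hm0.le) ((div_le_one hm0).2 hτm)
    have e : τ / m * (m / T.Λ) = τ / T.Λ := by field_simp
    rwa [e] at this
  have hdz : dist z' z ≤ 2 * T.Λ * τ := by
    rw [hz', dist_eq_norm, add_sub_cancel_left, norm_smul, Real.norm_eq_abs,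
      abs_of_nonneg (div_nonneg hτ.le hm0.le), ← dist_eq_norm]
    have hgz : dist g z ≤ 2 * T.Λ * m := by
      rcases min_choice (T.sz i) (T.sz j) with h | h
      · have k1 := T.dist_le i g hgmem.1
        have k2 := T.dist_le i z hz.1
        have := dist_triangle_right g z (T.q i)
        rw [hm, h]; linarith
      · have k1 := T.dist_le j g hgmem.2
        have k2 := T.dist_le j z hz.2
        have := dist_triangle_right g z (T.q j)
        rw [hm, h]; linarith
    calc τ / m * dist g z ≤ τ / m * (2 * T.Λ * m) := by gcongr
      _ = 2 * T.Λ * τ := by field_simp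
  have hρ : 0 < τ / T.Λ := by positivity
  have hle : τ / T.Λ ≤ τ := div_le_self hτ.le hΛ1
  have ht0 : 0 ≤ t := hτ.le.trans h1
  have ht0' : 0 ≤ t' := hτ.le.trans h3
  have k1 := T.qhK_le_of_balls (i := i) hρ ((Metric.ball_subset_ball (hle.trans h1)).trans
    (T.ball_lift_subset hx ht0 hti)) (hzball.trans inter_subset_left)
  have k2 := T.qhK_le_of_balls (i := j) hρ (hzball.trans inter_subset_right)
    ((Metric.ball_subset_ball (hle.trans h3)).trans (T.ball_lift_subset hy ht0' htj))
  have d1 : dist (T.lift i x t) z' ≤ T.Λ * (a * τ) + a * τ + 2 * T.Λ * τ := by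
    have e1 := T.dist_lift_le hx ht0
    have e2 := dist_triangle4_right (T.lift i x t) z' x z
    have e3 : T.Λ * t ≤ T.Λ * (a * τ) := by gcongr
    linarith
  have d2 : dist z' (T.lift j y t') ≤ T.Λ * (a * τ) + a * τ + 2 * T.Λ * τ := by
    have e1 := T.dist_lift_le hy ht0'
    have e2 := dist_triangle4_right z' (T.lift j y t') z y
    have e3 : T.Λ * t' ≤ T.Λ * (a * τ) := by gcongr
    linarith
  have hmem : z' ∈ T.domain := T.V_subset_domain i (hzball (Metric.mem_ball_self hρ)).1
  have tri := qhK_triangle T.qhDist_ne_top (T.V_subset_domain i (T.lift_mem hx ht0 hti)) hmem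
    (T.V_subset_domain j (T.lift_mem hy ht0' htj))
  have e : (T.Λ * (a * τ) + a * τ + 2 * T.Λ * τ) / (τ / T.Λ) * 2 = T.harnack a := by
    unfold harnack; field_simp; ring
  have f1 : dist (T.lift i x t) z' / (τ / T.Λ) ≤
      (T.Λ * (a * τ) + a * τ + 2 * T.Λ * τ) / (τ / T.Λ) := by gcongr
  have f2 : dist z' (T.lift j y t') / (τ / T.Λ) ≤
      (T.Λ * (a * τ) + a * τ + 2 * T.Λ * τ) / (τ / T.Λ) := by gcongr
  linarith

/-- A bound for the distance of the centres of adjacent boxes. -/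
noncomputable def linkBound : ℝ := T.harnack (2 * T.Λ ^ 2)

theorem qhK_q_le (hij : i = j ∨ T.Adj i j) : qhK T.domain (T.q i) (T.q j) ≤ T.linkBound := by
  have hΛ1 := T.one_le_Λ
  have hΛ := T.Λ_pos
  obtain ⟨g, hg⟩ := T.exists_gate hij
  have hm0 : 0 < min (T.sz i) (T.sz j) := lt_min (T.sz_pos i) (T.sz_pos j)
  have hgmem := hg (Metric.mem_ball_self (by positivity))
  have e1 := T.sz_le_of_adj hij
  have e2 := T.sz_le_of_adj (i := j) (j := i) (by
    rcases hij with rfl | h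
    · exact Or.inl rfl
    · exact Or.inr h.symm)
  have e3 : ∀ k, k = i ∨ k = j → T.sz k ≤ T.Λ * min (T.sz i) (T.sz j) := by
    have f1 := le_mul_of_one_le_left (T.sz_pos i).le hΛ1
    have f2 := le_mul_of_one_le_left (T.sz_pos j).le hΛ1
    rintro k (rfl | rfl) <;> rw [mul_min_of_nonneg _ _ hΛ.le] <;> exact le_min ‹_› ‹_›
  have e4 : ∀ u, 0 ≤ u → u ≤ T.Λ * min (T.sz i) (T.sz j) →
      u ≤ 2 * T.Λ ^ 2 * min (T.sz i) (T.sz j) := by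
    intro u _ hu
    refine hu.trans ?_
    gcongr
    nlinarith
  -- The gate point `g` lies in both boxes, and its lift at full scale is the centre of either box.
  have := T.qhK_lift_le (a := 2 * T.Λ ^ 2) (τ := min (T.sz i) (T.sz j)) (x := g) (y := g)
    (t := T.sz i) (t' := T.sz j) hij hgmem.1 hgmem.2 hm0 (min_le_left _ _)
    (e4 _ (T.sz_pos i).le (e3 i (Or.inl rfl))) (min_le_right _ _)
    (e4 _ (T.sz_pos j).le (e3 j (Or.inr rfl))) (by rw [dist_self]; positivity) le_rfl le_rfl
  rwa [T.lift_sz, T.lift_sz] at this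

end BoxTree

/-! ### Guessed geodesics in a tree of boxes: slimness, smallness and coarse connectedness. -/

namespace BoxTree

variable {n : ℕ} {I : Type*} (T : BoxTree n I)

open Classical in
/-- A box containing the point `x`. -/
noncomputable def node (x : EuclideanSpace ℝ (Fin n)) : I :=
  if h : ∃ i, x ∈ T.V i then h.choose else T.root

variable {x y z w : EuclideanSpace ℝ (Fin n)}

theorem mem_V_node (hx : x ∈ T.domain) : x ∈ T.V (T.node x) := by
  have h : ∃ i, x ∈ T.V i := mem_iUnion.1 hx
  rw [node, dif_pos h]
  exact h.choose_spec

/-- The points of the lifting segment of `x` up to scale `r`. -/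
def hair (x : EuclideanSpace ℝ (Fin n)) (r : ℝ) : Set (EuclideanSpace ℝ (Fin n)) :=
  {w | ∃ t, 0 ≤ t ∧ t ≤ T.sz (T.node x) ∧ t ≤ r ∧ w = T.lift (T.node x) x t}

/-- The centres of boxes on the tree path between two points that are not close. -/
def spine (x y : EuclideanSpace ℝ (Fin n)) : Set (EuclideanSpace ℝ (Fin n)) :=
  {w | T.c * max (T.sz (T.node x)) (T.sz (T.node y)) ≤ dist x y ∧
    ∃ l ∈ T.Seg (T.node x) (T.node y), w = T.q l}

/-- The guessed quasihyperbolic geodesic. -/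
def guess (x y : EuclideanSpace ℝ (Fin n)) : Set (EuclideanSpace ℝ (Fin n)) :=
  T.hair x (dist x y) ∪ T.hair y (dist x y) ∪ T.spine x y

theorem guess_comm (x y : EuclideanSpace ℝ (Fin n)) : T.guess x y = T.guess y x := by
  have : T.spine x y = T.spine y x := by
    unfold spine
    rw [T.seg_comm, max_comm, dist_comm]
  rw [guess, guess, this, dist_comm, union_comm (T.hair x _)]

theorem hair_subset (hx : x ∈ T.domain) (r : ℝ) : T.hair x r ⊆ T.domain := by
  rintro w ⟨t, h0, h1, -, rfl⟩
  exact T.V_subset_domain _ (T.lift_mem (T.mem_V_node hx) h0 h1)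

theorem guess_subset (hx : x ∈ T.domain) (hy : y ∈ T.domain) : T.guess x y ⊆ T.domain := by
  rintro w ((hw | hw) | ⟨-, l, -, rfl⟩)
  · exact T.hair_subset hx _ hw
  · exact T.hair_subset hy _ hw
  · exact T.V_subset_domain _ (T.q_mem l)

/-- The slimness constant. -/
noncomputable def slimBound : ℝ := T.harnack (4 * T.Λ / T.c) + 2 * T.linkBound + 2

theorem linkBound_nonneg : 0 ≤ T.linkBound := T.harnack_nonneg (by positivity)

theorem harnack_le_slimBound {a : ℝ} (ha : a ≤ 4 * T.Λ / T.c) :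
    T.harnack a + 2 * T.linkBound + 2 ≤ T.slimBound := by
  have := T.harnack_mono ha
  unfold slimBound
  linarith

theorem slimBound_nonneg : 0 ≤ T.slimBound := by
  have h1 := T.linkBound_nonneg
  have h2 := T.harnack_nonneg (a := 4 * T.Λ / T.c)
    (div_nonneg (by linarith [T.Λ_pos]) T.c_pos.le)
  unfold slimBound
  linarith

theorem bounds : 1 ≤ 4 * T.Λ / T.c ∧ 2 / T.c ≤ 4 * T.Λ / T.c ∧ 2 * T.Λ / T.c ≤ 4 * T.Λ / T.c ∧
    2 * T.Λ ≤ 4 * T.Λ / T.c ∧ 2 ≤ 4 * T.Λ / T.c := by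
  have h1 := T.one_le_Λ
  have h2 := T.c_pos
  have h3 := T.c_le_one
  refine ⟨?_, ?_, ?_, ?_, ?_⟩
  · rw [le_div_iff₀ h2]; nlinarith
  · gcongr; linarith
  · gcongr; linarith
  · rw [le_div_iff₀ h2]; nlinarith
  · rw [le_div_iff₀ h2]; nlinarith

theorem qhK_lift_lift_le {i : I} {t a τ : ℝ} (hx : x ∈ T.V i) (hτ : 0 < τ) (h1 : τ ≤ t)
    (h2 : t ≤ a * τ) (ha : 1 ≤ a) (hti : t ≤ T.sz i) :
    qhK T.domain (T.lift i x t) (T.lift i x τ) ≤ T.harnack a :=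
  T.qhK_lift_le (Or.inl rfl) hx hx hτ h1 h2 le_rfl (le_mul_of_one_le_left hτ.le ha)
    (by rw [dist_self]; positivity) hti (h1.trans hti)

/-- If `x, z` are far apart, the centre `q l` is itself in the guess. Otherwise `l` is one of two
equal or adjacent nodes, and if `z, y` are far apart the centre for `z` serves. In the remaining
case all nodes are comparable, while one of the two distances is at least half of `dist x y`; the
corresponding hair then climbs to a scale comparable to its box, hence close to the centre. -/
theorem slim_spine (hx : x ∈ T.domain) (hy : y ∈ T.domain) (hz : z ∈ T.domain) {l : I}
    (hxy : T.c * max (T.sz (T.node x)) (T.sz (T.node y)) ≤ dist x y)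
    (hl : l ∈ T.Seg (T.node x) (T.node z)) :
    ∃ w' ∈ T.guess x z ∪ T.guess z y, qhK T.domain (T.q l) w' ≤ T.slimBound := by
  have hΛ := T.Λ_pos
  have hΛ1 := T.one_le_Λ
  have hc := T.c_pos
  have hc1 := T.c_le_one
  have hB := T.linkBound_nonneg
  obtain ⟨b1, b2, b3, b4, b5⟩ := T.bounds
  have hA := T.harnack_nonneg (zero_le_one.trans b1)
  have hsb := T.harnack_le_slimBound le_rfl
  set i := T.node x with hi
  set j := T.node y with hj
  set h := T.node z with hh
  have hxi := T.mem_V_node hx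
  have hyj := T.mem_V_node hy
  have hzh := T.mem_V_node hz
  rw [← hi] at hxi
  rw [← hj] at hyj
  rw [← hh] at hzh
  have hqΩ : ∀ l, T.q l ∈ T.domain := fun l => T.V_subset_domain l (T.q_mem l)
  by_cases hxz : T.c * max (T.sz i) (T.sz h) ≤ dist x z
  · refine ⟨T.q l, Or.inl (Or.inr ⟨hxz, l, hl, rfl⟩), ?_⟩
    rw [qhK_self (hqΩ l)]
    exact T.slimBound_nonneg
  have hih := T.eq_or_adj_of_dist_lt hxi hzh (not_le.1 hxz)
  have hlh : qhK T.domain (T.q l) (T.q h) ≤ T.linkBound := by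
    rcases T.seg_subset_pair hih hl with rfl | rfl
    · exact T.qhK_q_le hih
    · exact T.qhK_q_le (Or.inl rfl)
  have hli : qhK T.domain (T.q l) (T.q i) ≤ T.linkBound := by
    rcases T.seg_subset_pair hih hl with rfl | rfl
    · exact T.qhK_q_le (Or.inl rfl)
    · exact T.qhK_q_le (hih.imp Eq.symm Adj.symm)
  by_cases hzy : T.c * max (T.sz h) (T.sz j) ≤ dist z y
  · exact ⟨T.q h, Or.inr (Or.inr ⟨hzy, h, T.left_mem_seg _ _, rfl⟩), by linarith⟩
  have hhj := T.eq_or_adj_of_dist_lt hzh hyj (not_le.1 hzy)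
  have htri := dist_triangle x z y
  have hM : 0 ≤ max (T.sz i) (T.sz j) := (T.sz_pos i).le.trans (le_max_left _ _)
  rcases le_or_gt (T.c * max (T.sz i) (T.sz j) / 2) (dist x z) with hcase | hcase
  · have hsi := T.sz_pos i
    have ht0 : 0 < T.c / 2 * T.sz i := by positivity
    have htle : T.c / 2 * T.sz i ≤ T.sz i := mul_le_of_le_one_left hsi.le (by linarith)
    have htd : T.c / 2 * T.sz i ≤ dist x z := by
      refine le_trans ?_ hcase
      have := mul_le_mul_of_nonneg_left (le_max_left (T.sz i) (T.sz j)) hc.le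
      linarith
    have hk := T.qhK_lift_lift_le (t := T.sz i) (a := 2 / T.c) hxi ht0 htle
      (by field_simp; exact le_rfl) (by rw [le_div_iff₀ hc]; linarith) le_rfl
    rw [T.lift_sz] at hk
    refine ⟨T.lift i x (T.c / 2 * T.sz i), Or.inl (Or.inl (Or.inl ⟨_, ht0.le, htle, htd, rfl⟩)), ?_⟩
    have hmem := T.V_subset_domain i (T.lift_mem hxi ht0.le htle)
    have := qhK_triangle T.qhDist_ne_top (hqΩ l) (hqΩ i) hmem
    have := T.harnack_mono b2
    linarith
  · have hsh := T.sz_pos h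
    have ht0 : 0 < T.c / (2 * T.Λ) * T.sz h := by positivity
    have hcl : T.c / (2 * T.Λ) ≤ 1 := by rw [div_le_one (by positivity)]; linarith
    have htle : T.c / (2 * T.Λ) * T.sz h ≤ T.sz h := mul_le_of_le_one_left hsh.le hcl
    have htd : T.c / (2 * T.Λ) * T.sz h ≤ dist z y := by
      have h1 : T.c * max (T.sz i) (T.sz j) / 2 ≤ dist z y := by linarith
      refine le_trans ?_ h1
      have h2 := T.sz_le_of_adj hhj
      have h3 := le_max_right (T.sz i) (T.sz j)
      calc T.c / (2 * T.Λ) * T.sz h ≤ T.c / (2 * T.Λ) * (T.Λ * T.sz j) := by gcongr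
        _ = T.c * T.sz j / 2 := by field_simp
        _ ≤ _ := by gcongr
    have hk := T.qhK_lift_lift_le (t := T.sz h) (a := 2 * T.Λ / T.c) hzh ht0 htle
      (by field_simp; exact le_rfl) (by rw [le_div_iff₀ hc]; linarith) le_rfl
    rw [T.lift_sz] at hk
    refine ⟨T.lift h z (T.c / (2 * T.Λ) * T.sz h),
      Or.inr (Or.inl (Or.inl ⟨_, ht0.le, htle, htd, rfl⟩)), ?_⟩
    have hmem := T.V_subset_domain h (T.lift_mem hzh ht0.le htle)
    have := qhK_triangle T.qhDist_ne_top (hqΩ l) (hqΩ h) hmem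
    have := T.harnack_mono b3
    linarith

/-- Let `w` be the lift of `x` at scale `t ≤ dist x y`. If `z` is not much closer to `x` than `t`,
the hair of `x` towards `z` reaches a scale comparable to `t`. Otherwise `z` lies in the same or an
adjacent box and `dist z y ≥ t / 2`, so the hair of `z` towards `y` reaches such a scale. -/
theorem slim_hair (hx : x ∈ T.domain) (hz : z ∈ T.domain)
    (hw : w ∈ T.hair x (dist x y)) :
    ∃ w' ∈ T.guess x z ∪ T.guess z y, qhK T.domain w w' ≤ T.slimBound := by
  have hΛ := T.Λ_pos
  have hΛ1 := T.one_le_Λ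
  have hc := T.c_pos
  have hc1 := T.c_le_one
  have hB := T.linkBound_nonneg
  obtain ⟨b1, b2, b3, b4, b5⟩ := T.bounds
  obtain ⟨t, ht0, hti, htd, rfl⟩ := hw
  set i := T.node x with hi
  set h := T.node z with hh
  have hxi := T.mem_V_node hx
  have hzh := T.mem_V_node hz
  rw [← hi] at hxi
  rw [← hh] at hzh
  rcases ht0.eq_or_lt with rfl | ht0
  · refine ⟨T.lift i x 0, Or.inl (Or.inl (Or.inl ⟨0, le_rfl, hti, dist_nonneg, rfl⟩)), ?_⟩
    rw [qhK_self (by rwa [T.lift_zero])]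
    exact T.slimBound_nonneg
  rcases le_or_gt (T.c / 2 * t) (dist x z) with hcase | hcase
  · have ht0' : 0 < T.c / 2 * t := by positivity
    have htle : T.c / 2 * t ≤ t := mul_le_of_le_one_left ht0.le (by linarith)
    have hk := T.qhK_lift_lift_le (t := t) (a := 2 / T.c) hxi ht0' htle
      (by field_simp; exact le_rfl) (by rw [le_div_iff₀ hc]; linarith) hti
    refine ⟨T.lift i x (T.c / 2 * t), Or.inl (Or.inl (Or.inl
      ⟨_, ht0'.le, htle.trans hti, hcase, rfl⟩)), ?_⟩
    have := T.harnack_le_slimBound b2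
    linarith
  · have hnear : dist x z < T.c * max (T.sz i) (T.sz h) := by
      refine hcase.trans_le ?_
      have h1 := le_max_left (T.sz i) (T.sz h)
      calc T.c / 2 * t ≤ T.c * t := by gcongr; linarith
        _ ≤ _ := by gcongr; exact hti.trans h1
    have hih := T.eq_or_adj_of_dist_lt hxi hzh hnear
    have hsz := T.sz_le_of_adj hih
    have htri := dist_triangle x z y
    have htz : T.c / 2 * t ≤ t / 2 := by nlinarith
    have ht0' : 0 < t / (2 * T.Λ) := by positivity
    have hth : t / (2 * T.Λ) ≤ T.sz h := by
      rw [div_le_iff₀ (by positivity)]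
      have := (T.sz_pos h)
      nlinarith
    have htz2 : t / (2 * T.Λ) ≤ t / 2 := by
      gcongr; linarith
    have e : 2 * T.Λ * (t / (2 * T.Λ)) = t := by field_simp
    refine ⟨T.lift h z (t / (2 * T.Λ)), Or.inr (Or.inl (Or.inl
      ⟨_, ht0'.le, hth, by linarith, rfl⟩)), ?_⟩
    have := T.qhK_lift_le (a := 2 * T.Λ) (τ := t / (2 * T.Λ)) (t := t) (t' := t / (2 * T.Λ))
      hih hxi hzh ht0' (by linarith) (by rw [e]) le_rfl (by rw [e]; linarith) (by rw [e]; linarith)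
      hti hth
    have := T.harnack_le_slimBound b4
    linarith

theorem slim (hx : x ∈ T.domain) (hy : y ∈ T.domain) (hz : z ∈ T.domain) (hw : w ∈ T.guess x y) :
    ∃ w' ∈ T.guess x z ∪ T.guess z y, qhK T.domain w w' ≤ T.slimBound := by
  have hswap : T.guess x z ∪ T.guess z y = T.guess y z ∪ T.guess z x := by
    rw [union_comm, T.guess_comm z y, T.guess_comm x z]
  rcases hw with (hw | hw) | ⟨hd, l, hl, rfl⟩
  · exact T.slim_hair hx hz hw
  · rw [hswap]
    rw [dist_comm] at hw
    exact T.slim_hair hy hz hw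
  · rcases T.seg_subset_union _ _ (T.node z) hl with hl | hl
    · exact T.slim_spine hx hy hz hd hl
    · rw [hswap]
      rw [T.seg_comm] at hl
      rw [dist_comm, max_comm] at hd
      exact T.slim_spine hy hx hz hd hl

theorem qhK_lift_self_le {i : I} {t : ℝ} (hx : x ∈ T.V i) (ht : 0 ≤ t)
    (htd : T.Λ * t ≤ Metric.infDist x (frontier T.domain) / 2) :
    qhK T.domain (T.lift i x t) x ≤ 1 := by
  have hxΩ := T.V_subset_domain i hx
  have hd := infDist_frontier_pos T.isOpen_domain T.frontier_nonempty hxΩ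
  have h1 := T.dist_lift_le hx ht
  rw [dist_comm] at h1
  rw [qhK_comm]
  have h2 := qhDist_le_of_dist_le_half T.isOpen_domain T.frontier_nonempty hxΩ (h1.trans htd)
  refine (qhK_le_of_qhDist_le (by positivity) h2).trans ?_
  rw [div_le_one hd]
  linarith

/-- A small quasihyperbolic distance makes `dist x y` a small fraction `κ` of the distance to the
frontier. The hairs are then short compared with that distance, and the spine is empty. -/
theorem exists_small : ∃ ε > 0, ∀ x ∈ T.domain, ∀ y ∈ T.domain, qhK T.domain x y ≤ ε →
    ∀ w ∈ T.guess x y, qhK T.domain w x ≤ T.slimBound := by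
  have hΛ := T.Λ_pos
  have hΛ1 := T.one_le_Λ
  have hc := T.c_pos
  have hc1 := T.c_le_one
  set κ := T.c / (4 * T.Λ) with hκ
  have hκ0 : 0 < κ := by positivity
  obtain ⟨ε, hε, hε1, hεκ⟩ : ∃ ε > 0, ε ≤ 1 ∧ Real.exp (2 * ε) - 1 ≤ κ := by
    have h1 : Tendsto (fun ε : ℝ => Real.exp (2 * ε) - 1) (𝓝[>] 0) (𝓝 0) := by
      have : Continuous fun ε : ℝ => Real.exp (2 * ε) - 1 := by fun_prop
      have := this.tendsto 0
      simp only [mul_zero, Real.exp_zero, sub_self] at this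
      exact this.mono_left nhdsWithin_le_nhds
    have h2 := (h1.eventually (gt_mem_nhds hκ0)).and
      (Ioc_mem_nhdsGT (zero_lt_one (α := ℝ)))
    obtain ⟨ε, hε, hε'⟩ := h2.exists
    exact ⟨ε, hε'.1, hε'.2, hε.le⟩
  refine ⟨ε, hε, fun x hx y hy hk w hw => ?_⟩
  set i := T.node x with hi
  set j := T.node y with hj
  have hxi := T.mem_V_node hx
  have hyj := T.mem_V_node hy
  rw [← hi] at hxi
  rw [← hj] at hyj
  have hdx := infDist_frontier_pos T.isOpen_domain T.frontier_nonempty hx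
  have hdle := T.infDist_le hxi
  set d := Metric.infDist x (frontier T.domain) with hd
  have hdist : dist x y ≤ κ * d := by
    refine (dist_le_of_qhDist_lt hdx (ρ := 2 * ε) (by linarith) ?_).trans (by gcongr)
    rw [← ofReal_qhK T.qhDist_ne_top hx hy]
    exact (ENNReal.ofReal_lt_ofReal_iff (by linarith)).2 (by linarith)
  have hκΛ : T.Λ * (κ * d) ≤ d / 4 := by
    have : T.Λ * (κ * d) = T.c * (d / 4) := by rw [hκ]; field_simp
    rw [this]
    exact mul_le_of_le_one_left (by positivity) hc1
  have hκd : κ * d ≤ d / 4 := le_trans (le_mul_of_one_le_left (by positivity) hΛ1) hκΛ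
  have hdy : d ≤ Metric.infDist y (frontier T.domain) + dist x y :=
    Metric.infDist_le_infDist_add_dist
  have hA := T.harnack_nonneg (a := 4 * T.Λ / T.c) (by positivity)
  have hB := T.linkBound_nonneg
  have hsb := T.harnack_le_slimBound le_rfl
  rcases hw with (hw | hw) | ⟨hfar, -⟩
  · obtain ⟨t, ht0, -, htd, rfl⟩ := hw
    have : T.Λ * t ≤ T.Λ * (κ * d) := by gcongr; exact htd.trans hdist
    have := T.qhK_lift_self_le hxi ht0 (by linarith)
    linarith
  · obtain ⟨t, ht0, hti, htd, rfl⟩ := hw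
    have : T.Λ * t ≤ T.Λ * (κ * d) := by gcongr; exact htd.trans hdist
    have := T.qhK_lift_self_le hyj ht0 (by linarith)
    have htri := qhK_triangle T.qhDist_ne_top (T.V_subset_domain j (T.lift_mem hyj ht0 hti)) hy hx
    rw [qhK_comm (x := y)] at htri
    linarith
  · exfalso
    -- A nonempty spine would need `dist x y ≥ c * sz i`, but the choice of `κ` gives `dist x y ≤ κ
    -- * d ≤ c * sz i / 2`.
    have h1 : T.c * T.sz i ≤ κ * d := by
      refine le_trans ?_ (hfar.trans hdist)
      gcongr
      exact le_max_left _ _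
    have h2 : κ * d ≤ κ * (2 * T.Λ * T.sz i) := by gcongr
    have h3 : κ * (2 * T.Λ * T.sz i) = T.c * T.sz i / 2 := by rw [hκ]; field_simp; ring
    have := mul_pos hc (T.sz_pos i)
    linarith

/-- One step between points of the guess. -/
def GuessStep (P : Set (EuclideanSpace ℝ (Fin n))) (a b : EuclideanSpace ℝ (Fin n)) : Prop :=
  qhK T.domain a b ≤ T.slimBound ∧ a ∈ P ∧ b ∈ P

theorem GuessStep.symm {T : BoxTree n I} {P : Set (EuclideanSpace ℝ (Fin n))}
    {a b : EuclideanSpace ℝ (Fin n)} (h : T.GuessStep P a b) : T.GuessStep P b a :=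
  ⟨by rw [qhK_comm]; exact h.1, h.2.2, h.2.1⟩

/-- Descend through the dyadic scales `m / 2 ^ k`, each step being bounded. Once the scale is small
compared with the distance of `x` to the frontier, a single last step reaches `x`, so the chain is
finite. -/
theorem reflTransGen_hair (hx : x ∈ T.domain) {m : ℝ} (hm0 : 0 ≤ m) (hm : m ≤ T.sz (T.node x)) :
    Relation.ReflTransGen (T.GuessStep (T.hair x m)) x (T.lift (T.node x) x m) := by
  have hΛ := T.Λ_pos
  have hB := T.linkBound_nonneg
  have hxi := T.mem_V_node hx
  obtain ⟨b1, -, -, -, b5⟩ := T.bounds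
  rcases hm0.eq_or_lt with rfl | hm0
  · rw [T.lift_zero]
  set i := T.node x with hi
  have hdx := infDist_frontier_pos T.isOpen_domain T.frontier_nonempty hx
  set d := Metric.infDist x (frontier T.domain) with hd
  have hmem : ∀ k : ℕ, T.lift i x (m / 2 ^ k) ∈ T.hair x m := fun k =>
    have : m / 2 ^ k ≤ m := div_le_self hm0.le (one_le_pow₀ (by norm_num))
    ⟨m / 2 ^ k, by positivity, this.trans hm, this, rfl⟩
  have hchain : ∀ k : ℕ, Relation.ReflTransGen (T.GuessStep (T.hair x m))
      (T.lift i x (m / 2 ^ k)) (T.lift i x m) := by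
    intro k
    induction k with
    | zero => simp [Relation.ReflTransGen.refl]
    | succ k ih =>
      refine Relation.ReflTransGen.head ⟨?_, hmem (k + 1), hmem k⟩ ih
      have h2 : m / 2 ^ k = 2 * (m / 2 ^ (k + 1)) := by rw [pow_succ]; field_simp
      have hle : m / 2 ^ k ≤ m := div_le_self hm0.le (one_le_pow₀ (by norm_num))
      have hp : 0 < m / 2 ^ (k + 1) := by positivity
      have := T.qhK_lift_lift_le (t := m / 2 ^ k) (a := 2) hxi hp (by linarith) h2.le (by norm_num)
        (hle.trans hm)
      rw [qhK_comm]
      have := T.harnack_le_slimBound b5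
      linarith
  obtain ⟨k, hk⟩ := pow_unbounded_of_one_lt (2 * T.Λ * m / d) (one_lt_two (α := ℝ))
  refine Relation.ReflTransGen.head ⟨?_, ⟨0, le_rfl, (T.sz_pos i).le, hm0.le, (T.lift_zero i x).symm⟩,
    hmem k⟩ (hchain k)
  rw [div_lt_iff₀ hdx] at hk
  have := T.qhK_lift_self_le (t := m / 2 ^ k) hxi (by positivity) (by
    rw [← mul_div_assoc, div_le_iff₀ (by positivity)]
    linarith)
  rw [qhK_comm]
  have h1 := T.harnack_le_slimBound le_rfl
  have h2 := T.harnack_nonneg (zero_le_one.trans b1)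
  linarith

theorem GuessStep.mono {T : BoxTree n I} {P Q : Set (EuclideanSpace ℝ (Fin n))} (h : P ⊆ Q)
    {a b : EuclideanSpace ℝ (Fin n)} (hab : Relation.ReflTransGen (T.GuessStep P) a b) :
    Relation.ReflTransGen (T.GuessStep Q) a b :=
  hab.lift id fun _ _ hs => ⟨hs.1, h hs.2.1, h hs.2.2⟩

/-- Climb the hair of `x`, cross, and descend the hair of `y`. For close points the hairs end at the
common scale `dist x y` and one step joins them; for distant points they end near the centres, which
are linked along the tree path. -/
theorem reflTransGen_guess (hx : x ∈ T.domain) (hy : y ∈ T.domain) :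
    Relation.ReflTransGen (T.GuessStep (T.guess x y)) x y := by
  have hΛ := T.Λ_pos
  have hΛ1 := T.one_le_Λ
  have hc := T.c_pos
  have hc1 := T.c_le_one
  have hB := T.linkBound_nonneg
  obtain ⟨b1, b2, b3, b4, b5⟩ := T.bounds
  rcases eq_or_ne x y with rfl | hne
  · exact Relation.ReflTransGen.refl
  have hd0 : 0 < dist x y := dist_pos.2 hne
  set i := T.node x with hi
  set j := T.node y with hj
  have hxi := T.mem_V_node hx
  have hyj := T.mem_V_node hy
  rw [← hi] at hxi
  rw [← hj] at hyj
  have hsi := T.sz_pos i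
  have hsj := T.sz_pos j
  set m := min (T.sz i) (dist x y) with hm
  set m' := min (T.sz j) (dist x y) with hm'
  have hm0 : 0 < m := lt_min hsi hd0
  have hm0' : 0 < m' := lt_min hsj hd0
  have c1 : Relation.ReflTransGen (T.GuessStep (T.guess x y)) x (T.lift i x m) := by
    refine GuessStep.mono ?_ (T.reflTransGen_hair hx hm0.le (min_le_left _ _))
    rintro w ⟨t, h0, h1, h2, rfl⟩
    exact Or.inl (Or.inl ⟨t, h0, h1, h2.trans (min_le_right _ _), rfl⟩)
  have c2 : Relation.ReflTransGen (T.GuessStep (T.guess x y)) y (T.lift j y m') := by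
    refine GuessStep.mono ?_ (T.reflTransGen_hair hy hm0'.le (min_le_left _ _))
    rintro w ⟨t, h0, h1, h2, rfl⟩
    exact Or.inl (Or.inr ⟨t, h0, h1, h2.trans (min_le_right _ _), rfl⟩)
  have mem1 : T.lift i x m ∈ T.guess x y :=
    Or.inl (Or.inl ⟨m, hm0.le, min_le_left _ _, min_le_right _ _, rfl⟩)
  have mem2 : T.lift j y m' ∈ T.guess x y :=
    Or.inl (Or.inr ⟨m', hm0'.le, min_le_left _ _, min_le_right _ _, rfl⟩)
  refine (c1.trans ?_).trans (c2.symm_of_symm fun _ _ h => h.symm)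
  rcases lt_or_ge (dist x y) (T.c * max (T.sz i) (T.sz j)) with hnear | hfar
  · have hij := T.eq_or_adj_of_dist_lt hxi hyj hnear
    have hji : j = i ∨ T.Adj j i := hij.imp Eq.symm Adj.symm
    -- This is where `c * Λ ≤ 1` enters: close points are nearer to each other than either box size,
    -- so both hairs reach the scale `dist x y`.
    have key : ∀ k, max (T.sz i) (T.sz j) ≤ T.Λ * T.sz k → dist x y ≤ T.sz k := by
      intro k hk
      have hsk := T.sz_pos k
      calc dist x y ≤ T.c * max (T.sz i) (T.sz j) := hnear.le
        _ ≤ T.c * (T.Λ * T.sz k) := by gcongr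
        _ = T.c * T.Λ * T.sz k := by ring
        _ ≤ T.sz k := mul_le_of_le_one_left hsk.le T.c_mul_Λ
    have e1 : m = dist x y := min_eq_right (key i (max_le
      (le_mul_of_one_le_left hsi.le hΛ1) (T.sz_le_of_adj hji)))
    have e2 : m' = dist x y := min_eq_right (key j (max_le (T.sz_le_of_adj hij)
      (le_mul_of_one_le_left hsj.le hΛ1)))
    refine Relation.ReflTransGen.single ⟨?_, mem1, mem2⟩
    have := T.qhK_lift_le (a := 1) (τ := dist x y) (t := m) (t' := m') hij hxi hyj hd0
      e1.ge (by rw [e1, one_mul]) e2.ge (by rw [e2, one_mul]) (by rw [one_mul]) (min_le_left _ _)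
      (min_le_left _ _)
    have := T.harnack_le_slimBound b1
    linarith
  · have hq : ∀ l ∈ T.Seg i j, T.q l ∈ T.guess x y := fun l hl => Or.inr ⟨hfar, l, hl, rfl⟩
    have hlink : ∀ k, ∀ u ∈ T.V k, T.sz k ≤ max (T.sz i) (T.sz j) →
        qhK T.domain (T.q k) (T.lift k u (min (T.sz k) (dist x y))) ≤ T.slimBound := by
      intro k u hu hk
      have hsk := T.sz_pos k
      have hmk : T.c * T.sz k ≤ min (T.sz k) (dist x y) :=
        le_min (mul_le_of_le_one_left hsk.le hc1) (le_trans (by gcongr) hfar)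
      have := T.qhK_lift_lift_le (x := u) (i := k) (t := T.sz k) (a := 2 / T.c)
        (τ := min (T.sz k) (dist x y)) hu (lt_min hsk hd0) (min_le_left _ _) (by
          rw [div_mul_eq_mul_div, le_div_iff₀ hc]
          nlinarith [mul_pos hc hsk]) (by rw [le_div_iff₀ hc]; linarith) le_rfl
      rw [T.lift_sz] at this
      have := T.harnack_le_slimBound b2
      linarith
    have s1 : T.GuessStep (T.guess x y) (T.lift i x m) (T.q i) :=
      ⟨by rw [qhK_comm]; exact hlink i x hxi (le_max_left _ _), mem1, hq i (T.left_mem_seg _ _)⟩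
    have s2 : T.GuessStep (T.guess x y) (T.q j) (T.lift j y m') :=
      ⟨hlink j y hyj (le_max_right _ _), hq j (T.right_mem_seg _ _), mem2⟩
    refine Relation.ReflTransGen.head s1 (Relation.ReflTransGen.tail ?_ s2)
    refine (T.reflTransGen_seg i j).lift T.q fun a b h => ⟨?_, hq a h.2.1, hq b h.2.2⟩
    have := T.qhK_q_le (Or.inr h.1)
    have := T.harnack_le_slimBound le_rfl
    have := T.harnack_nonneg (zero_le_one.trans b1)
    linarith

theorem _root_.exists_chain_of_reflTransGen {α : Type*} {r : α → α → Prop} {a b : α}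
    (h : Relation.ReflTransGen r a b) :
    ∃ (N : ℕ) (f : ℕ → α), f 0 = a ∧ f N = b ∧ ∀ i < N, r (f i) (f (i + 1)) := by
  induction h with
  | refl => exact ⟨0, fun _ => a, rfl, rfl, fun i hi => absurd hi (Nat.not_lt_zero i)⟩
  | @tail b c _ hbc ih =>
    obtain ⟨N, f, h0, hN, hf⟩ := ih
    refine ⟨N + 1, fun k => if k ≤ N then f k else c, by simp [h0], by simp, fun i hi => ?_⟩
    rcases (Nat.lt_succ_iff.1 hi).eq_or_lt with rfl | hlt
    · simpa [hN] using hbc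
    · simpa [hlt.le, Nat.succ_le_of_lt hlt] using hf i hlt

/-- The union of a bounded tree of boxes is Gromov hyperbolic in the quasihyperbolic metric. -/
theorem isGromovHyperbolicDomain (hb : Bornology.IsBounded T.domain) :
    IsGromovHyperbolicDomain T.domain := by
  obtain ⟨ε, hε, hsmall⟩ := T.exists_small
  refine isGromovHyperbolicDomain_of_isPathGuess T.qhDist_ne_top T.isOpen_domain hb
    T.frontier_nonempty (η := T.guess) (ε := ε) (h := T.slimBound) ?_
  refine ⟨fun x _ y _ => qhK_nonneg, fun x _ y _ => qhK_comm, fun x hx y hy z hz =>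
    qhK_triangle T.qhDist_ne_top hx hy hz, fun x hx => qhK_self hx, hε, T.slimBound_nonneg,
    fun x hx y hy => T.guess_subset hx hy, hsmall, fun x hx y hy z hz w hw => T.slim hx hy hz hw,
    fun x hx y hy => ?_⟩
  obtain ⟨N, f, h0, hN, hf⟩ := exists_chain_of_reflTransGen (T.reflTransGen_guess hx hy)
  refine ⟨N, f, h0, hN, fun i hi => ?_, fun i hi => (hf i hi).1⟩
  rcases hi.eq_or_lt with rfl | hlt
  · rcases i with _ | i
    · rw [h0]
      exact Or.inl (Or.inl ⟨0, le_rfl, (T.sz_pos _).le, dist_nonneg, (T.lift_zero _ _).symm⟩)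
    · exact (hf i (Nat.lt_succ_self i)).2.2
  · exact (hf i hlt).2.1

end BoxTree

/-! ### John curves in trees of boxes -/

section JohnCurve

variable {n : ℕ} {s C : ℝ} {Ω : Set (EuclideanSpace ℝ (Fin n))}
  {x y x₀ : EuclideanSpace ℝ (Fin n)}

/-- There is a curve of speed at most one from `x` to `x₀` whose distance to the boundary is
controlled by the `s`-th power of the elapsed length, the length being counted from `a`. -/
def HasJohnCurve (s C : ℝ) (Ω : Set (EuclideanSpace ℝ (Fin n)))
    (x₀ : EuclideanSpace ℝ (Fin n)) (a : ℝ) (x : EuclideanSpace ℝ (Fin n)) : Prop :=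
  ∃ (L : ℝ) (γ : ℝ → EuclideanSpace ℝ (Fin n)), 0 ≤ L ∧ LipschitzWith 1 γ ∧ γ 0 = x ∧ γ L = x₀ ∧
    ∀ t ∈ Icc 0 L, γ t ∈ Ω ∧ (a + t) ^ s ≤ C * Metric.infDist (γ t) (frontier Ω)

theorem HasJohnCurve.mono {a b : ℝ} (hs : 0 ≤ s) (ha : 0 ≤ a) (hab : a ≤ b)
    (h : HasJohnCurve s C Ω x₀ b x) : HasJohnCurve s C Ω x₀ a x := by
  obtain ⟨L, γ, hL, hγ, h0, h1, h⟩ := h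
  refine ⟨L, γ, hL, hγ, h0, h1, fun t ht => ⟨(h t ht).1, le_trans ?_ (h t ht).2⟩⟩
  exact Real.rpow_le_rpow (by linarith [ht.1]) (by linarith) hs

/-- Prepending a segment delays the rest of the curve by its length, which the larger initial offset
`b` has already paid for. This allows John curves to be built box by box towards the root. -/
theorem HasJohnCurve.cons {a b : ℝ} (hs : 0 ≤ s) (ha : 0 ≤ a) (hab : a + dist x y ≤ b)
    (hseg : ∀ τ ∈ Icc (0 : ℝ) 1, AffineMap.lineMap x y τ ∈ Ω ∧ (a + τ * dist x y) ^ s ≤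
      C * Metric.infDist (AffineMap.lineMap x y τ) (frontier Ω))
    (h : HasJohnCurve s C Ω x₀ b y) : HasJohnCurve s C Ω x₀ a x := by
  rcases eq_or_ne x y with rfl | hxy
  · exact h.mono hs ha (by simpa using hab)
  obtain ⟨L, γ, hL, hγ, h0, h1, h⟩ := h
  set d := dist x y with hd
  have hd0 : 0 < d := dist_pos.2 hxy
  set σ : ℝ → EuclideanSpace ℝ (Fin n) := fun t => AffineMap.lineMap x y (t / d) with hσ
  have hσd : ∀ t t', dist (σ t) (σ t') = |t - t'| := by
    intro t t'
    rw [hσ]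
    simp only
    rw [dist_lineMap_lineMap, Real.dist_eq, ← sub_div, abs_div, abs_of_pos hd0]
    rw [← hd, div_mul_cancel₀ _ hd0.ne']
  have hσ0 : σ 0 = x := by simp [hσ]
  have hσ1 : σ d = y := by simp [hσ, div_self hd0.ne']
  have hγd : ∀ t t', dist (γ t) (γ t') ≤ |t - t'| := fun t t' => by
    simpa [Real.dist_eq] using hγ.dist_le_mul t t'
  set δ : ℝ → EuclideanSpace ℝ (Fin n) := fun t => if t ≤ d then σ t else γ (t - d) with hδ
  have key : ∀ t t', t ≤ t' → dist (δ t) (δ t') ≤ |t - t'| := by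
    intro t t' htt
    by_cases h1 : t ≤ d <;> by_cases h2 : t' ≤ d
    · simp only [hδ, h1, h2, if_true]
      exact (hσd t t').le
    · simp only [hδ, h1, h2, if_true, if_false]
      have e1 := hσd t d
      have e2 := hγd 0 (t' - d)
      rw [h0] at e2
      rw [hσ1] at e1
      push Not at h2
      rw [abs_of_nonpos (by linarith)] at e1 e2 ⊢
      have := dist_triangle (σ t) y (γ (t' - d))
      linarith
    · exact absurd (htt.trans h2) h1
    · simp only [hδ, h1, h2, if_false]
      refine (hγd _ _).trans (le_of_eq ?_)
      congr 1; ring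
  refine ⟨d + L, δ, by positivity, ?_, ?_, ?_, ?_⟩
  · refine LipschitzWith.of_dist_le_mul fun t t' => ?_
    rw [NNReal.coe_one, one_mul, Real.dist_eq]
    rcases le_total t t' with h | h
    · exact key t t' h
    · rw [dist_comm, abs_sub_comm]; exact key t' t h
  · simp only [hδ, hd0.le, if_true, hσ0]
  · rcases hL.eq_or_lt with rfl | hL
    · simp only [hδ, add_zero, le_refl, if_true, hσ1, ← h1, h0]
    · simp only [hδ, not_le.2 (lt_add_of_pos_right d hL), if_false, add_sub_cancel_left, h1]
  · intro t ht
    by_cases htd : t ≤ d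
    · simp only [hδ, htd, if_true]
      have := hseg (t / d) ⟨div_nonneg ht.1 hd0.le, (div_le_one hd0).2 htd⟩
      rwa [div_mul_cancel₀ _ hd0.ne'] at this
    · simp only [hδ, htd, if_false]
      push Not at htd
      have := h (t - d) ⟨by linarith, by linarith [ht.2]⟩
      refine ⟨this.1, le_trans ?_ this.2⟩
      exact Real.rpow_le_rpow (by linarith [ht.1]) (by linarith) hs

/-- After rescaling to `[0, 1]`, the variation up to `t` is at most `L * t` since `γ` is
1-Lipschitz, so the elapsed parameter may replace arc length. -/
theorem HasJohnCurve.exists_curve (hs : 0 ≤ s) (h : HasJohnCurve s C Ω x₀ 0 x) :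
    ∃ γ : ℝ → EuclideanSpace ℝ (Fin n),
      ContinuousOn γ (Icc 0 1) ∧ MapsTo γ (Icc 0 1) Ω ∧ γ 0 = x ∧ γ 1 = x₀ ∧
      BoundedVariationOn γ (Icc 0 1) ∧
      ∀ t ∈ Ioc (0 : ℝ) 1,
        (eVariationOn γ (Icc 0 t)).toReal ^ s ≤ C * Metric.infDist (γ t) (frontier Ω) := by
  obtain ⟨L, γ, hL, hγ, h0, h1, h⟩ := h
  have hmem : ∀ t ∈ Icc (0 : ℝ) 1, L * t ∈ Icc 0 L := fun t ht =>
    ⟨mul_nonneg hL ht.1, mul_le_of_le_one_right hL ht.2⟩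
  have hvar : ∀ t ∈ Icc (0 : ℝ) 1,
      eVariationOn (fun t => γ (L * t)) (Icc 0 t) ≤ ENNReal.ofReal (L * t) := by
    intro t ht
    have e1 := (hγ.lipschitzOnWith (s := univ)).comp_eVariationOn_le
      (f := γ) (g := fun t => L * t) (s := Icc 0 t) (mapsTo_univ _ _)
    have hm : MonotoneOn (fun t => L * t) (Icc 0 t) :=
      (monotone_id.const_mul hL).monotoneOn _
    have e2 := hm.eVariationOn_eq (a := 0) (b := t) ⟨le_rfl, ht.1⟩ ⟨ht.1, le_rfl⟩
    rw [inter_self, mul_zero, sub_zero] at e2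
    rw [ENNReal.coe_one, one_mul] at e1
    exact e1.trans e2.le
  refine ⟨fun t => γ (L * t), (hγ.continuous.comp (by fun_prop)).continuousOn,
    fun t ht => (h _ (hmem t ht)).1, by simpa using h0, by simpa using h1, ?_, ?_⟩
  · exact ((hvar 1 ⟨zero_le_one, le_rfl⟩).trans_lt ENNReal.ofReal_lt_top).ne
  · intro t ht
    have ht' : t ∈ Icc (0 : ℝ) 1 := ⟨ht.1.le, ht.2⟩
    have e := (h _ (hmem t ht')).2
    rw [zero_add] at e
    refine le_trans (Real.rpow_le_rpow ENNReal.toReal_nonneg ?_ hs) e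
    exact ENNReal.toReal_le_of_le_ofReal (hmem t ht').1 (hvar t ht')

end JohnCurve

namespace BoxTree

variable {n : ℕ} {I : Type*} (T : BoxTree n I)

theorem le_infDist_of_ball {i : I} {x : EuclideanSpace ℝ (Fin n)} {ρ : ℝ}
    (h : Metric.ball x ρ ⊆ T.V i) : ρ ≤ Metric.infDist x (frontier T.domain) :=
  le_infDist_frontier_of_ball_subset T.isOpen_domain T.frontier_nonempty
    (h.trans (T.V_subset_domain i))

/-- Along a segment joining the centres of two `ρ`-balls in one box the distance to the frontier is
at least `ρ`, so only the final length `b` has to be checked. -/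
theorem hasJohnCurve_of_balls {s C a b ρ : ℝ} {i : I} {x y x₀ : EuclideanSpace ℝ (Fin n)}
    (hs : 0 ≤ s) (ha : 0 ≤ a) (hC : 0 ≤ C) (hρ : 0 < ρ) (hx : Metric.ball x ρ ⊆ T.V i)
    (hy : Metric.ball y ρ ⊆ T.V i) (hab : a + dist x y ≤ b) (hb : b ^ s ≤ C * ρ)
    (h : HasJohnCurve s C T.domain x₀ b y) : HasJohnCurve s C T.domain x₀ a x := by
  refine h.cons hs ha hab fun τ hτ => ?_
  have hball : Metric.ball (AffineMap.lineMap x y τ) ρ ⊆ T.V i :=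
    ball_subset_of_mem_segment (convex_openBox _ _) hx hy
      (segment_eq_image_lineMap ℝ x y ▸ mem_image_of_mem _ hτ)
  refine ⟨T.V_subset_domain i (hball (Metric.mem_ball_self hρ)), ?_⟩
  have hd : (0 : ℝ) ≤ dist x y := dist_nonneg
  calc (a + τ * dist x y) ^ s ≤ b ^ s :=
        Real.rpow_le_rpow (by have := mul_nonneg hτ.1 hd; linarith)
          (by have := mul_le_of_le_one_left hd hτ.2; linarith) hs
    _ ≤ C * ρ := hb
    _ ≤ _ := by gcongr; exact T.le_infDist_of_ball hball

/-- A tree of boxes with a suitable potential is a John domain. -/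
theorem isSJohnDomain (hb : Bornology.IsBounded T.domain) {s C B : ℝ} (hs : 1 ≤ s) (a : I → ℝ)
    (h1 : ∀ i, T.Λ * T.sz i ≤ a i)
    (h2 : ∀ i, T.depth i ≠ 0 → a i + T.Λ * T.sz i + T.Λ * T.sz (T.parent i) ≤ a (T.parent i))
    (h3 : ∀ i, T.depth i ≠ 0 → a (T.parent i) ^ s ≤ C * T.sz i)
    (h3' : a T.root ^ s ≤ C * T.sz T.root) (h4 : ∀ i, a i ≤ B) :
    IsSJohnDomain s T.domain (T.q T.root) := by
  have hΛ := T.Λ_pos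
  have hΛ1 := T.one_le_Λ
  have hs0 : 0 ≤ s := by linarith
  have ha : ∀ i, 0 < a i := fun i => lt_of_lt_of_le (mul_pos hΛ (T.sz_pos i)) (h1 i)
  have hC : 0 ≤ C := by
    have := (Real.rpow_pos_of_pos (ha T.root) s).trans_le h3'
    exact (pos_of_mul_pos_left this (T.sz_pos _).le).le
  have hB : 0 < B := (ha T.root).trans_le (h4 _)
  set C' := C * T.Λ + T.Λ * B ^ (s - 1) with hC'
  have hCC : C * T.Λ ≤ C' := le_add_of_nonneg_right (by positivity)
  have hCB : T.Λ * B ^ (s - 1) ≤ C' := le_add_of_nonneg_left (by positivity)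
  have hC'0 : 0 ≤ C' := by positivity
  have hcentre : ∀ N i, T.depth i = N →
      HasJohnCurve s C' T.domain (T.q T.root) (a i) (T.q i) := by
    intro N
    induction N with
    | zero =>
      intro i hi
      obtain rfl := T.eq_root i hi
      refine ⟨0, fun _ => T.q T.root, le_rfl, LipschitzWith.const' _, rfl, rfl, fun t ht => ?_⟩
      obtain rfl : t = 0 := le_antisymm ht.2 ht.1
      refine ⟨T.V_subset_domain _ (T.q_mem _), ?_⟩
      rw [add_zero]
      have := T.le_infDist_of_ball (T.ball_subset T.root)
      calc a T.root ^ s ≤ C * T.sz T.root := h3'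
        _ ≤ C * T.Λ * T.sz T.root := by
          refine mul_le_mul_of_nonneg_right ?_ (T.sz_pos T.root).le
          exact le_mul_of_one_le_right hC hΛ1
        _ ≤ _ := mul_le_mul hCC this (T.sz_pos _).le hC'0
    | succ N ih =>
      intro i hi
      have h0 : T.depth i ≠ 0 := by omega
      have hp := ih (T.parent i) (by have := T.depth_parent i h0; omega)
      have hsz := T.sz_pos i
      have hρ : 0 < T.sz i / T.Λ := by positivity
      have hg := T.gate_subset i h0
      have hgm := hg (Metric.mem_ball_self hρ)
      have e1 := T.dist_le i _ hgm.1
      have e2 := T.dist_le _ _ hgm.2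
      have e3 := h2 i h0
      have hle : a (T.parent i) ^ s ≤ C' * (T.sz i / T.Λ) := by
        calc a (T.parent i) ^ s ≤ C * T.sz i := h3 i h0
          _ = C * T.Λ * (T.sz i / T.Λ) := by field_simp
          _ ≤ _ := by gcongr
      have hle' : T.sz i / T.Λ ≤ T.sz (T.parent i) := by
        rw [div_le_iff₀ hΛ, mul_comm]; exact T.sz_le_parent i h0
      have k1 := T.hasJohnCurve_of_balls (a := a i + T.Λ * T.sz i) (b := a (T.parent i))
        (i := T.parent i) (x := T.g i) hs0 (by have := ha i; positivity) hC'0 hρ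
        (hg.trans inter_subset_right) ((Metric.ball_subset_ball hle').trans (T.ball_subset _))
        (by linarith) hle hp
      refine T.hasJohnCurve_of_balls (i := i) hs0 (ha i).le hC'0 hρ
        ((Metric.ball_subset_ball (div_le_self hsz.le hΛ1)).trans (T.ball_subset i))
        (hg.trans inter_subset_left) (by rw [dist_comm]; linarith) ?_ k1
      refine le_trans (Real.rpow_le_rpow (by have := ha i; positivity) ?_ hs0) hle
      have : 0 < T.Λ * T.sz (T.parent i) := mul_pos hΛ (T.sz_pos _)
      linarith
  have hall : ∀ x ∈ T.domain, HasJohnCurve s C' T.domain (T.q T.root) 0 x := by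
    intro x hx
    obtain ⟨i, hi⟩ := mem_iUnion.1 hx
    have hsz := T.sz_pos i
    have hd := T.dist_le i x hi
    refine (hcentre _ i rfl).cons hs0 le_rfl (by linarith [h1 i]) fun τ hτ => ?_
    have e : AffineMap.lineMap x (T.q i) τ = T.lift i x (τ * T.sz i) := by
      rw [lift, mul_div_cancel_right₀ _ hsz.ne', AffineMap.lineMap_apply_module']
      abel
    have hτ0 := hτ.1
    have hτs : τ * T.sz i ≤ T.sz i := mul_le_of_le_one_left hsz.le hτ.2
    rw [e]
    refine ⟨T.V_subset_domain i (T.lift_mem hi (by positivity) hτs), ?_⟩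
    have hinf := T.le_infDist_of_ball (T.ball_lift_subset hi (by positivity) hτs)
    have hτd : τ * dist x (T.q i) ≤ B := by
      have := mul_le_of_le_one_left (dist_nonneg (x := x) (y := T.q i)) hτ.2
      linarith [h1 i, h4 i]
    rw [zero_add]
    -- Inside the first box the distance to the frontier grows linearly with the length, which
    -- suffices because `s ≥ 1` and all lengths are at most `B`.
    calc (τ * dist x (T.q i)) ^ s
        = (τ * dist x (T.q i)) * (τ * dist x (T.q i)) ^ (s - 1) := by
          have := Real.rpow_add_one' (x := τ * dist x (T.q i)) (y := s - 1) (by positivity)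
            (by linarith)
          rw [sub_add_cancel] at this
          rw [this, mul_comm]
      _ ≤ (τ * (T.Λ * T.sz i)) * B ^ (s - 1) := by
          gcongr
      _ = T.Λ * B ^ (s - 1) * (τ * T.sz i) := by ring
      _ ≤ C' * Metric.infDist (T.lift i x (τ * T.sz i)) (frontier T.domain) := by gcongr
  have hcurve := fun x hx => (hall x hx).exists_curve hs0
  refine ⟨⟨T.isOpen_domain, ?_, hb⟩, T.V_subset_domain _ (T.q_mem _), C', hcurve⟩
  refine ⟨⟨_, T.V_subset_domain _ (T.q_mem T.root)⟩,
    isPreconnected_of_forall (T.q T.root) fun x hx => ?_⟩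
  obtain ⟨γ, hc, hm, h0, h1, -⟩ := hcurve x hx
  exact ⟨γ '' Icc 0 1, hm.image_subset, ⟨1, by simp, h1⟩, ⟨0, by simp, h0⟩,
    isPreconnected_Icc.image _ hc⟩

end BoxTree

/-! ### The pattern of chambers and corridors -/

/-- A subdivision of `[0, H]` into intervals of length comparable to `h k`, where `h` decreases
geometrically from `δ` to `δ / 2 ^ N` and increases again near the other end. -/
theorem exists_profile (N : ℕ) : ∀ (H δ : ℝ), 0 < δ → 4 * δ ≤ H →
    ∃ (K : ℕ) (y h : ℕ → ℝ), 0 < K ∧ y 0 = 0 ∧ y K = H ∧ h 0 = δ ∧ (∀ k, k + 1 = K → h k = δ) ∧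
      (∀ k < K, h k ≤ y (k + 1) - y k ∧ y (k + 1) - y k ≤ 2 * h k) ∧
      (∀ k, k + 1 < K → h (k + 1) ≤ 2 * h k ∧ h k ≤ 2 * h (k + 1)) ∧
      (∀ k < K, δ / 2 ^ N ≤ h k ∧ h k ≤ δ) ∧
      (∀ k < K, h k ≠ δ / 2 ^ N → y (k + 1) ≤ 2 * δ ∨ H - 2 * δ ≤ y k) := by
  induction N with
  | zero =>
    intro H δ hδ hH
    -- Without narrowing, `⌊H / δ⌋₊` equal intervals have length between `δ` and `2 * δ`.
    have hKpos : 0 < ⌊H / δ⌋₊ := Nat.floor_pos.2 ((one_le_div hδ).2 (by linarith))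
    set K := ⌊H / δ⌋₊ with hK
    have hKr : (0 : ℝ) < K := Nat.cast_pos.2 hKpos
    have h1 : K * δ ≤ H := (le_div_iff₀ hδ).1 (Nat.floor_le (div_nonneg (by linarith) hδ.le))
    have h2 : H < (K + 1) * δ := (div_lt_iff₀ hδ).1 (Nat.lt_floor_add_one _)
    have hone : (1 : ℝ) ≤ K := by exact_mod_cast hKpos
    refine ⟨K, fun k => k * (H / K), fun _ => δ, hKpos, by simp, ?_, rfl, fun _ _ => rfl, ?_, ?_,
      ?_, ?_⟩
    · field_simp
    · intro k _
      have e : ((k + 1 : ℕ) : ℝ) * (H / K) - k * (H / K) = H / K := by push_cast; ring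
      simp only [e]
      constructor
      · rw [le_div_iff₀ hKr]; linarith
      · rw [div_le_iff₀ hKr]; nlinarith
    · intro k _; constructor <;> linarith
    · intro k _; simp
    · intro k _ h; simp at h
  | succ N ih =>
    intro H δ hδ hH
    -- One interval of length `δ` is put at each end of the profile with data `H - 2 * δ` and `δ /
    -- 2`. The wide parts then occupy at most `2 * δ` at each end, by summing the geometric series.
    obtain ⟨K, y, h, hK, y0, yK, h0, hl, hlen, hadj, hb, hw⟩ :=
      ih (H - 2 * δ) (δ / 2) (by positivity) (by linarith)
    have epow : δ / 2 / 2 ^ N = δ / 2 ^ (N + 1) := by rw [pow_succ']; field_simp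
    rw [epow] at hb hw
    have hle1 : δ / 2 ^ (N + 1) ≤ δ := div_le_self hδ.le (one_le_pow₀ (by norm_num))
    refine ⟨K + 2, fun k => if k = 0 then 0 else if k ≤ K + 1 then δ + y (k - 1) else H,
      fun k => if k = 0 then δ else if k ≤ K then h (k - 1) else δ, by omega, by simp, by simp,
      by simp, ?_, ?_, ?_, ?_, ?_⟩
    · intro k hk
      have e1 : k ≠ 0 := by omega
      have e2 : ¬ k ≤ K := by omega
      simp [e1, e2]
    · intro k hk
      rcases k with _ | k
      · simp [y0]; linarith
      rcases lt_trichotomy k K with hlt | rfl | hgt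
      · have e1 : k + 1 ≤ K := hlt
        have e2 : k + 1 ≤ K + 1 := by omega
        have := hlen k hlt
        simp only [Nat.succ_ne_zero, if_false, e1, e2, if_true, Nat.add_sub_cancel,
          Nat.add_le_add_iff_right]
        constructor <;> linarith
      · have e2 : ¬ k + 1 ≤ k := by omega
        simp only [Nat.succ_ne_zero, if_false, e2, if_true, Nat.add_sub_cancel, le_refl,
          Nat.add_le_add_iff_right, yK]
        constructor <;> linarith
      · omega
    · intro k hk
      rcases k with _ | k
      · have e1 : 0 + 1 ≤ K := hK
        simp only [if_true, e1, zero_add, one_ne_zero, if_false, Nat.sub_self, h0]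
        constructor <;> linarith
      · have e1 : k + 1 ≤ K := by omega
        simp only [Nat.succ_ne_zero, if_false, e1, if_true, Nat.add_sub_cancel]
        by_cases e2 : k + 1 + 1 ≤ K
        · simp only [e2, if_true]
          exact hadj k e2
        · simp only [e2, if_false, hl k (by omega)]
          constructor <;> linarith
    · intro k hk
      rcases k with _ | k
      · simpa using hle1
      · by_cases e1 : k + 1 ≤ K
        · simp only [Nat.succ_ne_zero, if_false, e1, if_true, Nat.add_sub_cancel]
          have := hb k e1
          exact ⟨this.1, by linarith [this.2]⟩
        · simpa only [Nat.succ_ne_zero, if_false, e1] using ⟨hle1, le_rfl⟩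
    · intro k hk hne
      rcases k with _ | k
      · left
        simp [y0]; linarith
      · by_cases e1 : k + 1 ≤ K
        · have e2 : k + 1 ≤ K + 1 := by omega
          simp only [Nat.succ_ne_zero, if_false, e1, if_true, Nat.add_sub_cancel,
            Nat.add_le_add_iff_right, e2] at hne ⊢
          rcases hw k e1 hne with h | h
          · left; linarith
          · right; linarith
        · right
          obtain rfl : k = K := by omega
          simp [yK]
          linarith

/-- Words carry their newest letter first, so the ancestors of a word are its suffixes: two words
are comparable, or they branch by different letters after a common part `l`. -/
theorem List.isSuffix_trichotomy {α : Type*} (l₁ l₂ : List α) : l₁ <:+ l₂ ∨ l₂ <:+ l₁ ∨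
    ∃ l a b, a ≠ b ∧ a :: l <:+ l₁ ∧ b :: l <:+ l₂ := by
  classical
  induction l₁ with
  | nil => exact Or.inl (List.nil_suffix)
  | cons a l ih =>
    rcases ih with h | h | ⟨l', b, b', hb, h1, h2⟩
    · obtain ⟨t, rfl⟩ := h
      rcases List.eq_nil_or_concat t with rfl | ⟨t', b, rfl⟩
      · exact Or.inr (Or.inl (List.suffix_cons a l))
      · by_cases hab : a = b
        · subst hab
          exact Or.inl ⟨t', by simp⟩
        · exact Or.inr (Or.inr ⟨l, a, b, hab, List.suffix_rfl, ⟨t', by simp⟩⟩)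
    · exact Or.inr (Or.inl (h.trans (List.suffix_cons a l)))
    · exact Or.inr (Or.inr ⟨l', b, b', hb, h1.trans (List.suffix_cons a l), h2⟩)

/-- The data for the inductive construction of the domain: on top of the unit cube there are smaller
cubes of side `θ` with corners `τ u`, joined to the unit cube by corridors whose axis has the
coordinates `χ u`. The coordinate `V` is the vertical one. The corridors are subdivided; in
generation `l` they narrow down to the width `w l`. -/
structure Pattern (n : ℕ) (U : Type*) where
  V : Fin n
  F : Fin n
  F_ne : F ≠ V
  θ : ℝ
  δ : ℝ
  τ : U → Fin n → ℝ
  χ : U → Fin n → ℝ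
  K : U → ℕ → ℕ
  y : U → ℕ → ℕ → ℝ
  h : U → ℕ → ℕ → ℝ
  w : ℕ → ℝ
  θ_pos : 0 < θ
  θ_le : 8 * θ ≤ 1
  δ_pos : 0 < δ
  δ_le : 8 * δ ≤ θ
  le_τ_V : ∀ u, 5 / 4 ≤ τ u V
  τ_V_add_le : ∀ u, τ u V + 2 * θ ≤ 2
  τ_nonneg : ∀ u i, i ≠ V → 0 ≤ τ u i
  τ_add_le : ∀ u i, i ≠ V → τ u i + θ ≤ 1
  le_χ : ∀ u i, i ≠ V → τ u i + δ ≤ χ u i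
  χ_add_le : ∀ u i, i ≠ V → χ u i + δ ≤ τ u i + θ
  -- Either the two columns are apart in a horizontal direction, or one cube hangs above the other
  -- with a gap and its corridor descends beside the lower cube, a coordinate `i` witnessing that it
  -- passes clear of it.
  sep : ∀ u u', u ≠ u' → (∃ i, i ≠ V ∧ 2 * θ ≤ |τ u i - τ u' i|) ∨
    (τ u V + 3 * θ ≤ τ u' V ∧ ∃ i, i ≠ V ∧ τ u i + θ + 2 * δ ≤ χ u' i) ∨
    (τ u' V + 3 * θ ≤ τ u V ∧ ∃ i, i ≠ V ∧ τ u' i + θ + 2 * δ ≤ χ u i)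
  K_pos : ∀ u l, 0 < K u l
  y_zero : ∀ u l, y u l 0 = 0
  y_K : ∀ u l, y u l (K u l) = τ u V - 1
  h_zero : ∀ u l, h u l 0 = δ
  h_last : ∀ u l k, k + 1 = K u l → h u l k = δ
  h_le : ∀ u l k, k < K u l → h u l k ≤ y u l (k + 1) - y u l k
  le_two_h : ∀ u l k, k < K u l → y u l (k + 1) - y u l k ≤ 2 * h u l k
  h_succ_le : ∀ u l k, k + 1 < K u l → h u l (k + 1) ≤ 2 * h u l k
  h_le_succ : ∀ u l k, k + 1 < K u l → h u l k ≤ 2 * h u l (k + 1)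
  w_pos : ∀ l, 0 < w l
  w_le_h : ∀ u l k, k < K u l → w l ≤ h u l k
  h_le_δ : ∀ u l k, k < K u l → h u l k ≤ δ
  h_eq_w : ∀ u l k, k < K u l → h u l k ≠ w l → y u l (k + 1) ≤ 2 * δ ∨
    τ u V - 1 - 2 * δ ≤ y u l k

namespace Pattern

variable {n : ℕ} {U : Type*} (P : Pattern n U)

/-- The nodes of the tree: chambers, indexed by words, and pieces of the corridor that joins the
chamber of the word `u :: v` to the chamber of `v`, the pieces being numbered from above. -/
inductive Node : Type _
  | chamber (v : List U) : Node
  | corridor (v : List U) (u : U) (k : ℕ) (hk : k < P.K u v.length) : Node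

variable {P}

/-- The word of a node. -/
def Node.word : P.Node → List U
  | .chamber v => v
  | .corridor v u _ _ => u :: v

variable (P)

/-- The scale of the word `v`. -/
def r (v : List U) : ℝ := P.θ ^ v.length

/-- The lower corner of the chamber of a word. -/
def corner : List U → Fin n → ℝ
  | [] => 0
  | u :: v => fun i => corner v i + P.r v * P.τ u i

/-- The depth of a chamber. -/
def chamberDepth : List U → ℕ
  | [] => 0
  | u :: v => chamberDepth v + P.K u v.length + 1

/-- The parent of a node. -/
def parent : P.Node → P.Node
  | .chamber [] => .chamber []
  | .chamber (u :: v) => .corridor v u 0 (P.K_pos u v.length)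
  | .corridor v u k _ => if h : k + 1 < P.K u v.length then .corridor v u (k + 1) h else .chamber v

/-- The depth of a node. -/
def depth : P.Node → ℕ
  | .chamber v => P.chamberDepth v
  | .corridor v u k _ => P.chamberDepth (u :: v) - (k + 1)

open Classical in
/-- The lower corner of the box of a node. -/
noncomputable def lo : P.Node → Fin n → ℝ
  | .chamber v => P.corner v
  | .corridor v u k _ => fun i =>
      if i = P.V then P.corner (u :: v) i - P.r v * (P.y u v.length (k + 1) + P.h u v.length k / 8)
      else P.corner v i + P.r v * (P.χ u i - P.h u v.length k)

open Classical in
/-- The upper corner of the box of a node. -/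
noncomputable def hi : P.Node → Fin n → ℝ
  | .chamber v => fun i => P.corner v i + P.r v
  | .corridor v u k _ => fun i =>
      if i = P.V then P.corner (u :: v) i - P.r v * (P.y u v.length k - P.h u v.length k / 8)
      else P.corner v i + P.r v * (P.χ u i + P.h u v.length k)

/-- Half the size of the box of a node. -/
noncomputable def sz : P.Node → ℝ
  | .chamber v => P.r v / 2
  | .corridor v u k _ => P.r v * P.h u v.length k / 2

/-- The box of a node. -/
def box (i : P.Node) : Set (EuclideanSpace ℝ (Fin n)) := openBox (P.lo i) (P.hi i)

variable {P}

theorem θ_lt_one : P.θ < 1 := by have := P.θ_le; linarith [P.θ_pos]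

theorem r_pos (v : List U) : 0 < P.r v := pow_pos P.θ_pos _

theorem r_cons (u : U) (v : List U) : P.r (u :: v) = P.θ * P.r v := by
  simp only [r, List.length_cons]; ring

theorem r_le_of_suffix {v w : List U} (h : v <:+ w) : P.r w ≤ P.r v :=
  pow_le_pow_of_le_one P.θ_pos.le P.θ_lt_one.le h.length_le

theorem r_le_one (v : List U) : P.r v ≤ 1 := pow_le_one₀ P.θ_pos.le P.θ_lt_one.le

theorem corner_cons (u : U) (v : List U) (i : Fin n) :
    P.corner (u :: v) i = P.corner v i + P.r v * P.τ u i := rfl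

theorem h_pos {u : U} {l k : ℕ} (hk : k < P.K u l) : 0 < P.h u l k :=
  (P.w_pos l).trans_le (P.w_le_h u l k hk)

theorem y_le_y (u : U) (l : ℕ) {k k' : ℕ} (h : k ≤ k') (hk' : k' ≤ P.K u l) :
    P.y u l k ≤ P.y u l k' := by
  induction k', h using Nat.le_induction with
  | base => exact le_rfl
  | succ m hm ih =>
    have := P.h_le u l m hk'
    have := P.h_pos hk'
    linarith [ih (by omega)]

theorem y_nonneg (u : U) {l k : ℕ} (hk : k ≤ P.K u l) : 0 ≤ P.y u l k := by
  have := P.y_le_y u l (Nat.zero_le k) hk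
  rwa [P.y_zero] at this

theorem y_le (u : U) {l k : ℕ} (hk : k ≤ P.K u l) : P.y u l k ≤ P.τ u P.V - 1 := by
  have := P.y_le_y u l hk le_rfl
  rwa [P.y_K] at this

theorem sz_pos (i : P.Node) : 0 < P.sz i := by
  rcases i with v | ⟨v, u, k, hk⟩
  · have := P.r_pos v
    simp only [sz]; positivity
  · have := P.r_pos v
    have := P.h_pos hk
    simp only [sz]; positivity

theorem mem_box_chamber {v : List U} {x : EuclideanSpace ℝ (Fin n)} :
    x ∈ P.box (.chamber v) ↔ ∀ i, P.corner v i < x i ∧ x i < P.corner v i + P.r v := Iff.rfl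

theorem mem_box_corridor {v : List U} {u : U} {k : ℕ} {hk : k < P.K u v.length}
    {x : EuclideanSpace ℝ (Fin n)} :
    x ∈ P.box (.corridor v u k hk) ↔
      (∀ i, i ≠ P.V → P.corner v i + P.r v * (P.χ u i - P.h u v.length k) < x i ∧
        x i < P.corner v i + P.r v * (P.χ u i + P.h u v.length k)) ∧
      P.corner (u :: v) P.V - P.r v * (P.y u v.length (k + 1) + P.h u v.length k / 8) < x P.V ∧
      x P.V < P.corner (u :: v) P.V - P.r v * (P.y u v.length k - P.h u v.length k / 8) := by
  constructor
  · intro h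
    refine ⟨fun i hi => ?_, ?_⟩
    · simpa [lo, Pattern.hi, hi] using h i
    · simpa [lo, Pattern.hi] using h P.V
  · rintro ⟨h1, h2⟩ i
    by_cases hi : i = P.V
    · subst hi
      simpa [lo, Pattern.hi] using h2
    · have := h1 i hi
      simpa [lo, Pattern.hi, hi] using this

/-! #### Zones -/

variable (P)

/-- The zone of a word: the cube of the chamber, doubled in the vertical direction. -/
def zone (v : List U) : Set (EuclideanSpace ℝ (Fin n)) :=
  {x | (∀ i, i ≠ P.V → P.corner v i < x i ∧ x i < P.corner v i + P.r v) ∧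
    P.corner v P.V < x P.V ∧ x P.V < P.corner v P.V + 2 * P.r v}

/-- The branch of the word `u :: v`, consisting of a corridor and a zone. -/
def branch (v : List U) (u : U) : Set (EuclideanSpace ℝ (Fin n)) :=
  {x | (∀ i, i ≠ P.V → P.corner (u :: v) i < x i ∧ x i < P.corner (u :: v) i + P.θ * P.r v) ∧
    P.corner v P.V + P.r v * (1 - P.δ) < x P.V ∧
    ((P.corner (u :: v) P.V < x P.V ∧ x P.V < P.corner (u :: v) P.V + 2 * (P.θ * P.r v)) ∨
      ((∀ i, i ≠ P.V → P.corner v i + P.r v * (P.χ u i - P.δ) < x i ∧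
        x i < P.corner v i + P.r v * (P.χ u i + P.δ)) ∧
        x P.V < P.corner (u :: v) P.V + P.r v * P.δ))}

variable {P}

theorem box_chamber_subset (v : List U) : P.box (.chamber v) ⊆ P.zone v := by
  intro x hx
  rw [mem_box_chamber] at hx
  exact ⟨fun i _ => hx i, (hx P.V).1, by linarith [(hx P.V).2, P.r_pos v]⟩

theorem zone_cons_subset_branch (v : List U) (u : U) : P.zone (u :: v) ⊆ P.branch v u := by
  rintro x ⟨h1, h2, h3⟩
  rw [r_cons] at h1 h3
  refine ⟨h1, ?_, Or.inl ⟨h2, h3⟩⟩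
  rw [corner_cons] at h2
  have := P.le_τ_V u
  have := P.δ_pos
  nlinarith [P.r_pos v]

theorem box_corridor_subset (v : List U) (u : U) {k : ℕ} (hk : k < P.K u v.length) :
    P.box (.corridor v u k hk) ⊆ P.branch v u := by
  intro x hx
  obtain ⟨h1, h2, h3⟩ := mem_box_corridor.1 hx
  have hr := P.r_pos v
  have hδ := P.h_le_δ u _ k hk
  have hh := P.h_pos hk
  have hy := P.y_nonneg u hk.le
  have hy' := P.y_le u (Nat.succ_le_of_lt hk)
  have key : ∀ i, i ≠ P.V → P.corner v i + P.r v * (P.χ u i - P.δ) < x i ∧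
        x i < P.corner v i + P.r v * (P.χ u i + P.δ) := by
    intro i hi
    have := h1 i hi
    constructor <;> nlinarith
  refine ⟨fun i hi => ?_, ?_, Or.inr ⟨key, ?_⟩⟩
  · have e1 := key i hi
    have e2 := P.le_χ u i hi
    have e3 := P.χ_add_le u i hi
    rw [corner_cons]
    constructor <;> nlinarith
  · rw [corner_cons] at h2
    have : P.r v * (P.y u v.length (k + 1) + P.h u v.length k / 8) ≤
      P.r v * (P.τ u P.V - 1 + P.δ) := by gcongr; linarith
    nlinarith
  · have : P.r v * (P.h u v.length k / 8 - P.y u v.length k) ≤ P.r v * P.δ := by gcongr; linarith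
    linarith

theorem branch_subset_zone (v : List U) (u : U) : P.branch v u ⊆ P.zone v := by
  rintro x ⟨h1, h2, h3⟩
  have hr := P.r_pos v
  have hδ := P.δ_le
  have hδ0 := P.δ_pos
  have hθ := P.θ_le
  have hθ0 := P.θ_pos
  refine ⟨fun i hi => ?_, by nlinarith, ?_⟩
  · have e1 := h1 i hi
    rw [corner_cons] at e1
    have e2 := P.τ_nonneg u i hi
    have e3 := P.τ_add_le u i hi
    have := mul_nonneg hr.le e2
    constructor <;> nlinarith
  · have e := P.τ_V_add_le u
    rw [corner_cons] at h3
    rcases h3 with h3 | h3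
    · nlinarith [h3.2]
    · nlinarith [h3.2]

/-- Zones and branches nest alternately, `zone (u :: v) ⊆ branch v u ⊆ zone v`. This localizes
everything built above a chamber, so that separation is only checked between sibling branches. -/
theorem zone_subset_of_suffix {v w : List U} (h : v <:+ w) : P.zone w ⊆ P.zone v := by
  obtain ⟨t, rfl⟩ := h
  induction t with
  | nil => exact Subset.rfl
  | cons u t ih =>
    exact ((zone_cons_subset_branch _ _).trans (branch_subset_zone _ _)).trans ih

theorem box_subset_branch {v : List U} {u : U} {i : P.Node} (h : u :: v <:+ i.word) :
    P.box i ⊆ P.branch v u := by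
  rcases i with v' | ⟨v', u', k, hk⟩
  · exact (box_chamber_subset v').trans ((zone_subset_of_suffix h).trans
      (zone_cons_subset_branch v u))
  · rcases List.suffix_cons_iff.1 h with h | h
    · simp only [List.cons.injEq] at h
      obtain ⟨rfl, rfl⟩ := h
      exact box_corridor_subset _ _ hk
    · exact (box_corridor_subset _ _ hk).trans ((branch_subset_zone _ _).trans
        ((zone_subset_of_suffix h).trans (zone_cons_subset_branch v u)))

theorem box_subset_zone_nil (i : P.Node) : P.box i ⊆ P.zone [] := by
  rcases i with v | ⟨v, u, k, hk⟩
  · exact (box_chamber_subset v).trans (zone_subset_of_suffix List.nil_suffix)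
  · exact (box_corridor_subset _ _ hk).trans ((branch_subset_zone _ _).trans
      (zone_subset_of_suffix List.nil_suffix))

theorem sz_le_of_suffix {v : List U} {u : U} {i : P.Node} (h : u :: v <:+ i.word) :
    P.sz i ≤ P.r v := by
  rcases i with v' | ⟨v', u', k, hk⟩
  · have := P.r_le_of_suffix ((List.suffix_cons u v).trans h)
    simp only [Node.word] at this
    simp only [sz]
    linarith [P.r_pos v']
  · have hv : v <:+ v' := by
      rcases List.suffix_cons_iff.1 h with h | h
      · simp only [List.cons.injEq] at h
        exact h.2 ▸ List.suffix_rfl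
      · exact (List.suffix_cons u v).trans h
    have h1 := P.r_le_of_suffix hv
    have h2 := P.h_le_δ u' _ k hk
    have h3 := P.h_pos hk
    have h4 := P.r_pos v'
    have h5 := P.δ_le
    have h6 := P.θ_le
    simp only [sz]
    have : P.r v' * P.h u' v'.length k ≤ P.r v' * 1 := by gcongr; linarith
    linarith

/-- The branches of different letters are separated. -/
theorem le_dist_of_branch {v : List U} {u u' : U} (huu : u ≠ u') {x y : EuclideanSpace ℝ (Fin n)}
    (hx : x ∈ P.branch v u) (hy : y ∈ P.branch v u') : P.r v * P.δ ≤ dist x y := by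
  have hr := P.r_pos v
  have hδ := P.δ_le
  have hδ0 := P.δ_pos
  have hθ0 := P.θ_pos
  -- This is the stacked case, the branch of `u` being the lower one. A point of the zone of `u'` is
  -- higher than the whole branch of `u`; a point of the corridor of `u'` is beyond it in the
  -- direction `i`.
  have main : ∀ (u u' : U) (x y : EuclideanSpace ℝ (Fin n)), x ∈ P.branch v u → y ∈ P.branch v u' →
      (P.τ u P.V + 3 * P.θ ≤ P.τ u' P.V ∧ ∃ i, i ≠ P.V ∧ P.τ u i + P.θ + 2 * P.δ ≤ P.χ u' i) →
      P.r v * P.δ ≤ dist x y := by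
    rintro u u' x y ⟨hx1, hx2, hx3⟩ ⟨hy1, hy2, hy3⟩ ⟨hV, i, hi, hF⟩
    rcases hy3 with hy3 | hy3
    · refine le_trans ?_ (abs_coord_sub_le_dist x y P.V)
      rw [abs_sub_comm]
      refine le_trans ?_ (le_abs_self _)
      have e1 := hy3.1
      have e2 : x P.V < P.corner (u :: v) P.V + 2 * (P.θ * P.r v) := by
        rcases hx3 with h | h
        · exact h.2
        · nlinarith [h.2]
      rw [corner_cons] at e1 e2
      nlinarith
    · refine le_trans ?_ (abs_coord_sub_le_dist x y i)
      rw [abs_sub_comm]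
      refine le_trans ?_ (le_abs_self _)
      have e1 := (hy3.1 i hi).1
      have e2 := (hx1 i hi).2
      rw [corner_cons] at e2
      nlinarith
  rcases P.sep u u' huu with ⟨i, hi, h⟩ | h | h
  · refine le_trans ?_ (abs_coord_sub_le_dist x y i)
    have e1 := hx.1 i hi
    have e2 := hy.1 i hi
    rw [corner_cons] at e1 e2
    have e3 : P.r v * P.δ ≤ P.θ * P.r v := by nlinarith
    rcases le_abs.1 h with h | h
    · refine le_trans ?_ (le_abs_self _)
      nlinarith
    · refine le_trans ?_ (neg_le_abs _)
      nlinarith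
  · exact main u u' x y hx hy h
  · rw [dist_comm]
    exact main u' u y x hy hx h

end Pattern

namespace Pattern

variable {n : ℕ} {U : Type*} {P : Pattern n U}

/-! #### Separation of the boxes -/

variable (P) in
/-- The boxes of the nodes `i` and `j` are separated. -/
def Far (i j : P.Node) : Prop :=
  ∀ x ∈ P.box i, ∀ y ∈ P.box j, P.δ * max (P.sz i) (P.sz j) ≤ dist x y

theorem Far.symm {i j : P.Node} (h : P.Far i j) : P.Far j i := fun x hx y hy => by
  rw [max_comm, dist_comm]; exact h y hy x hx

theorem δ_le_one : P.δ ≤ 1 := by linarith [P.δ_le, P.θ_le, P.δ_pos]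

theorem far_of_coord {i j : P.Node} {a : ℝ} (hi : P.sz i ≤ a) (hj : P.sz j ≤ a)
    (h : ∀ x ∈ P.box i, ∀ y ∈ P.box j, P.δ * a ≤ |x P.V - y P.V|) : P.Far i j :=
  fun x hx y hy => (mul_le_mul_of_nonneg_left (max_le hi hj) P.δ_pos.le).trans
    ((h x hx y hy).trans (abs_coord_sub_le_dist x y P.V))

theorem far_of_ne {v : List U} {u u' : U} {i j : P.Node} (huu : u ≠ u')
    (hi : u :: v <:+ i.word) (hj : u' :: v <:+ j.word) : P.Far i j := by
  intro x hx y hy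
  refine le_trans ?_ (le_dist_of_branch huu (box_subset_branch hi hx) (box_subset_branch hj hy))
  rw [mul_comm]
  gcongr
  · exact P.δ_pos.le
  · exact max_le (sz_le_of_suffix hi) (sz_le_of_suffix hj)

theorem depth_corridor_ne_zero (v : List U) (u : U) {k : ℕ} (hk : k < P.K u v.length) :
    P.depth (.corridor v u k hk) ≠ 0 := by
  simp only [depth, chamberDepth]; omega

theorem parent_corridor_of_lt {v : List U} {u : U} {k : ℕ} (hk : k < P.K u v.length)
    (h : k + 1 < P.K u v.length) : P.parent (.corridor v u k hk) = .corridor v u (k + 1) h := by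
  simp [parent, h]

theorem parent_corridor_of_not_lt {v : List U} {u : U} {k : ℕ} (hk : k < P.K u v.length)
    (h : ¬ k + 1 < P.K u v.length) : P.parent (.corridor v u k hk) = .chamber v := by
  simp [parent, h]

theorem sz_corridor_le {v : List U} {u : U} {k : ℕ} (hk : k < P.K u v.length) :
    P.sz (.corridor v u k hk) ≤ P.r v :=
  P.sz_le_of_suffix (i := .corridor v u k hk) List.suffix_rfl

theorem sz_corridor_le_half {v : List U} {u : U} {k : ℕ} (hk : k < P.K u v.length) :
    P.sz (.corridor v u k hk) ≤ P.r v / 2 := by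
  have := P.h_le_δ u _ k hk
  simp only [sz]
  nlinarith [P.δ_le_one, P.r_pos v]

theorem far_chamber_corridor {v : List U} {u : U} {k : ℕ} (hk : k < P.K u v.length)
    (h : k + 1 < P.K u v.length) : P.Far (.chamber v) (.corridor v u k hk) := by
  have hr := P.r_pos v
  have hδ := P.δ_pos
  refine far_of_coord (a := P.r v / 2) (by simp only [sz]; linarith) (sz_corridor_le_half hk) ?_
  intro x hx y hy
  have e1 := (mem_box_chamber.1 hx P.V).2
  have e2 := (mem_box_corridor.1 hy).2.1
  rw [abs_sub_comm]
  refine le_trans ?_ (le_abs_self _)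
  have e3 : P.y u v.length (k + 1) ≤ P.τ u P.V - 1 - P.δ := by
    obtain ⟨m, hm⟩ : ∃ m, m + 1 = P.K u v.length := ⟨P.K u v.length - 1, by omega⟩
    have f1 := P.h_le u v.length m (by omega)
    rw [P.h_last u v.length m hm, hm, P.y_K] at f1
    have f2 := P.y_le_y u v.length (show k + 1 ≤ m by omega) (by omega)
    linarith
  have e5 := P.h_le_δ u v.length k hk
  have e6 : P.r v * (P.y u v.length (k + 1) + P.h u v.length k / 8) ≤
      P.r v * (P.τ u P.V - 1 - P.δ / 2) := by gcongr; linarith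
  rw [corner_cons] at e2
  linarith

theorem far_chamber_zone {v : List U} {u : U} {j : P.Node} (hj : P.box j ⊆ P.zone (u :: v))
    (hs : P.sz j ≤ P.r v) : P.Far (.chamber v) j := by
  have hr := P.r_pos v
  refine far_of_coord (a := P.r v) (by simp only [sz]; linarith) hs fun x hx y hy => ?_
  have e1 := (mem_box_chamber.1 hx P.V).2
  have e2 := (hj hy).2.1
  rw [corner_cons] at e2
  rw [abs_sub_comm]
  refine le_trans ?_ (le_abs_self _)
  have := P.le_τ_V u
  have := P.δ_le
  have := P.θ_le
  nlinarith

theorem far_corridor_branch {v : List U} {u u' : U} {k : ℕ} (hk : k < P.K u v.length) {j : P.Node}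
    (hj : u' :: u :: v <:+ j.word) : P.Far (.corridor v u k hk) j := by
  have hr := P.r_pos v
  have hs := P.sz_le_of_suffix hj
  have hδ := P.δ_pos
  have hδθ := P.δ_le
  have hθ := P.θ_le
  rw [r_cons] at hs
  refine far_of_coord (a := P.r v) (sz_corridor_le hk) (by nlinarith) fun x hx y hy => ?_
  have e1 := (mem_box_corridor.1 hx).2.2
  have e2 := (box_subset_branch hj hy).2.1
  rw [r_cons] at e2
  rw [abs_sub_comm]
  refine le_trans ?_ (le_abs_self _)
  have h1 := P.y_nonneg u hk.le
  have h2 := P.h_le_δ u _ k hk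
  have h3 : P.r v * (P.h u v.length k / 8 - P.y u v.length k) ≤ P.r v * P.δ := by
    gcongr; linarith [P.h_pos hk]
  have h4 : P.θ * P.δ ≤ P.θ * (1 / 2) := mul_le_mul_of_nonneg_left (by linarith) P.θ_pos.le
  have h5 : P.r v * (3 * P.δ) ≤ P.r v * (P.θ * (1 - P.δ)) :=
    mul_le_mul_of_nonneg_left (by linarith) hr.le
  nlinarith

theorem far_of_strict {i j : P.Node} {u : U} (h : u :: i.word <:+ j.word)
    (hj : ¬ (P.depth j ≠ 0 ∧ P.parent j = i)) : P.Far i j := by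
  rcases i with v | ⟨v, u', k, hk⟩
  · simp only [Node.word] at h
    have hs := P.sz_le_of_suffix h
    rcases j with v' | ⟨v', u', k, hk⟩
    · exact far_chamber_zone ((box_chamber_subset v').trans (zone_subset_of_suffix h)) hs
    · rcases List.suffix_cons_iff.1 h with h | h
      · simp only [List.cons.injEq] at h
        obtain ⟨rfl, rfl⟩ := h
        by_cases hlt : k + 1 < P.K u v.length
        · exact far_chamber_corridor hk hlt
        · exact absurd ⟨depth_corridor_ne_zero _ _ hk, parent_corridor_of_not_lt hk hlt⟩ hj
      · exact far_chamber_zone ((box_corridor_subset _ _ hk).trans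
          ((branch_subset_zone _ _).trans (zone_subset_of_suffix h))) hs
  · exact far_corridor_branch hk h

/-- At least one full piece lies between the two. Neighbouring pieces differ in length scale by a
factor of at most 2, so this piece outweighs the overhangs of an eighth at each end. -/
theorem far_corridor_corridor {v : List U} {u : U} {k k' : ℕ} (hk : k < P.K u v.length)
    (hk' : k' < P.K u v.length) (h : k + 2 ≤ k') :
    P.Far (.corridor v u k hk) (.corridor v u k' hk') := by
  intro x hx y hy
  refine le_trans ?_ (abs_coord_sub_le_dist x y P.V)
  have e1 := (mem_box_corridor.1 hx).2.1
  have e2 := (mem_box_corridor.1 hy).2.2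
  refine le_trans ?_ (le_abs_self _)
  have hr := P.r_pos v
  obtain ⟨m, rfl⟩ : ∃ m, k' = m + 1 := ⟨k' - 1, by omega⟩
  have f1 := P.h_le u v.length m (by omega)
  have f2 := P.h_le_succ u v.length k (by omega)
  have f3 := P.h_succ_le u v.length m (by omega)
  have f4 := P.h_le u v.length (k + 1) (by omega)
  have f5 := P.y_le_y u v.length (show k + 1 ≤ m by omega) (by omega)
  have f6 := P.y_le_y u v.length (show k + 2 ≤ m + 1 by omega) (by omega)
  have hδ : P.δ ≤ 1 / 2 := by linarith [P.δ_le, P.θ_le, P.δ_pos]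
  have key : max (P.h u v.length k) (P.h u v.length (m + 1)) / 4 ≤
      P.y u v.length (m + 1) - P.y u v.length (k + 1) - P.h u v.length k / 8 -
        P.h u v.length (m + 1) / 8 := by
    rcases max_cases (P.h u v.length k) (P.h u v.length (m + 1)) with h | h <;> rw [h.1] <;>
      linarith
  have key' : P.r v * (max (P.h u v.length k) (P.h u v.length (m + 1)) / 4) ≤ P.r v *
      (P.y u v.length (m + 1) - P.y u v.length (k + 1) - P.h u v.length k / 8 -
        P.h u v.length (m + 1) / 8) := by gcongr
  have e : max (P.sz (.corridor v u k hk)) (P.sz (.corridor v u (m + 1) hk')) =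
      P.r v * max (P.h u v.length k) (P.h u v.length (m + 1)) / 2 := by
    simp only [sz]
    rw [mul_max_of_nonneg _ _ hr.le, max_div_div_right (by norm_num)]
  rw [e]
  have hmax : 0 ≤ P.r v * max (P.h u v.length k) (P.h u v.length (m + 1)) / 2 := by
    have := (P.h_pos hk).le.trans (le_max_left _ (P.h u v.length (m + 1)))
    positivity
  have := mul_le_mul_of_nonneg_right hδ hmax
  linarith

theorem far_chamber_cons_corridor {v : List U} {u : U} {k : ℕ} (hk : k < P.K u v.length)
    (h : k ≠ 0) : P.Far (.chamber (u :: v)) (.corridor v u k hk) := by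
  have hr := P.r_pos v
  have hδ := P.δ_pos
  have hθ := P.θ_le
  refine far_of_coord (a := P.r v / 2) (by simp only [sz, r_cons]; nlinarith)
    (sz_corridor_le_half hk) ?_
  intro x hx y hy
  have e1 := (mem_box_chamber.1 hx P.V).1
  have e2 := (mem_box_corridor.1 hy).2.2
  refine le_trans ?_ (le_abs_self _)
  have e3 := P.h_le u v.length 0 (by omega)
  have e4 := P.y_le_y u v.length (show 1 ≤ k by omega) (by omega)
  rw [P.h_zero, P.y_zero, zero_add] at e3
  have e5 := P.h_le_δ u _ k hk
  have : P.r v * (P.δ / 2) ≤ P.r v * (P.y u v.length k - P.h u v.length k / 8) := by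
    gcongr; linarith
  nlinarith

/-- Words that branch put the boxes into sibling branches. For nested distinct words, the only
contact is the mouth of a corridor in the chamber below it. For equal words the boxes belong to one
corridor with the chamber on top, and the numbering of the pieces decides. -/
theorem far_of_not_adj {i j : P.Node} (hij : i ≠ j) (h1 : ¬ (P.depth i ≠ 0 ∧ P.parent i = j))
    (h2 : ¬ (P.depth j ≠ 0 ∧ P.parent j = i)) : P.Far i j := by
  have strict : ∀ i j : P.Node, ¬ (P.depth j ≠ 0 ∧ P.parent j = i) → i.word <:+ j.word →
      i.word ≠ j.word → P.Far i j := by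
    intro i j h hs hne
    obtain ⟨t, ht⟩ := hs
    rcases List.eq_nil_or_concat t with rfl | ⟨t', b, rfl⟩
    · exact absurd ht hne
    · exact far_of_strict (u := b) ⟨t', by rw [← ht]; simp⟩ h
  by_cases hw : i.word = j.word
  · have mixed : ∀ (w v : List U) (u : U) (k : ℕ) (hk : k < P.K u v.length), w = u :: v →
        ¬ (P.depth (.chamber w) ≠ 0 ∧ P.parent (.chamber w) = .corridor v u k hk) →
        P.Far (.chamber w) (.corridor v u k hk) := by
      rintro _ v u k hk rfl h
      refine far_chamber_cons_corridor hk fun h0 => h ⟨by simp [depth, chamberDepth], ?_⟩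
      subst h0
      rfl
    rcases i with w | ⟨v, u, k, hk⟩ <;> rcases j with w' | ⟨v', u', k', hk'⟩ <;>
      simp only [Node.word] at hw
    · exact absurd (by rw [hw]) hij
    · exact mixed _ _ _ _ _ hw h1
    · exact (mixed _ _ _ _ _ hw.symm h2).symm
    · simp only [List.cons.injEq] at hw
      obtain ⟨rfl, rfl⟩ := hw
      have succ : ∀ k k' (hk : k < P.K u v.length) (hk' : k' < P.K u v.length), k < k' →
          ¬ (P.depth (.corridor v u k hk) ≠ 0 ∧
            P.parent (.corridor v u k hk) = .corridor v u k' hk') →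
          P.Far (.corridor v u k hk) (.corridor v u k' hk') := by
        intro k k' hk hk' hlt h
        refine far_corridor_corridor hk hk' ?_
        by_contra hcon
        obtain rfl : k' = k + 1 := by omega
        exact h ⟨depth_corridor_ne_zero _ _ _, parent_corridor_of_lt _ hk'⟩
      rcases lt_trichotomy k k' with hlt | rfl | hlt
      · exact succ _ _ _ _ hlt h1
      · exact absurd rfl hij
      · exact (succ _ _ _ _ hlt h2).symm
  · rcases List.isSuffix_trichotomy i.word j.word with h | h | ⟨v, u, u', huu, hi, hj⟩
    · exact strict i j h2 h hw
    · exact (strict j i h1 h (Ne.symm hw)).symm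
    · exact far_of_ne huu hi hj

/-! #### Size and position of the boxes -/

theorem ball_subset_openBox {lo hi : Fin n → ℝ} {q : EuclideanSpace ℝ (Fin n)} {ρ : ℝ}
    (h1 : ∀ k, lo k ≤ q k - ρ) (h2 : ∀ k, q k + ρ ≤ hi k) : Metric.ball q ρ ⊆ openBox lo hi := by
  intro x hx k
  have := (abs_coord_sub_le_dist x q k).trans_lt hx
  rw [abs_lt] at this
  exact ⟨by linarith [h1 k], by linarith [h2 k]⟩

theorem dist_le_of_coord_le {x y : EuclideanSpace ℝ (Fin n)} {b : ℝ}
    (h : ∀ k, |x k - y k| ≤ b) : dist x y ≤ n * b := by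
  classical
  have e : x - y = ∑ k, EuclideanSpace.single k (x k - y k) := by
    ext i
    simp [Finset.sum_apply, Pi.single_apply]
  rw [dist_eq_norm, e]
  refine (norm_sum_le _ _).trans ?_
  calc ∑ k, ‖EuclideanSpace.single k (x k - y k)‖ ≤ ∑ _k : Fin n, b := by
        refine Finset.sum_le_sum fun k _ => ?_
        rw [PiLp.norm_single, Real.norm_eq_abs]
        exact h k
    _ = n * b := by simp

variable (P) in
/-- The centre of the box of a node. -/
noncomputable def centre (i : P.Node) : EuclideanSpace ℝ (Fin n) :=
  WithLp.toLp 2 fun k => (P.lo i k + P.hi i k) / 2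

theorem centre_apply (i : P.Node) (k : Fin n) : P.centre i k = (P.lo i k + P.hi i k) / 2 := rfl

theorem side_bounds (i : P.Node) (k : Fin n) :
    2 * P.sz i ≤ P.hi i k - P.lo i k ∧ P.hi i k - P.lo i k ≤ 9 / 2 * P.sz i := by
  rcases i with v | ⟨v, u, m, hm⟩
  · have := P.r_pos v
    simp only [lo, hi, sz]
    constructor <;> linarith
  · have hr := P.r_pos v
    have hh := P.h_pos hm
    have := mul_pos hr hh
    by_cases hk : k = P.V
    · subst hk
      have h1 := mul_le_mul_of_nonneg_left (P.h_le u _ m hm) hr.le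
      have h2 := mul_le_mul_of_nonneg_left (P.le_two_h u _ m hm) hr.le
      simp only [lo, Pattern.hi, sz, if_true]
      constructor <;> nlinarith
    · simp only [lo, Pattern.hi, sz, hk, if_false]
      constructor <;> nlinarith

theorem ball_centre_subset (i : P.Node) : Metric.ball (P.centre i) (P.sz i) ⊆ P.box i :=
  ball_subset_openBox (fun k => by rw [centre_apply]; linarith [P.side_bounds i k])
    (fun k => by rw [centre_apply]; linarith [P.side_bounds i k])

theorem dist_centre_le (i : P.Node) {x : EuclideanSpace ℝ (Fin n)} (hx : x ∈ P.box i) :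
    dist x (P.centre i) ≤ n * (9 / 4 * P.sz i) :=
  dist_le_of_coord_le fun k => by
    have h1 := hx k
    have h2 := P.side_bounds i k
    rw [centre_apply, abs_le]
    constructor <;> linarith [h1.1, h1.2]

open Classical in
variable (P) in
/-- A point in the middle of a vertical face of the box of a node. -/
noncomputable def facePoint (i : P.Node) : EuclideanSpace ℝ (Fin n) :=
  WithLp.toLp 2 fun k => if k = P.F then P.hi i k else (P.lo i k + P.hi i k) / 2

theorem dist_facePoint_le (i : P.Node) : dist (P.facePoint i) (P.centre i) ≤
    n * (9 / 4 * P.sz i) :=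
  dist_le_of_coord_le fun k => by
    have h2 := P.side_bounds i k
    have h3 := P.sz_pos i
    rw [centre_apply]
    by_cases hk : k = P.F
    · simp only [facePoint, hk, if_true]
      rw [hk] at h2
      rw [abs_le]
      constructor <;> linarith
    · simp only [facePoint, hk, if_false, sub_self, abs_zero]
      linarith

theorem facePoint_V (i : P.Node) : P.facePoint i P.V = P.centre i P.V := by
  simp [facePoint, centre_apply, P.F_ne.symm]

theorem facePoint_notMem (i : P.Node) : P.facePoint i ∉ P.box i := fun h => by
  have := (h P.F).2
  simp [facePoint] at this

theorem facePoint_mem_closure (i : P.Node) : P.facePoint i ∈ closure (P.box i) := by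
  classical
  have hc : Continuous fun t : ℝ => P.centre i + t • (P.facePoint i - P.centre i) := by fun_prop
  have h1 : P.facePoint i = (fun t : ℝ => P.centre i + t • (P.facePoint i - P.centre i)) 1 := by
    simp
  rw [h1]
  refine (hc.continuousWithinAt (s := Ico (0:ℝ) 1) (x := 1)).mem_closure ?_ ?_
  · rw [closure_Ico zero_ne_one]; simp
  · intro t ht k
    have h2 := P.side_bounds i k
    have h3 := P.sz_pos i
    by_cases hk : k = P.F
    · simp only [facePoint, hk, PiLp.add_apply, PiLp.smul_apply, PiLp.sub_apply, centre_apply,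
        if_true, smul_eq_mul]
      rw [hk] at h2
      constructor
      · nlinarith [ht.1, ht.2]
      · nlinarith [ht.1, ht.2]
    · simp only [facePoint, hk, PiLp.add_apply, PiLp.smul_apply, PiLp.sub_apply, centre_apply,
        if_false, smul_eq_mul, sub_self, mul_zero, add_zero]
      constructor <;> linarith

end Pattern

namespace Pattern

variable {n : ℕ} {U : Type*} {P : Pattern n U}

/-! #### The tree of boxes of a pattern -/

theorem eq_nil_of_depth_eq_zero {i : P.Node} (h : P.depth i = 0) : i = .chamber [] := by
  rcases i with v | ⟨v, u, k, hk⟩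
  · rcases v with _ | ⟨u, v⟩
    · rfl
    · simp [depth, chamberDepth] at h
  · exact absurd h (depth_corridor_ne_zero v u hk)

theorem depth_parent {i : P.Node} (h : P.depth i ≠ 0) : P.depth (P.parent i) + 1 = P.depth i := by
  rcases i with v | ⟨v, u, k, hk⟩
  · rcases v with _ | ⟨u, v⟩
    · exact absurd rfl h
    · have := P.K_pos u v.length
      simp only [parent, depth, chamberDepth]; omega
  · by_cases hlt : k + 1 < P.K u v.length
    · rw [parent_corridor_of_lt hk hlt]
      simp only [depth, chamberDepth]; omega
    · rw [parent_corridor_of_not_lt hk hlt]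
      simp only [depth, chamberDepth]; omega

/-- Induction over the pairs consisting of a node and its parent. -/
theorem parent_induction {p : P.Node → P.Node → Prop}
    (h1 : ∀ v u, p (.chamber (u :: v)) (.corridor v u 0 (P.K_pos u v.length)))
    (h2 : ∀ v u k hk hk', p (.corridor v u k hk) (.corridor v u (k + 1) hk'))
    (h3 : ∀ v u k hk, k + 1 = P.K u v.length → p (.corridor v u k hk) (.chamber v))
    {i : P.Node} (h : P.depth i ≠ 0) : p i (P.parent i) := by
  rcases i with v | ⟨v, u, k, hk⟩
  · rcases v with _ | ⟨u, v⟩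
    · exact absurd rfl h
    · exact h1 v u
  · by_cases hlt : k + 1 < P.K u v.length
    · rw [parent_corridor_of_lt hk hlt]
      exact h2 v u k hk hlt
    · rw [parent_corridor_of_not_lt hk hlt]
      exact h3 v u k hk (by omega)

theorem sz_comparable {i : P.Node} (h : P.depth i ≠ 0) :
    P.δ * P.sz i ≤ 2 * P.sz (P.parent i) ∧ P.δ * P.sz (P.parent i) ≤ 2 * P.sz i := by
  have hδ := P.δ_pos
  have hδ1 := P.δ_le_one
  have hδθ := P.δ_le
  have hθ := P.θ_le
  refine parent_induction (P := P) (p := fun i j => P.δ * P.sz i ≤ 2 * P.sz j ∧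
    P.δ * P.sz j ≤ 2 * P.sz i) ?_ ?_ ?_ h
  · intro v u
    have hr := P.r_pos v
    simp only [sz, r_cons, P.h_zero]
    constructor <;> nlinarith [mul_pos hr hδ, mul_pos hr P.θ_pos]
  · intro v u k hk hk'
    have hr := P.r_pos v
    have e1 := mul_le_mul_of_nonneg_left (P.h_succ_le u _ k hk') hr.le
    have e2 := mul_le_mul_of_nonneg_left (P.h_le_succ u _ k hk') hr.le
    have e3 := mul_pos hr (P.h_pos hk)
    have e4 := mul_pos hr (P.h_pos hk')
    simp only [sz]
    constructor <;> nlinarith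
  · intro v u k hk hK
    have hr := P.r_pos v
    simp only [sz, P.h_last u _ k hK]
    constructor <;> nlinarith [mul_pos hr hδ]

/-- The overlap of a box with its parent stays off the mid-height of both, so a point at the
mid-height of a box avoids its neighbours in the tree. -/
theorem centre_V_bounds {i : P.Node} (h : P.depth i ≠ 0) :
    P.hi (P.parent i) P.V ≤ P.centre i P.V ∧ P.centre (P.parent i) P.V ≤ P.lo i P.V := by
  have hδ := P.δ_pos
  have hδθ := P.δ_le
  have hθ := P.θ_le
  refine parent_induction (P := P) (p := fun i j => P.hi j P.V ≤ P.centre i P.V ∧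
    P.centre j P.V ≤ P.lo i P.V) ?_ ?_ ?_ h
  · intro v u
    have hr := P.r_pos v
    have e1 := mul_le_mul_of_nonneg_left (P.h_le u v.length 0 (P.K_pos u v.length)) hr.le
    have e2 := mul_le_mul_of_nonneg_left hδθ hr.le
    rw [P.h_zero] at e1
    have e3 := mul_pos hr hδ
    simp only [centre_apply, lo, Pattern.hi, if_true, r_cons, P.h_zero, P.y_zero, zero_add] at e1 ⊢
    constructor <;> nlinarith
  · intro v u k hk hk'
    have hr := P.r_pos v
    have e1 := mul_le_mul_of_nonneg_left (P.h_le u v.length k hk) hr.le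
    have e2 := mul_le_mul_of_nonneg_left (P.h_le u v.length (k + 1) hk') hr.le
    have e3 := mul_le_mul_of_nonneg_left (P.h_succ_le u _ k hk') hr.le
    have e4 := mul_le_mul_of_nonneg_left (P.h_le_succ u _ k hk') hr.le
    have e5 := mul_pos hr (P.h_pos hk)
    have e6 := mul_pos hr (P.h_pos hk')
    simp only [centre_apply, lo, Pattern.hi, if_true]
    constructor <;> nlinarith
  · intro v u k hk hK
    have hr := P.r_pos v
    have e1 := mul_le_mul_of_nonneg_left (P.h_le u v.length k hk) hr.le
    have e5 := mul_pos hr (P.h_pos hk)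
    have e2 := mul_le_mul_of_nonneg_left hδθ hr.le
    have e3 := mul_le_mul_of_nonneg_left hθ hr.le
    simp only [centre_apply, lo, Pattern.hi, if_true, P.h_last u _ k hK, hK, P.y_K,
      corner_cons] at *
    constructor <;> nlinarith

/-- The own box is open, the neighbours are excluded by height, and any other box is separated from
the closure. Hence there is a boundary point beside every box, as `BoxTree.off` demands. -/
theorem facePoint_off (i j : P.Node) : P.facePoint i ∉ P.box j := by
  intro h
  have hV := h P.V
  rw [facePoint_V] at hV
  rcases eq_or_ne i j with rfl | hij
  · exact facePoint_notMem i h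
  by_cases h1 : P.depth i ≠ 0 ∧ P.parent i = j
  · obtain ⟨h0, rfl⟩ := h1
    exact absurd hV.2 (not_lt.2 (centre_V_bounds h0).1)
  by_cases h2 : P.depth j ≠ 0 ∧ P.parent j = i
  · obtain ⟨h0, rfl⟩ := h2
    exact absurd hV.1 (not_lt.2 (centre_V_bounds h0).2)
  obtain ⟨x, hx, hx'⟩ := mem_closure_iff.1 (facePoint_mem_closure i) (P.box j)
    (isOpen_openBox _ _) h
  have := far_of_not_adj hij h1 h2 x hx' x hx
  rw [dist_self] at this
  exact absurd this (not_le.2 (mul_pos P.δ_pos (lt_max_of_lt_left (P.sz_pos i))))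

open Classical in
variable (P) in
/-- A point on the axis of a corridor. -/
noncomputable def axisPoint (v : List U) (u : U) (z : ℝ) : EuclideanSpace ℝ (Fin n) :=
  WithLp.toLp 2 fun i => if i = P.V then z else P.corner v i + P.r v * P.χ u i

theorem ball_axisPoint_subset_corridor {v : List U} {u : U} {k : ℕ} (hk : k < P.K u v.length)
    {z ρ : ℝ} (h0 : ρ ≤ P.r v * P.h u v.length k)
    (h1 : P.corner (u :: v) P.V - P.r v * (P.y u v.length (k + 1) + P.h u v.length k / 8) ≤ z - ρ)
    (h2 : z + ρ ≤ P.corner (u :: v) P.V - P.r v * (P.y u v.length k - P.h u v.length k / 8)) :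
    Metric.ball (P.axisPoint v u z) ρ ⊆ P.box (.corridor v u k hk) := by
  refine ball_subset_openBox (fun i => ?_) (fun i => ?_) <;> by_cases hi : i = P.V
  · subst hi; simpa [lo, axisPoint] using h1
  · simp only [lo, axisPoint, hi, if_false]; linarith
  · subst hi; simpa [Pattern.hi, axisPoint] using h2
  · simp only [Pattern.hi, axisPoint, hi, if_false]; linarith

theorem exists_gate {i : P.Node} (h : P.depth i ≠ 0) :
    ∃ g, Metric.ball g (P.sz i * P.δ / 16) ⊆ P.box i ∩ P.box (P.parent i) := by
  have hδ := P.δ_pos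
  have hδθ := P.δ_le
  have hθ := P.θ_le
  have hδ1 := P.δ_le_one
  refine parent_induction (P := P) (p := fun i j => ∃ g, Metric.ball g (P.sz i * P.δ / 16) ⊆
    P.box i ∩ P.box j) ?_ ?_ ?_ h
  · intro v u
    have hr := P.r_pos v
    have hrδ := mul_pos hr hδ
    have e1 := mul_le_mul_of_nonneg_left (P.h_le u v.length 0 (P.K_pos u v.length)) hr.le
    have e2 : P.sz (.chamber (u :: v)) * P.δ / 16 ≤ P.r v * P.δ / 16 := by
      simp only [sz, r_cons]
      nlinarith
    have e3 := mul_le_mul_of_nonneg_left hδθ hr.le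
    rw [P.h_zero, P.y_zero] at e1
    refine ⟨P.axisPoint v u (P.corner (u :: v) P.V + P.r v * P.δ / 16),
      (Metric.ball_subset_ball e2).trans (subset_inter ?_ ?_)⟩
    · refine ball_subset_openBox (fun i => ?_) (fun i => ?_) <;> by_cases hi : i = P.V
      · subst hi; simp [lo, axisPoint]
      · have := mul_le_mul_of_nonneg_left (P.le_χ u i hi) hr.le
        simp only [lo, axisPoint, hi, if_false, corner_cons]
        nlinarith
      · subst hi
        simp only [Pattern.hi, axisPoint, if_true, r_cons]
        nlinarith
      · have := mul_le_mul_of_nonneg_left (P.χ_add_le u i hi) hr.le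
        simp only [Pattern.hi, axisPoint, hi, if_false, corner_cons, r_cons]
        nlinarith
    · refine ball_axisPoint_subset_corridor _ ?_ ?_ ?_ <;> simp only [P.h_zero, P.y_zero]
      · linarith
      · nlinarith
      · nlinarith
  · intro v u k hk hk'
    have hr := P.r_pos v
    have e1 := mul_le_mul_of_nonneg_left (P.h_le u v.length k hk) hr.le
    have e2 := mul_le_mul_of_nonneg_left (P.h_le u v.length (k + 1) hk') hr.le
    have e3 := mul_le_mul_of_nonneg_left (P.h_succ_le u _ k hk') hr.le
    have e4 := mul_le_mul_of_nonneg_left (P.h_le_succ u _ k hk') hr.le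
    have e5 := mul_pos hr (P.h_pos hk)
    have e6 := mul_pos hr (P.h_pos hk')
    have e7 : P.sz (.corridor v u k hk) * P.δ / 16 ≤ P.r v * P.h u v.length k / 32 := by
      simp only [sz]
      nlinarith
    refine ⟨P.axisPoint v u (P.corner (u :: v) P.V - P.r v * P.y u v.length (k + 1)),
      (Metric.ball_subset_ball e7).trans (subset_inter ?_ ?_)⟩
    · refine ball_axisPoint_subset_corridor hk ?_ ?_ ?_ <;> nlinarith
    · refine ball_axisPoint_subset_corridor hk' ?_ ?_ ?_ <;> nlinarith
  · intro v u k hk hK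
    have hr := P.r_pos v
    have hrδ := mul_pos hr hδ
    have e1 := mul_le_mul_of_nonneg_left (P.h_le u v.length k hk) hr.le
    have e2 : P.sz (.corridor v u k hk) * P.δ / 16 ≤ P.r v * P.δ / 16 := by
      simp only [sz, P.h_last u _ k hK]
      nlinarith
    have e3 := mul_le_mul_of_nonneg_left hδθ hr.le
    have e4 := mul_le_mul_of_nonneg_left hθ hr.le
    rw [P.h_last u _ k hK, hK, P.y_K] at e1
    refine ⟨P.axisPoint v u (P.corner v P.V + P.r v - P.r v * P.δ / 16),
      (Metric.ball_subset_ball e2).trans (subset_inter ?_ ?_)⟩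
    · refine ball_axisPoint_subset_corridor _ ?_ ?_ ?_ <;>
        simp only [P.h_last u _ k hK, hK, P.y_K, corner_cons]
      · linarith
      · nlinarith
      · nlinarith
    · refine ball_subset_openBox (fun i => ?_) (fun i => ?_) <;> by_cases hi : i = P.V
      · subst hi
        simp only [lo, axisPoint, if_true]
        nlinarith
      · have f1 := mul_le_mul_of_nonneg_left (P.le_χ u i hi) hr.le
        have f2 := mul_le_mul_of_nonneg_left (P.τ_nonneg u i hi) hr.le
        simp only [lo, axisPoint, hi, if_false]
        nlinarith
      · subst hi; simp [Pattern.hi, axisPoint]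
      · have f1 := mul_le_mul_of_nonneg_left (P.χ_add_le u i hi) hr.le
        have f2 := mul_le_mul_of_nonneg_left (P.τ_add_le u i hi) hr.le
        simp only [Pattern.hi, axisPoint, hi, if_false]
        nlinarith

open Classical in
variable (P) in
/-- The tree of boxes of a pattern. -/
noncomputable def tree : BoxTree n P.Node where
  root := .chamber []
  parent := P.parent
  depth := P.depth
  lo := P.lo
  hi := P.hi
  q := P.centre
  g i := if h : P.depth i ≠ 0 then (exists_gate h).choose else 0
  sz := P.sz
  Λ := 16 * n / P.δ
  c := P.δ ^ 2 / (16 * n)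
  eq_root _ h := eq_nil_of_depth_eq_zero h
  depth_root := rfl
  depth_parent _ h := depth_parent h
  one_le_Λ := by
    have hn : (1 : ℝ) ≤ n := by exact_mod_cast (Fin.pos P.V)
    rw [one_le_div P.δ_pos]
    linarith [P.δ_le_one]
  c_pos := by
    have hn : (1 : ℝ) ≤ n := by exact_mod_cast (Fin.pos P.V)
    have := P.δ_pos
    positivity
  c_mul_Λ := by
    have hn : (1 : ℝ) ≤ n := by exact_mod_cast (Fin.pos P.V)
    have := P.δ_pos
    have h : P.δ ^ 2 / (16 * n) * (16 * n / P.δ) = P.δ := by field_simp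
    rw [h]
    exact P.δ_le_one
  sz_pos := P.sz_pos
  ball_subset := P.ball_centre_subset
  dist_le i x hx := by
    refine (P.dist_centre_le i hx).trans ?_
    have hδ := P.δ_pos
    have := P.δ_le_one
    have := P.sz_pos i
    rw [← mul_assoc]
    gcongr
    rw [le_div_iff₀ hδ]
    have hn : (0 : ℝ) ≤ n := by positivity
    nlinarith
  sz_le_parent i h := by
    have hn : (1 : ℝ) ≤ n := by exact_mod_cast (Fin.pos P.V)
    have h1 := (sz_comparable h).1
    have h2 := P.sz_pos (P.parent i)
    rw [div_mul_eq_mul_div, le_div_iff₀ P.δ_pos]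
    nlinarith
  sz_parent_le i h := by
    have hn : (1 : ℝ) ≤ n := by exact_mod_cast (Fin.pos P.V)
    have h1 := (sz_comparable h).2
    have h2 := P.sz_pos i
    rw [div_mul_eq_mul_div, le_div_iff₀ P.δ_pos]
    nlinarith
  gate_subset i h := by
    have hn : (1 : ℝ) ≤ n := by exact_mod_cast (Fin.pos P.V)
    have hδ := P.δ_pos
    have hs := P.sz_pos i
    rw [dif_pos h]
    refine (Metric.ball_subset_ball ?_).trans (exists_gate h).choose_spec
    rw [div_div_eq_mul_div]
    gcongr
    linarith
  sep i j hij h1 h2 x hx y hy := by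
    have hn : (1 : ℝ) ≤ n := by exact_mod_cast (Fin.pos P.V)
    refine le_trans ?_ (far_of_not_adj hij h1 h2 x hx y hy)
    have := P.δ_pos
    have := (P.sz_pos i).trans_le (le_max_left _ (P.sz j))
    gcongr
    rw [div_le_iff₀ (by positivity)]
    nlinarith [P.δ_le_one]
  off i := ⟨P.facePoint i, facePoint_off i, by
    refine (P.dist_facePoint_le i).trans ?_
    have hδ := P.δ_pos
    have := P.δ_le_one
    have := P.sz_pos i
    rw [← mul_assoc]
    gcongr
    rw [le_div_iff₀ hδ]
    have hn : (0 : ℝ) ≤ n := by positivity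
    nlinarith⟩

variable (P) in
/-- The domain of a pattern: the union of all boxes. -/
def domain : Set (EuclideanSpace ℝ (Fin n)) := ⋃ i, P.box i

theorem isBounded_domain : Bornology.IsBounded P.domain := by
  refine (Metric.isBounded_ball (x := (0 : EuclideanSpace ℝ (Fin n))) (r := n * 2 + 1)).subset ?_
  intro x hx
  obtain ⟨i, hi⟩ := mem_iUnion.1 hx
  obtain ⟨h1, h2, h3⟩ := box_subset_zone_nil i hi
  have hr : P.r [] = 1 := by simp [r]
  have : dist x 0 ≤ n * 2 := by
    refine dist_le_of_coord_le fun k => ?_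
    have hc : P.corner [] k = 0 := rfl
    have hc' : P.corner [] P.V = 0 := rfl
    by_cases hk : k = P.V
    · subst hk
      rw [hc, hr] at h3
      rw [hc] at h2
      simp only [PiLp.zero_apply, sub_zero]
      rw [abs_le]; constructor <;> linarith
    · have := h1 k hk
      rw [hc, hr] at this
      simp only [PiLp.zero_apply, sub_zero]
      rw [abs_le]; constructor <;> linarith
  rw [Metric.mem_ball]
  linarith

theorem isGromovHyperbolicDomain : IsGromovHyperbolicDomain P.domain :=
  P.tree.isGromovHyperbolicDomain P.isBounded_domain

variable (P) in
/-- The potential that controls the lengths of John curves. -/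
noncomputable def potential : P.Node → ℝ
  | .chamber v => 128 * n / P.δ ^ 2 * P.r v
  | .corridor v u k _ => 128 * n / P.δ ^ 2 * P.r (u :: v) +
      32 * n / P.δ ^ 2 * ((P.y u v.length k + P.δ) * P.r v)

/-- The chamber above the corridor contributes only the fraction `θ ≤ 1 / 8` of the potential of
`v`, and the corridor is shorter than `r v`, so there is room left for the passage into the chamber.
-/
theorem potential_corridor_le {v : List U} {u : U} {k : ℕ} (hk : k < P.K u v.length) :
    P.potential (.corridor v u k hk) + 8 * n / P.δ ^ 2 * P.r v ≤ 128 * n / P.δ ^ 2 * P.r v := by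
  have hδ := P.δ_pos
  have hδ' := P.δ_le
  have hθ := P.θ_le
  have hr := P.r_pos v
  have hy := P.y_le u hk.le
  have hy' := P.τ_V_add_le u
  have hθ0 := P.θ_pos
  simp only [potential, r_cons]
  have e : 128 * n / P.δ ^ 2 * (P.θ * P.r v) +
      32 * n / P.δ ^ 2 * ((P.y u v.length k + P.δ) * P.r v) + 8 * n / P.δ ^ 2 * P.r v =
      (n / P.δ ^ 2 * P.r v) * (128 * P.θ + 32 * (P.y u v.length k + P.δ) + 8) := by ring
  have e' : 128 * n / P.δ ^ 2 * P.r v = (n / P.δ ^ 2 * P.r v) * 128 := by ring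
  rw [e, e']
  gcongr
  linarith

/-- The potential is at most `A * r v` in the chamber of `v` and in the corridors that leave it,
whereas every piece of these has size at least `r v * w / 2 ≥ (δ / 4) * r v ^ s`. This is the
required comparison of the `s`-th power of length with width. -/
theorem isSJohnDomain {s : ℝ} (hs : 1 ≤ s)
    (hw : ∀ l, P.δ / 2 * (P.θ ^ l) ^ (s - 1) ≤ P.w l) :
    IsSJohnDomain s P.domain (P.centre (.chamber [])) := by
  have hδ := P.δ_pos
  have hδ1 := P.δ_le_one
  have hδθ := P.δ_le
  have hθ := P.θ_le
  have hθ0 := P.θ_pos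
  have hn : (1 : ℝ) ≤ n := by exact_mod_cast (Fin.pos P.V)
  set A : ℝ := 128 * n / P.δ ^ 2 with hA
  set κ : ℝ := n / P.δ ^ 2 with hκ
  have hA' : A = 128 * κ := by rw [hA, hκ]; ring
  have hκ' : (32 * n / P.δ ^ 2 : ℝ) = 32 * κ := by rw [hκ]; ring
  have hκ'' : (8 * n / P.δ ^ 2 : ℝ) = 8 * κ := by rw [hκ]; ring
  have hκδ : (16 * n / P.δ : ℝ) = 16 * (κ * P.δ) := by rw [hκ]; field_simp
  have hκ0 : 0 < κ := by positivity
  have hκ1 : κ * P.δ ≤ κ := mul_le_of_le_one_right hκ0.le hδ1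
  have hA0 : 0 < A := by positivity
  have hpot : ∀ v u k hk, P.potential (.corridor v u k hk) =
      A * P.r (u :: v) + 32 * κ * ((P.y u v.length k + P.δ) * P.r v) := by
    intro v u k hk
    simp only [potential, hκ', hA]
  have hszr : ∀ v, P.r v ^ s * (P.δ / 4) ≤ P.r v * P.w v.length / 2 := by
    intro v
    have h1 := hw v.length
    have hr := P.r_pos v
    have h2 : P.r v ^ s = P.r v * P.r v ^ (s - 1) := by
      have := Real.rpow_add_one hr.ne' (s - 1)
      rw [sub_add_cancel] at this
      rw [this, mul_comm]
    rw [h2]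
    have h3 : P.r v * (P.δ / 2 * P.r v ^ (s - 1)) ≤ P.r v * P.w v.length := by gcongr; exact h1
    linarith
  have hpow : ∀ (v : List U) (a b : ℝ), 0 ≤ a → a ≤ A * P.r v → P.r v ^ s * (P.δ / 4) ≤ b →
      a ^ s ≤ A ^ s * (4 / P.δ) * b := by
    intro v a b ha hav hb
    calc a ^ s ≤ (A * P.r v) ^ s := Real.rpow_le_rpow ha hav (by linarith)
      _ = A ^ s * (4 / P.δ) * (P.r v ^ s * (P.δ / 4)) := by
        rw [Real.mul_rpow hA0.le (P.r_pos v).le]; field_simp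
      _ ≤ _ := by gcongr
  have hrs : ∀ v, P.r v ^ s ≤ P.r v := fun v => by
    have := Real.rpow_le_rpow_of_exponent_ge (P.r_pos v) (P.r_le_one v) hs
    rwa [Real.rpow_one] at this
  have hnn : ∀ i, 0 ≤ P.potential i := by
    rintro (v | ⟨v, u, k, hk⟩)
    · have := P.r_pos v
      simp only [potential]; positivity
    · have := P.r_pos v
      have := P.r_pos (u :: v)
      have := P.y_nonneg u hk.le
      rw [hpot]; positivity
  refine P.tree.isSJohnDomain P.isBounded_domain hs (C := A ^ s * (4 / P.δ)) (B := A) P.potential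
    ?_ ?_ ?_ ?_ ?_
  · change ∀ i, 16 * n / P.δ * P.sz i ≤ P.potential i
    rw [hκδ]
    rintro (v | ⟨v, u, k, hk⟩)
    · have := P.r_pos v
      simp only [potential, sz]
      rw [← hA, hA']
      nlinarith
    · have hr := P.r_pos v
      have h1 := P.h_le_δ u _ k hk
      have h2 := P.h_pos hk
      have h3 := P.y_nonneg u hk.le
      rw [hpot]
      simp only [sz]
      have e1 : P.r v * P.h u v.length k ≤ P.r v * (P.y u v.length k + P.δ) := by gcongr; linarith
      have e2 : κ * P.δ * (P.r v * P.h u v.length k) ≤ κ * (P.r v * (P.y u v.length k + P.δ)) := by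
        gcongr
      have e3 : 0 < A * P.r (u :: v) := mul_pos hA0 (P.r_pos _)
      have e4 : 0 < κ * (P.r v * (P.y u v.length k + P.δ)) := by positivity
      linarith
  · intro i h
    change P.potential i + 16 * n / P.δ * P.sz i + 16 * n / P.δ * P.sz (P.parent i) ≤
      P.potential (P.parent i)
    rw [hκδ]
    refine parent_induction (P := P) (p := fun i j => P.potential i + 16 * (κ * P.δ) * P.sz i +
      16 * (κ * P.δ) * P.sz j ≤ P.potential j) ?_ ?_ ?_ h
    · intro v u
      have hr := P.r_pos v
      rw [hpot]
      simp only [potential, sz, P.y_zero, P.h_zero, r_cons, ← hA]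
      have e1 : κ * P.δ * (P.r v * P.δ) ≤ κ * P.δ * (P.r v * 1) := by gcongr
      have e2 : κ * P.δ * (P.r v * P.θ) ≤ κ * P.δ * (P.r v * 1) := by gcongr; linarith
      have e3 : 0 < κ * P.δ * (P.r v * 1) := by positivity
      linarith
    · intro v u k hk hk'
      have hr := P.r_pos v
      rw [hpot, hpot]
      simp only [sz]
      have e1 := P.h_le u v.length k hk
      have e2 := P.h_succ_le u v.length k hk'
      have hh := P.h_pos hk
      have hh' := P.h_pos hk'
      have e3 : κ * P.r v * (P.h u v.length k + P.h u v.length (k + 1)) ≤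
        κ * P.r v * (3 * (P.y u v.length (k + 1) - P.y u v.length k)) := by gcongr; linarith
      have e4 : κ * P.δ * (P.r v * (P.h u v.length k + P.h u v.length (k + 1))) ≤
        κ * (P.r v * (P.h u v.length k + P.h u v.length (k + 1))) := by gcongr
      have e5 : 0 < κ * P.r v * (P.h u v.length k + P.h u v.length (k + 1)) := by positivity
      nlinarith
    · intro v u k hk hK
      have hr := P.r_pos v
      have e := P.potential_corridor_le hk
      have e1 : P.potential (.chamber v) = A * P.r v := rfl
      rw [e1]
      rw [← hA, hκ''] at e
      simp only [sz, P.h_last u _ k hK]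
      have hδ8 : P.δ ≤ 1 / 64 := by linarith
      have e2 : κ * P.δ * P.r v ≤ κ * (1 / 64) * P.r v := by gcongr
      have e3 : κ * P.δ * (P.r v * P.δ) ≤ κ * P.δ * (P.r v * 1) := by gcongr
      have e4 : 0 < κ * P.r v := by positivity
      linarith
  · intro i h
    change P.potential (P.parent i) ^ s ≤ A ^ s * (4 / P.δ) * P.sz i
    refine parent_induction (P := P) (p := fun i j => P.potential j ^ s ≤
      A ^ s * (4 / P.δ) * P.sz i) ?_ ?_ ?_ h
    · intro v u
      have hr := P.r_pos v
      refine hpow v _ _ (hnn _) ?_ ?_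
      · have := P.potential_corridor_le (P.K_pos u v.length)
        rw [← hA, hκ''] at this
        have : 0 < 8 * κ * P.r v := by positivity
        linarith
      · have := hrs v
        simp only [sz, r_cons]
        nlinarith
    · intro v u k hk hk'
      have hr := P.r_pos v
      refine hpow v _ _ (hnn _) ?_ ((hszr v).trans ?_)
      · have := P.potential_corridor_le hk'
        rw [← hA, hκ''] at this
        have : 0 < 8 * κ * P.r v := by positivity
        linarith
      · have := P.w_le_h u _ k hk
        simp only [sz]
        gcongr
    · intro v u k hk hK
      have hr := P.r_pos v
      refine hpow v _ _ (hnn _) le_rfl ((hszr v).trans ?_)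
      have := P.w_le_h u _ k hk
      simp only [sz]
      gcongr
  · refine hpow [] _ _ (hnn _) le_rfl ?_
    change P.r [] ^ s * (P.δ / 4) ≤ P.r [] / 2
    simp [r]
    linarith
  · rintro (v | ⟨v, u, k, hk⟩)
    · have := P.r_le_one v
      have e1 : P.potential (.chamber v) = A * P.r v := rfl
      rw [e1]
      exact mul_le_of_le_one_right hA0.le this
    · have := P.potential_corridor_le hk
      have h1 := P.r_le_one v
      have hr := P.r_pos v
      have h2 : A * P.r v ≤ A := mul_le_of_le_one_right hA0.le h1
      rw [← hA, hκ''] at this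
      have : 0 < 8 * κ * P.r v := by positivity
      linarith

end Pattern

/-! ### Hausdorff content of the sets of chambers -/

/-- The words whose letters of generation `i` belong to `L i`. -/
def words {U : Type*} (L : ℕ → Finset U) : ℕ → Finset (List U)
  | 0 => {[]}
  | j + 1 => (L j ×ˢ words L j).map
      ⟨fun p => p.1 :: p.2, fun p q h => by
        simp only [List.cons.injEq] at h; exact Prod.ext h.1 h.2⟩

section Words

variable {U : Type*} {L : ℕ → Finset U}

theorem mem_words_succ {j : ℕ} {w : List U} :
    w ∈ words L (j + 1) ↔ ∃ u ∈ L j, ∃ v ∈ words L j, u :: v = w := by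
  simp only [words, Finset.mem_map, Finset.mem_product, Prod.exists]
  constructor
  · rintro ⟨u, v, ⟨h1, h2⟩, h3⟩; exact ⟨u, h1, v, h2, h3⟩
  · rintro ⟨u, h1, v, h2, h3⟩; exact ⟨u, v, ⟨h1, h2⟩, h3⟩

theorem length_of_mem_words {j : ℕ} : ∀ {w : List U}, w ∈ words L j → w.length = j := by
  induction j with
  | zero => intro w hw; simp only [words, Finset.mem_singleton] at hw; simp [hw]
  | succ j ih =>
    intro w hw
    obtain ⟨u, -, v, hv, rfl⟩ := mem_words_succ.1 hw
    simp [ih hv]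

theorem card_words_succ (j : ℕ) : (words L (j + 1)).card = (L j).card * (words L j).card := by
  simp [words]

-- The set of admissible letters depends only on the generation, so all words of a given length have
-- equally many extensions.
open Classical in
theorem card_words_suffix_le (w : List U) {j : ℕ} (hj : w.length ≤ j) :
    ((words L j).filter fun v => w <:+ v).card * (words L w.length).card ≤ (words L j).card := by
  induction j, hj using Nat.le_induction with
  | base =>
    have : ((words L w.length).filter fun v => w <:+ v).card ≤ 1 := by
      refine Finset.card_le_one.2 fun a ha b hb => ?_
      simp only [Finset.mem_filter] at ha hb
      rw [← ha.2.eq_of_length (length_of_mem_words ha.1).symm,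
        ← hb.2.eq_of_length (length_of_mem_words hb.1).symm]
    simpa using Nat.mul_le_mul_right (words L w.length).card this
  | succ j hj ih =>
    have hsub : ((words L (j + 1)).filter fun v => w <:+ v) ⊆
        (L j ×ˢ ((words L j).filter fun v => w <:+ v)).image fun p => p.1 :: p.2 := by
      intro x hx
      simp only [Finset.mem_filter] at hx
      obtain ⟨u, hu, v, hv, rfl⟩ := mem_words_succ.1 hx.1
      refine Finset.mem_image.2 ⟨(u, v), ?_, rfl⟩
      refine Finset.mem_product.2 ⟨hu, Finset.mem_filter.2 ⟨hv, ?_⟩⟩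
      rcases List.suffix_cons_iff.1 hx.2 with h | h
      · have := length_of_mem_words hx.1
        rw [← h] at this
        omega
      · exact h
    have h1 := (Finset.card_le_card hsub).trans Finset.card_image_le
    rw [Finset.card_product] at h1
    rw [card_words_succ]
    calc _ ≤ (L j).card * ((words L j).filter fun v => w <:+ v).card * (words L w.length).card :=
          Nat.mul_le_mul_right _ h1
      _ ≤ _ := by rw [mul_assoc]; exact Nat.mul_le_mul_left _ ih

end Words

/-- A choice of letters for which the number of words grows like `B ^ j / (j + 1)`. -/
theorem exists_letters {U : Type*} [Fintype U] [Nonempty U] {B : ℝ} (hB : 2 ≤ B)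
    (hU : B ≤ Fintype.card U) : ∃ L : ℕ → Finset U, ∀ j,
      ((words L j).card : ℝ) ≤ B ^ j / (j + 1) ∧
        B ^ j / (j + 1) ≤ Fintype.card U * (words L j).card := by
  classical
  set b : ℕ → ℝ := fun j => B ^ j / (j + 1) with hb
  have hb0 : ∀ j, 0 < b j := fun j => by simp only [hb]; positivity
  have hmono : ∀ j, b j ≤ b (j + 1) := by
    intro j
    simp only [hb]
    rw [div_le_div_iff₀ (by positivity) (by positivity), pow_succ]
    push_cast
    have : (0 : ℝ) ≤ j := by positivity
    have h1 : (j : ℝ) + 1 + 1 ≤ B * (j + 1) := by nlinarith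
    have := mul_le_mul_of_nonneg_left h1 (show 0 ≤ B ^ j by positivity)
    linarith
  have hgrow : ∀ j, b (j + 1) ≤ B * b j := by
    intro j
    simp only [hb]
    rw [← mul_div_assoc, ← pow_succ']
    gcongr
    simp
  obtain ⟨u₀⟩ := ‹Nonempty U›
  set M : ℕ := Fintype.card U with hM
  -- Greedy choice, recorded with the current number of words: use all letters whenever the next
  -- count stays below `b (j + 1)`, and a single letter otherwise. Since `b` is nondecreasing and
  -- grows by at most the factor `B ≤ M`, the count never lags behind by more than the factor `M`.
  let f : ℕ → ℕ × Finset U := fun j => Nat.rec (1, if (M : ℝ) * 1 ≤ b 1 then Finset.univ else {u₀})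
    (fun j p => (p.2.card * p.1,
      if (M : ℝ) * (p.2.card * p.1 : ℕ) ≤ b (j + 2) then Finset.univ else {u₀})) j
  have hcard : ∀ j, (words (fun j => (f j).2) j).card = (f j).1 := by
    intro j
    induction j with
    | zero => rfl
    | succ j ih => rw [card_words_succ, ih]
  have hf2 : ∀ j, (f j).2 = if (M : ℝ) * (f j).1 ≤ b (j + 1) then Finset.univ else {u₀} := by
    intro j
    rcases j with _ | j
    · simp [f]
    · rfl
  have hf1 : ∀ j, (f (j + 1)).1 = (f j).2.card * (f j).1 := fun j => rfl
  refine ⟨fun j => (f j).2, fun j => ?_⟩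
  rw [hcard]
  change ((f j).1 : ℝ) ≤ b j ∧ b j ≤ M * (f j).1
  induction j with
  | zero =>
    have e : (f 0).1 = 1 := rfl
    rw [e]
    have : b 0 = 1 := by simp [hb]
    rw [this]
    simp only [Nat.cast_one, mul_one]
    exact ⟨le_rfl, by linarith⟩
  | succ j ih =>
    rw [hf1, hf2]
    have hM0 : (0 : ℝ) < M := by linarith
    split_ifs with h
    · rw [Finset.card_univ]
      push_cast
      refine ⟨h, (hgrow j).trans ?_⟩
      exact mul_le_mul hU ih.2 (hb0 j).le hM0.le
    · simp only [Finset.card_singleton, one_mul]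
      exact ⟨ih.1.trans (hmono j), (not_le.1 h).le⟩

namespace Pattern

variable {n : ℕ} {U : Type*} {P : Pattern n U}

variable (P) in
/-- The union of the closed balls in the chambers of the words of length `j`. -/
noncomputable def core (L : ℕ → Finset U) (j : ℕ) : Set (EuclideanSpace ℝ (Fin n)) :=
  ⋃ v ∈ words L j, Metric.closedBall (P.centre (.chamber v)) (P.r v / 4)

theorem closedBall_subset_box (v : List U) :
    Metric.closedBall (P.centre (.chamber v)) (P.r v / 4) ⊆ P.box (.chamber v) :=
  (Metric.closedBall_subset_ball (by simp only [sz]; linarith [P.r_pos v])).trans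
    (ball_centre_subset _)

theorem isCompact_core (L : ℕ → Finset U) (j : ℕ) : IsCompact (P.core L j) :=
  (words L j).isCompact_biUnion fun _ _ => isCompact_closedBall _ _

theorem core_subset_domain (L : ℕ → Finset U) (j : ℕ) : P.core L j ⊆ P.domain :=
  iUnion₂_subset fun v _ => (closedBall_subset_box v).trans (subset_iUnion P.box _)

/-- Different words of the same length have a common part, and their chambers are separated. -/
theorem exists_suffix_of_ne {v v' : List U} (hlen : v.length = v'.length) (hne : v ≠ v') :
    ∃ l, l <:+ v ∧ l <:+ v' ∧ ∀ x ∈ P.box (.chamber v), ∀ y ∈ P.box (.chamber v'),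
      P.r l * P.δ ≤ dist x y := by
  rcases List.isSuffix_trichotomy v v' with h | h | ⟨l, u, u', huu, h1, h2⟩
  · exact absurd (h.eq_of_length hlen) hne
  · exact absurd (h.eq_of_length hlen.symm).symm hne
  · exact ⟨l, (List.suffix_cons u l).trans h1, (List.suffix_cons u' l).trans h2,
      fun x hx y hy => le_dist_of_branch huu (box_subset_branch (i := .chamber v) h1 hx)
        (box_subset_branch (i := .chamber v') h2 hy)⟩

theorem r_of_mem_words {L : ℕ → Finset U} {j : ℕ} {v : List U} (hv : v ∈ words L j) :
    P.r v = P.θ ^ j := by rw [r, length_of_mem_words hv]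

theorem volume_closedBall_chamber {L : ℕ → Finset U} {j : ℕ} {v : List U} (hv : v ∈ words L j) :
    volume (Metric.closedBall (P.centre (.chamber v)) (P.r v / 4)) =
      ENNReal.ofReal ((P.θ ^ j / 4) ^ n) *
        volume (Metric.ball (0 : EuclideanSpace ℝ (Fin n)) 1) := by
  rw [Measure.addHaar_closedBall _ _ (by have := P.r_pos v; positivity), finrank_euclideanSpace,
    Fintype.card_fin, r_of_mem_words hv]

theorem volume_core (L : ℕ → Finset U) (j : ℕ) :
    volume (P.core L j) = (words L j).card * (ENNReal.ofReal ((P.θ ^ j / 4) ^ n) *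
        volume (Metric.ball (0 : EuclideanSpace ℝ (Fin n)) 1)) := by
  rw [core, measure_biUnion_finset ?_ fun _ _ => Metric.isClosed_closedBall.measurableSet]
  · rw [Finset.sum_congr rfl fun v hv => volume_closedBall_chamber hv, Finset.sum_const,
      nsmul_eq_mul]
  · intro v hv v' hv' hne
    obtain ⟨l, -, -, h⟩ := exists_suffix_of_ne (P := P)
      ((length_of_mem_words hv).trans (length_of_mem_words hv').symm) hne
    refine Set.disjoint_left.2 fun x hx hx' => ?_
    have := h x (closedBall_subset_box v hx) x (closedBall_subset_box v' hx')
    rw [dist_self] at this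
    exact absurd this (not_le.2 (mul_pos (P.r_pos l) P.δ_pos))

-- A ball too small to meet different branches above words shorter than `k` sees only chambers whose
-- words share a suffix of length `k`. By equal branching these carry at most one part in `(words L
-- k).card` of the volume.
open Classical in
theorem volume_core_inter_ball_le (L : ℕ → Finset U) (j k : ℕ) (hk : k ≤ j)
    {x : EuclideanSpace ℝ (Fin n)} {ρ : ℝ} (hρ : ∀ i < k, 2 * ρ < P.θ ^ i * P.δ) :
    volume (P.core L j ∩ Metric.ball x ρ) * (words L k).card ≤ volume (P.core L j) := by
  set T := (words L j).filter fun v =>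
    (Metric.closedBall (P.centre (.chamber v)) (P.r v / 4) ∩ Metric.ball x ρ).Nonempty with hT
  have hsub : P.core L j ∩ Metric.ball x ρ ⊆
      ⋃ v ∈ T, Metric.closedBall (P.centre (.chamber v)) (P.r v / 4) := by
    rintro z ⟨hz, hzb⟩
    obtain ⟨v, hv, hzv⟩ := mem_iUnion₂.1 hz
    exact mem_iUnion₂.2 ⟨v, Finset.mem_filter.2 ⟨hv, z, hzv, hzb⟩, hzv⟩
  set κ := ENNReal.ofReal ((P.θ ^ j / 4) ^ n) *
        volume (Metric.ball (0 : EuclideanSpace ℝ (Fin n)) 1) with hκ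
  have h1 : volume (P.core L j ∩ Metric.ball x ρ) ≤ T.card * κ := by
    refine (measure_mono hsub).trans ((measure_biUnion_finset_le _ _).trans ?_)
    rw [Finset.sum_congr rfl fun v hv => volume_closedBall_chamber (Finset.mem_filter.1 hv).1,
      Finset.sum_const, nsmul_eq_mul]
  have h2 : T.card * (words L k).card ≤ (words L j).card := by
    rcases T.eq_empty_or_nonempty with h | ⟨v₀, hv₀⟩
    · simp [h]
    have hv₀' := Finset.mem_filter.1 hv₀
    have hl₀ := length_of_mem_words hv₀'.1
    set w := v₀.drop (j - k) with hw
    have hwl : w.length = k := by rw [hw, List.length_drop, hl₀]; omega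
    have hTw : T ⊆ (words L j).filter fun v => w <:+ v := by
      intro v hv
      have hv' := Finset.mem_filter.1 hv
      refine Finset.mem_filter.2 ⟨hv'.1, ?_⟩
      by_cases hne : v = v₀
      · rw [hne]; exact List.drop_suffix _ _
      obtain ⟨l, hl, hl', h⟩ := exists_suffix_of_ne (P := P)
        ((length_of_mem_words hv'.1).trans hl₀.symm) hne
      obtain ⟨a, ha, hax⟩ := hv'.2
      obtain ⟨b, hb, hbx⟩ := hv₀'.2
      have h3 := h a (closedBall_subset_box v ha) b (closedBall_subset_box v₀ hb)
      have h4 := dist_triangle_right a b x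
      rw [Metric.mem_ball] at hax hbx
      have h5 : k ≤ l.length := by
        by_contra hcon
        have := hρ l.length (by omega)
        rw [r] at h3
        linarith
      exact (List.suffix_of_suffix_length_le (l₁ := w) (List.drop_suffix _ _) hl'
        (by omega)).trans hl
    have := card_words_suffix_le (L := L) w (j := j) (by omega)
    rw [hwl] at this
    exact (Nat.mul_le_mul_right _ (Finset.card_le_card hTw)).trans this
  calc volume (P.core L j ∩ Metric.ball x ρ) * (words L k).card
      ≤ T.card * κ * (words L k).card := by gcongr
    _ = ((T.card * (words L k).card : ℕ) : ℝ≥0∞) * κ := by push_cast; ring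
    _ ≤ (words L j).card * κ := by gcongr
    _ = _ := (volume_core L j).symm

/-- The sets `core L j` have Hausdorff content bounded below if there are enough words. -/
theorem exists_le_hausdorffContent (L : ℕ → Finset U) {q C : ℝ} (hq : 0 < q) (hqn : q ≤ n)
    (hC : 0 < C) (h : ∀ j, 1 ≤ C * (words L j).card * (P.θ ^ j) ^ q) :
    ∃ c : ℝ≥0, 0 < c ∧ ∀ j, (c : ℝ≥0∞) ≤ hausdorffContent q (P.core L j) := by
  have hθ := P.θ_pos
  have hδ := P.δ_pos
  set D : ℝ := C * (2 / P.δ) ^ q + C * 4 ^ n with hD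
  have hD0 : 0 < D := by positivity
  have hN : ∀ j, 0 < (words L j).card := by
    intro j
    rcases Nat.eq_zero_or_pos (words L j).card with h0 | h0
    · have := h j
      rw [h0] at this
      norm_num at this
    · exact h0
  have hball0 : volume (Metric.ball (0 : EuclideanSpace ℝ (Fin n)) 1) ≠ 0 :=
    (Metric.measure_ball_pos _ _ one_pos).ne'
  have hball1 : volume (Metric.ball (0 : EuclideanSpace ℝ (Fin n)) 1) ≠ ⊤ := measure_ball_ne_top
  -- The Frostman condition for normalized Lebesgue measure on the core; summing it over a covering
  -- bounds the content.
  have key : ∀ (j : ℕ) (x : EuclideanSpace ℝ (Fin n)) (ρ : ℝ≥0),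
      volume (P.core L j ∩ Metric.ball x ρ) ≤
        ENNReal.ofReal D * (ρ : ℝ≥0∞) ^ q * volume (P.core L j) := by
    intro j x ρ
    rcases eq_or_ne ρ 0 with rfl | hρ0
    · simp
    have hρ : (0 : ℝ) < ρ := NNReal.coe_pos.2 (pos_iff_ne_zero.2 hρ0)
    have eρ : ENNReal.ofReal D * (ρ : ℝ≥0∞) ^ q = ENNReal.ofReal (D * (ρ : ℝ) ^ q) := by
      rw [ENNReal.ofReal_mul hD0.le, ← ENNReal.ofReal_rpow_of_pos hρ, ENNReal.ofReal_coe_nnreal]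
    rw [eρ]
    have hex : ∃ k, P.θ ^ k * P.δ ≤ 2 * ρ := by
      obtain ⟨k, hk⟩ := exists_pow_lt_of_lt_one (show 0 < 2 * ρ / P.δ by positivity) P.θ_lt_one
      exact ⟨k, ((lt_div_iff₀ hδ).1 hk).le⟩
    classical
    have hk := Nat.find_spec hex
    have hmin : ∀ i < Nat.find hex, 2 * (ρ : ℝ) < P.θ ^ i * P.δ :=
      fun i hi => not_le.1 (Nat.find_min hex hi)
    set k := Nat.find hex with hkdef
    by_cases hkj : k ≤ j
    · have h1 := volume_core_inter_ball_le (P := P) L j k hkj (x := x) hmin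
      have h2 : (1 : ℝ) ≤ D * (ρ : ℝ) ^ q * (words L k).card := by
        refine (h k).trans ?_
        have e1 : (P.θ ^ k) ^ q ≤ (2 / P.δ) ^ q * (ρ : ℝ) ^ q := by
          rw [← Real.mul_rpow (by positivity) hρ.le]
          refine Real.rpow_le_rpow (by positivity) ?_ hq.le
          rw [div_mul_eq_mul_div, le_div_iff₀ hδ]
          exact hk
        calc C * (words L k).card * (P.θ ^ k) ^ q
            ≤ C * (words L k).card * ((2 / P.δ) ^ q * (ρ : ℝ) ^ q) := by gcongr
          _ = C * (2 / P.δ) ^ q * (ρ : ℝ) ^ q * (words L k).card := by ring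
          _ ≤ _ := by
            gcongr
            exact le_add_of_nonneg_right (by positivity)
      calc volume (P.core L j ∩ Metric.ball x ρ)
          ≤ ENNReal.ofReal (D * (ρ : ℝ) ^ q * (words L k).card) *
            volume (P.core L j ∩ Metric.ball x ρ) :=
            le_mul_of_one_le_left zero_le (by
              rw [← ENNReal.ofReal_one]; exact ENNReal.ofReal_le_ofReal h2)
        _ = ENNReal.ofReal (D * (ρ : ℝ) ^ q) *
            (volume (P.core L j ∩ Metric.ball x ρ) * (words L k).card) := by
            rw [ENNReal.ofReal_mul (by positivity), ENNReal.ofReal_natCast]; ring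
        _ ≤ _ := by gcongr
    -- The ball is now smaller than the chambers, so its full volume is compared with theirs; `q ≤
    -- n` turns the excess power of `ρ` into a power of `θ ^ j`.
    · have h1 : 2 * (ρ : ℝ) < P.θ ^ j * P.δ := hmin j (by omega)
      have hρj : (ρ : ℝ) ≤ P.θ ^ j := by
        have : P.θ ^ j * P.δ ≤ P.θ ^ j * 1 := by gcongr; exact P.δ_le_one
        linarith
      refine (measure_mono inter_subset_right).trans ?_
      rw [Measure.addHaar_ball_of_pos _ _ hρ, finrank_euclideanSpace, Fintype.card_fin, volume_core,
        ← ENNReal.ofReal_natCast, ← mul_assoc, ← mul_assoc, ← ENNReal.ofReal_mul (by positivity),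
        ← ENNReal.ofReal_mul (by positivity)]
      gcongr
      have e1 : (ρ : ℝ) ^ n = (ρ : ℝ) ^ q * (ρ : ℝ) ^ ((n : ℝ) - q) := by
        rw [← Real.rpow_add hρ, add_sub_cancel, Real.rpow_natCast]
      have e2 : (P.θ ^ j) ^ n = (P.θ ^ j) ^ q * (P.θ ^ j) ^ ((n : ℝ) - q) := by
        rw [← Real.rpow_add (by positivity), add_sub_cancel, Real.rpow_natCast]
      have e3 : (ρ : ℝ) ^ ((n : ℝ) - q) ≤ (P.θ ^ j) ^ ((n : ℝ) - q) :=
        Real.rpow_le_rpow hρ.le hρj (by linarith)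
      calc (ρ : ℝ) ^ n ≤ (ρ : ℝ) ^ q * (P.θ ^ j) ^ ((n : ℝ) - q) := by rw [e1]; gcongr
        _ ≤ (C * (words L j).card * (P.θ ^ j) ^ q) *
            ((ρ : ℝ) ^ q * (P.θ ^ j) ^ ((n : ℝ) - q)) :=
            le_mul_of_one_le_left (by positivity) (h j)
        _ = C * 4 ^ n * (ρ : ℝ) ^ q * (words L j).card *
            ((P.θ ^ j) ^ q * (P.θ ^ j) ^ ((n : ℝ) - q) / 4 ^ n) := by field_simp
        _ = C * 4 ^ n * (ρ : ℝ) ^ q * (words L j).card * (P.θ ^ j / 4) ^ n := by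
            rw [← e2, div_pow]
        _ ≤ D * (ρ : ℝ) ^ q * (words L j).card * (P.θ ^ j / 4) ^ n := by
            gcongr
            exact le_add_of_nonneg_left (by positivity)
  refine ⟨D.toNNReal⁻¹, inv_pos.2 (Real.toNNReal_pos.2 hD0), fun j => ?_⟩
  refine le_iInf fun x => le_iInf fun ρ => le_iInf fun hcov => ?_
  have hv0 : volume (P.core L j) ≠ 0 := by
    rw [volume_core]
    refine mul_ne_zero (by exact_mod_cast (hN j).ne') (mul_ne_zero ?_ hball0)
    exact (ENNReal.ofReal_pos.2 (by positivity)).ne'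
  have hv1 : volume (P.core L j) ≠ ⊤ := (isCompact_core L j).measure_lt_top.ne
  have hle : volume (P.core L j) ≤
      (ENNReal.ofReal D * ∑' i, (ρ i : ℝ≥0∞) ^ q) * volume (P.core L j) := by
    calc volume (P.core L j) ≤ volume (⋃ i, P.core L j ∩ Metric.ball (x i) (ρ i)) := by
          refine measure_mono fun z hz => ?_
          obtain ⟨i, hi⟩ := mem_iUnion.1 (hcov hz)
          exact mem_iUnion.2 ⟨i, hz, hi⟩
      _ ≤ ∑' i, volume (P.core L j ∩ Metric.ball (x i) (ρ i)) := measure_iUnion_le _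
      _ ≤ ∑' i, ENNReal.ofReal D * (ρ i : ℝ≥0∞) ^ q * volume (P.core L j) :=
          ENNReal.tsum_le_tsum fun i => key j _ _
      _ = _ := by rw [ENNReal.tsum_mul_right, ENNReal.tsum_mul_left]
  have h1 : 1 ≤ ENNReal.ofReal D * ∑' i, (ρ i : ℝ≥0∞) ^ q := by
    by_contra hcon
    rw [not_le] at hcon
    have := ENNReal.mul_lt_mul_left hv0 hv1 hcon
    rw [one_mul] at this
    exact absurd hle (not_le.2 this)
  have hD1 : (D.toNNReal : ℝ≥0∞) ≠ 0 := ENNReal.coe_ne_zero.2 (Real.toNNReal_pos.2 hD0).ne'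
  rw [ENNReal.coe_inv (Real.toNNReal_pos.2 hD0).ne', ENNReal.inv_le_iff_le_mul (fun _ => hD1)
    (fun h => absurd h ENNReal.coe_ne_top)]
  exact h1

end Pattern

/-! ### Test functions for the capacity -/

section WeakGradient

variable {n : ℕ} {Ω : Set (EuclideanSpace ℝ (Fin n))} {u : EuclideanSpace ℝ (Fin n) → ℝ}

/-- Functions regular only on `Ω` become globally continuous when multiplied by a test function, so
integration by parts over the whole space applies. -/
theorem ContinuousOn.continuous_mul_of_tsupport_subset {X : Type*} [TopologicalSpace X] {Ω : Set X}
    {a b : X → ℝ} (ha : ContinuousOn a Ω) (ho : IsOpen Ω) (hb : Continuous b)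
    (hs : tsupport b ⊆ Ω) : Continuous fun x => a x * b x := by
  refine continuous_iff_continuousAt.2 fun x => ?_
  by_cases hx : x ∈ tsupport b
  · exact (ha.continuousAt (ho.mem_nhds (hs hx))).mul hb.continuousAt
  · refine (continuousAt_const (y := (0 : ℝ))).congr ?_
    filter_upwards [(isClosed_tsupport b).isOpen_compl.mem_nhds hx] with y hy
    rw [image_eq_zero_of_notMem_tsupport hy, mul_zero]

/-- The classical gradient, as a vector. -/
noncomputable def classicalGradient (u : EuclideanSpace ℝ (Fin n) → ℝ)
    (x : EuclideanSpace ℝ (Fin n)) : EuclideanSpace ℝ (Fin n) :=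
  WithLp.toLp 2 fun i => fderiv ℝ u x (EuclideanSpace.single i 1)

theorem continuousOn_classicalGradient (ho : IsOpen Ω) (hu : ContDiffOn ℝ 1 u Ω) :
    ContinuousOn (classicalGradient u) Ω := by
  have h := hu.continuousOn_fderiv_of_isOpen ho le_rfl
  refine (PiLp.continuous_toLp 2 _).comp_continuousOn (continuousOn_pi.2 fun i => ?_)
  exact h.clm_apply continuousOn_const

theorem isWeakGradient_classicalGradient (ho : IsOpen Ω) (hu : ContDiffOn ℝ 1 u Ω) :
    IsWeakGradient Ω u (classicalGradient u) := by
  have hG := continuousOn_classicalGradient ho hu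
  refine ⟨hu.continuousOn.locallyIntegrableOn ho.measurableSet,
    hG.locallyIntegrableOn ho.measurableSet, fun φ hφ hc hs i => ?_⟩
  set e : EuclideanSpace ℝ (Fin n) := EuclideanSpace.single i 1 with he
  have hφd : Continuous fun x => fderiv ℝ φ x e := by
    have := hφ.continuous_fderiv (by simp)
    fun_prop
  have hsd : tsupport (fun x => fderiv ℝ φ x e) ⊆ Ω := (tsupport_fderiv_apply_subset ℝ e).trans hs
  have hcd : HasCompactSupport fun x => fderiv ℝ φ x e := hc.fderiv_apply (𝕜 := ℝ) e
  have hGi : ContinuousOn (fun x => fderiv ℝ u x e) Ω :=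
    (hu.continuousOn_fderiv_of_isOpen ho le_rfl).clm_apply continuousOn_const
  have i1 : Integrable (fun x => fderiv ℝ u x e * φ x) :=
    (hGi.continuous_mul_of_tsupport_subset ho hφ.continuous hs).integrable_of_hasCompactSupport
      hc.mul_left
  have i2 : Integrable (fun x => u x * fderiv ℝ φ x e) :=
    (hu.continuousOn.continuous_mul_of_tsupport_subset ho hφd hsd).integrable_of_hasCompactSupport
      hcd.mul_left
  have i3 : Integrable (fun x => u x * φ x) :=
    (hu.continuousOn.continuous_mul_of_tsupport_subset ho hφ.continuous
      hs).integrable_of_hasCompactSupport hc.mul_left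
  have key := integral_mul_fderiv_eq_neg_fderiv_mul_of_integrable i1 i2 i3
    (fun x hx => (hu.contDiffAt (ho.mem_nhds (hs hx))).differentiableAt one_ne_zero)
    (fun x _ => (hφ.differentiable (by simp)) x)
  rw [setIntegral_eq_integral_of_forall_compl_eq_zero, setIntegral_eq_integral_of_forall_compl_eq_zero,
    key]
  · rfl
  · intro x hx
    rw [image_eq_zero_of_notMem_tsupport fun h => hx (hs h), mul_zero]
  · intro x hx
    rw [image_eq_zero_of_notMem_tsupport (f := fun x => fderiv ℝ φ x e) fun h => hx (hsd h),
      mul_zero]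

theorem memLp_restrict_of_continuousOn {E : Type*} [NormedAddCommGroup E]
    [SecondCountableTopology E] {f : EuclideanSpace ℝ (Fin n) → E}
    {K : Set (EuclideanSpace ℝ (Fin n))} (hf : ContinuousOn f K) (hK : IsCompact K) (p : ℝ≥0∞) :
    MemLp f p (volume.restrict K) := by
  obtain ⟨C, hC⟩ := hK.exists_bound_of_continuousOn hf
  have : IsFiniteMeasure (volume.restrict K) := ⟨by simpa using hK.measure_lt_top⟩
  refine MemLp.of_bound (hf.aestronglyMeasurable hK.measurableSet) C ?_
  exact (ae_restrict_iff' hK.measurableSet).2 (Eventually.of_forall hC)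

theorem memW1pLoc_of_contDiffOn (ho : IsOpen Ω) (hu : ContDiffOn ℝ 1 u Ω) (p : ℝ) :
    MemW1pLoc p Ω u (classicalGradient u) :=
  ⟨isWeakGradient_classicalGradient ho hu, fun _ hK hc =>
    ⟨memLp_restrict_of_continuousOn (hu.continuousOn.mono hK) hc _,
      memLp_restrict_of_continuousOn ((continuousOn_classicalGradient ho hu).mono hK) hc _⟩⟩

theorem volume_openBox (lo hi : Fin n → ℝ) :
    volume (openBox lo hi) = ∏ k, ENNReal.ofReal (hi k - lo k) := by
  have h : openBox lo hi = (WithLp.ofLp : EuclideanSpace ℝ (Fin n) → Fin n → ℝ) ⁻¹'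
      (univ.pi fun k => Ioo (lo k) (hi k)) := by
    ext x; simp [openBox]
  rw [h, (PiLp.volume_preserving_ofLp (Fin n)).measure_preimage
    (MeasurableSet.univ_pi fun k => measurableSet_Ioo).nullMeasurableSet, volume_pi_pi]
  simp

/-- The gradient of a function of one coordinate. -/
theorem classicalGradient_coord {f : ℝ → ℝ} {k : Fin n} {x : EuclideanSpace ℝ (Fin n)}
    (hf : DifferentiableAt ℝ f (x k)) (hu : u =ᶠ[𝓝 x] fun y => f (y k)) :
    classicalGradient u x = deriv f (x k) • EuclideanSpace.single k (1 : ℝ) := by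
  have h1 : HasFDerivAt (fun y : EuclideanSpace ℝ (Fin n) => f (y k))
      (deriv f (x k) • (EuclideanSpace.proj k : EuclideanSpace ℝ (Fin n) →L[ℝ] ℝ)) x :=
    hf.hasDerivAt.comp_hasFDerivAt x
      (EuclideanSpace.proj k : EuclideanSpace ℝ (Fin n) →L[ℝ] ℝ).hasFDerivAt
  ext i
  simp only [classicalGradient, hu.fderiv_eq, h1.fderiv]
  simp [eq_comm]

/-- The margins at both ends keep the gradient away from the wide ends of a corridor and make the
test function constant near its mouths. -/
theorem exists_smooth_step : ∃ (f : ℝ → ℝ) (C : ℝ), ContDiff ℝ 1 f ∧ (∀ t ≤ 1 / 4, f t = 0) ∧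
    (∀ t, 3 / 4 ≤ t → f t = 1) ∧ (∀ t, |deriv f t| ≤ C) ∧
    ∀ t, deriv f t ≠ 0 → 1 / 4 ≤ t ∧ t ≤ 3 / 4 := by
  set f : ℝ → ℝ := fun t => Real.smoothTransition (2 * t - 1 / 2) with hf
  have hc : ContDiff ℝ 1 f := Real.smoothTransition.contDiff.comp (by fun_prop)
  have h0 : ∀ t ≤ 1 / 4, f t = 0 := fun t ht =>
    Real.smoothTransition.zero_of_nonpos (by linarith)
  have h1 : ∀ t, 3 / 4 ≤ t → f t = 1 := fun t ht =>
    Real.smoothTransition.one_of_one_le (by linarith)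
  have hd : ∀ t, deriv f t ≠ 0 → 1 / 4 ≤ t ∧ t ≤ 3 / 4 := by
    intro t ht
    constructor
    · by_contra! hlt
      refine ht ?_
      have : f =ᶠ[𝓝 t] fun _ => 0 := by
        filter_upwards [Iio_mem_nhds hlt] with y hy using h0 y (le_of_lt hy)
      rw [this.deriv_eq, deriv_const]
    · by_contra! hlt
      refine ht ?_
      have : f =ᶠ[𝓝 t] fun _ => 1 := by
        filter_upwards [Ioi_mem_nhds hlt] with y hy using h1 y (le_of_lt hy)
      rw [this.deriv_eq, deriv_const]
  obtain ⟨C, hC⟩ := (isCompact_Icc (a := (1 / 4 : ℝ)) (b := 3 / 4)).exists_bound_of_continuousOn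
    (hc.continuous_deriv le_rfl).continuousOn
  refine ⟨f, C, hc, h0, h1, fun t => ?_, hd⟩
  by_cases ht : deriv f t = 0
  · rw [ht, abs_zero]
    exact (norm_nonneg _).trans (hC (1 / 4) ⟨le_rfl, by norm_num⟩)
  · exact hC t (hd t ht)

end WeakGradient

namespace Pattern

variable {n : ℕ} {U : Type*} {P : Pattern n U}

variable (P) in
/-- The part of the domain above the entrance of the corridor to the chamber of `w`. -/
def limb (w : List U) : Set (EuclideanSpace ℝ (Fin n)) := ⋃ (i : P.Node) (_ : w <:+ i.word), P.box i

variable (P) in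
/-- The profile of the test function along the corridor to the chamber of a word, as a function of
the vertical coordinate. -/
noncomputable def cutoff (f : ℝ → ℝ) : List U → ℝ → ℝ
  | [], _ => 1
  | u :: v, z => f ((P.corner (u :: v) P.V - z) / (P.r v * (P.τ u P.V - 1)))

open Classical in
variable (P) in
/-- The test function for the capacity: it vanishes in the chambers of the words in `A` and their
descendants, and is equal to one outside the corridors that lead to them. -/
noncomputable def testFun (f : ℝ → ℝ) (A : Finset (List U)) (x : EuclideanSpace ℝ (Fin n)) : ℝ :=
  1 - ∑ w ∈ A, (P.limb w).indicator (fun x => 1 - P.cutoff f w (x P.V)) x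

theorem box_disjoint_of_suffix {w w' : List U} (hlen : w.length = w'.length) (hne : w ≠ w')
    {i j : P.Node} (hi : w <:+ i.word) (hj : w' <:+ j.word) : Disjoint (P.box i) (P.box j) := by
  refine Set.disjoint_left.2 fun x hx hx' => ?_
  rcases List.isSuffix_trichotomy w w' with h | h | ⟨l, u, u', huu, h1, h2⟩
  · exact hne (h.eq_of_length hlen)
  · exact hne (h.eq_of_length hlen.symm).symm
  · have := le_dist_of_branch huu (box_subset_branch (h1.trans hi) hx)
      (box_subset_branch (h2.trans hj) hx')
    rw [dist_self] at this
    exact absurd this (not_le.2 (mul_pos (P.r_pos l) P.δ_pos))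

theorem eq_or_adj_of_mem {i j : P.Node} {x : EuclideanSpace ℝ (Fin n)} (hi : x ∈ P.box i)
    (hj : x ∈ P.box j) : i = j ∨ (P.depth i ≠ 0 ∧ P.parent i = j) ∨
      (P.depth j ≠ 0 ∧ P.parent j = i) := by
  by_contra! h
  have := far_of_not_adj h.1 (fun h' => h.2.1 h'.1 h'.2) (fun h' => h.2.2 h'.1 h'.2) x hi x hj
  rw [dist_self] at this
  exact absurd this (not_le.2 (mul_pos P.δ_pos (lt_max_of_lt_left (P.sz_pos i))))

theorem word_parent_suffix {i : P.Node} (h : P.depth i ≠ 0) : (P.parent i).word <:+ i.word :=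
  parent_induction (P := P) (p := fun i j => j.word <:+ i.word)
    (fun _ _ => List.suffix_rfl) (fun _ _ _ _ _ => List.suffix_rfl)
    (fun v u _ _ _ => List.suffix_cons u v) h

theorem height_pos (u : U) (v : List U) : 0 < P.r v * (P.τ u P.V - 1) :=
  mul_pos (P.r_pos v) (by linarith [P.le_τ_V u])

theorem cutoff_eq_zero {f : ℝ → ℝ} (hf : ∀ t ≤ 1 / 4, f t = 0) {u : U} {v : List U} {z : ℝ}
    (hz : P.corner (u :: v) P.V ≤ z) : P.cutoff f (u :: v) z = 0 :=
  hf _ ((div_nonpos_of_nonpos_of_nonneg (by linarith) (P.height_pos u v).le).trans (by norm_num))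

theorem cutoff_eq_one {f : ℝ → ℝ} (hf : ∀ t, 3 / 4 ≤ t → f t = 1) {u : U} {v : List U} {z : ℝ}
    (hz : z ≤ P.corner v P.V + P.r v) : P.cutoff f (u :: v) z = 1 := by
  refine hf _ ?_
  rw [le_div_iff₀ (P.height_pos u v), corner_cons]
  have := P.height_pos u v
  linarith

/-- The profile is equal to one where a limb meets a box that does not belong to it. -/
theorem cutoff_eq_one_of_mem {f : ℝ → ℝ} (hf : ∀ t, 3 / 4 ≤ t → f t = 1) {w : List U}
    {i j : P.Node} {x : EuclideanSpace ℝ (Fin n)} (hi : x ∈ P.box i) (hj : x ∈ P.box j)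
    (hw : w <:+ j.word) (hwi : ¬ w <:+ i.word) : P.cutoff f w (x P.V) = 1 := by
  rcases eq_or_adj_of_mem hi hj with rfl | ⟨h0, rfl⟩ | ⟨h0, rfl⟩
  · exact absurd hw hwi
  · exact absurd (hw.trans (word_parent_suffix h0)) hwi
  · revert hwi hw hj hi
    refine parent_induction (P := P) (p := fun j i => x ∈ P.box j → w <:+ j.word → x ∈ P.box i →
      ¬ w <:+ i.word → P.cutoff f w (x P.V) = 1) ?_ ?_ ?_ h0
    · exact fun v u _ h _ h' => absurd h h'
    · exact fun v u _ _ _ _ h _ h' => absurd h h'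
    · intro v u k hk hK hj hw hi hwi
      rcases List.suffix_cons_iff.1 hw with rfl | h
      · exact cutoff_eq_one hf (mem_box_chamber.1 hi P.V).2.le
      · exact absurd h hwi

variable {f : ℝ → ℝ} {A : Finset (List U)} {l : ℕ}

/-- Limbs over different words of equal length are disjoint, so only one summand survives. -/
theorem testFun_of_suffix (hA : ∀ w ∈ A, w.length = l) {w : List U} (hw : w ∈ A) {i : P.Node}
    (hi : w <:+ i.word) {x : EuclideanSpace ℝ (Fin n)} (hx : x ∈ P.box i) :
    P.testFun f A x = P.cutoff f w (x P.V) := by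
  rw [testFun, Finset.sum_eq_single w]
  · have hmem : x ∈ P.limb w := mem_iUnion₂.2 ⟨i, hi, hx⟩
    rw [indicator_of_mem hmem]
    ring
  · intro w' hw' hne
    refine indicator_of_notMem (fun h => ?_) _
    obtain ⟨j, hj, hxj⟩ := mem_iUnion₂.1 h
    exact Set.disjoint_left.1 (box_disjoint_of_suffix ((hA w' hw').trans (hA w hw).symm) hne hj hi)
      hxj hx
  · exact fun h => absurd hw h

theorem testFun_of_not_suffix (hf : ∀ t, 3 / 4 ≤ t → f t = 1) {i : P.Node}
    (hi : ∀ w ∈ A, ¬ w <:+ i.word) {x : EuclideanSpace ℝ (Fin n)} (hx : x ∈ P.box i) :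
    P.testFun f A x = 1 := by
  rw [testFun, Finset.sum_eq_zero, sub_zero]
  intro w hw
  by_cases h : x ∈ P.limb w
  · rw [indicator_of_mem h]
    obtain ⟨j, hj, hxj⟩ := mem_iUnion₂.1 h
    rw [cutoff_eq_one_of_mem hf hx hxj hj (hi w hw), sub_self]
  · exact indicator_of_notMem h _

theorem testFun_of_notMem {x : EuclideanSpace ℝ (Fin n)} (hx : ∀ w ∈ A, x ∉ P.limb w) :
    P.testFun f A x = 1 := by
  rw [testFun, Finset.sum_eq_zero, sub_zero]
  exact fun w hw => indicator_of_notMem (hx w hw) _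

theorem contDiff_cutoff (hf : ContDiff ℝ 1 f) (w : List U) : ContDiff ℝ 1 (P.cutoff f w) := by
  rcases w with _ | ⟨u, v⟩
  · exact contDiff_const
  · exact hf.comp (by fun_prop)

theorem isOpen_domain : IsOpen P.domain := P.tree.isOpen_domain

theorem box_mem_nhds {i : P.Node} {x : EuclideanSpace ℝ (Fin n)} (hx : x ∈ P.box i) :
    P.box i ∈ 𝓝 x := (isOpen_openBox _ _).mem_nhds hx

/-- Regularity is checked box by box, the boxes being open. The edge of a limb causes no jump, since
where it meets a box outside the limb the profile is already one. -/
theorem contDiffOn_testFun (hf : ContDiff ℝ 1 f) (hf1 : ∀ t, 3 / 4 ≤ t → f t = 1)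
    (hA : ∀ w ∈ A, w.length = l) : ContDiffOn ℝ 1 (P.testFun f A) P.domain := by
  intro x hx
  obtain ⟨i, hi⟩ := mem_iUnion.1 hx
  refine ContDiffAt.contDiffWithinAt ?_
  by_cases h : ∃ w ∈ A, w <:+ i.word
  · obtain ⟨w, hw, hwi⟩ := h
    have h1 : ContDiff ℝ 1 fun y : EuclideanSpace ℝ (Fin n) => P.cutoff f w (y P.V) :=
      (contDiff_cutoff hf w).comp
        (EuclideanSpace.proj P.V : EuclideanSpace ℝ (Fin n) →L[ℝ] ℝ).contDiff
    refine h1.contDiffAt.congr_of_eventuallyEq ?_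
    filter_upwards [box_mem_nhds hi] with y hy using testFun_of_suffix hA hw hwi hy
  · push Not at h
    refine (contDiffAt_const (c := (1 : ℝ))).congr_of_eventuallyEq ?_
    filter_upwards [box_mem_nhds hi] with y hy using testFun_of_not_suffix hf1 h hy

variable (P) in
open Classical in
/-- The narrow part of the corridor that leads to the chamber of `u :: v`. -/
noncomputable def tube (v : List U) (u : U) : Set (EuclideanSpace ℝ (Fin n)) :=
  openBox (fun i => if i = P.V then P.corner (u :: v) i - P.r v * (P.τ u i - 1)
      else P.corner v i + P.r v * (P.χ u i - P.w v.length))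
    (fun i => if i = P.V then P.corner (u :: v) i
      else P.corner v i + P.r v * (P.χ u i + P.w v.length))

theorem volume_tube_le (v : List U) (u : U) :
    volume (P.tube v u) ≤ ENNReal.ofReal (P.r v * (2 * (P.r v * P.w v.length)) ^ (n - 1)) := by
  classical
  have hr := P.r_pos v
  have hw := P.w_pos v.length
  rw [tube, volume_openBox, ← Finset.mul_prod_erase _ _ (Finset.mem_univ P.V),
    ENNReal.ofReal_mul hr.le, ENNReal.ofReal_pow (by positivity)]
  refine mul_le_mul' ?_ (le_of_eq ?_)
  · simp only [if_true]
    refine ENNReal.ofReal_le_ofReal ?_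
    have := P.τ_V_add_le u
    have := P.θ_pos
    nlinarith
  · rw [Finset.prod_congr rfl (g := fun _ => ENNReal.ofReal (2 * (P.r v * P.w v.length)))]
    · rw [Finset.prod_const, Finset.card_erase_of_mem (Finset.mem_univ _), Finset.card_univ,
        Fintype.card_fin]
    · intro k hk
      simp only [Finset.ne_of_mem_erase hk, if_false]
      congr 1
      ring

theorem cutoff_deriv (hf : ContDiff ℝ 1 f) (v : List U) (u : U) (z : ℝ) :
    deriv (P.cutoff f (u :: v)) z =
      -deriv f ((P.corner (u :: v) P.V - z) / (P.r v * (P.τ u P.V - 1))) /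
        (P.r v * (P.τ u P.V - 1)) := by
  have h1 : HasDerivAt (fun z => (P.corner (u :: v) P.V - z) / (P.r v * (P.τ u P.V - 1)))
      (-1 / (P.r v * (P.τ u P.V - 1))) z :=
    ((hasDerivAt_id z).const_sub _).div_const _
  have h2 := ((hf.differentiable one_ne_zero) ((P.corner (u :: v) P.V - z) /
    (P.r v * (P.τ u P.V - 1)))).hasDerivAt.comp z h1
  have h3 : deriv (P.cutoff f (u :: v)) z = _ := h2.deriv
  rw [h3]
  ring

/-- The gradient of the test function is supported in the tubes and bounded there. -/
theorem norm_gradient_testFun {C : ℝ} (hf : ContDiff ℝ 1 f) (hf1 : ∀ t, 3 / 4 ≤ t → f t = 1)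
    (hfC : ∀ t, |deriv f t| ≤ C) (hfd : ∀ t, deriv f t ≠ 0 → 1 / 4 ≤ t ∧ t ≤ 3 / 4)
    (hA : ∀ w ∈ A, w.length = l) {x : EuclideanSpace ℝ (Fin n)} (hx : x ∈ P.domain) :
    classicalGradient (P.testFun f A) x = 0 ∨ ∃ v u, u :: v ∈ A ∧ x ∈ P.tube v u ∧
      ‖classicalGradient (P.testFun f A) x‖ ≤ 4 * C / P.r v := by
  obtain ⟨i, hi⟩ := mem_iUnion.1 hx
  have hC : 0 ≤ C := (abs_nonneg _).trans (hfC 0)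
  by_cases h : ∃ w ∈ A, w <:+ i.word
  · obtain ⟨w, hw, hwi⟩ := h
    have hev : P.testFun f A =ᶠ[𝓝 x] fun y => P.cutoff f w (y P.V) := by
      filter_upwards [box_mem_nhds hi] with y hy using testFun_of_suffix hA hw hwi hy
    have hG := classicalGradient_coord
      (((contDiff_cutoff (P := P) hf w).differentiable one_ne_zero) (x P.V)) hev
    by_cases h0 : deriv (P.cutoff f w) (x P.V) = 0
    · left
      rw [hG, h0, zero_smul]
    right
    rcases w with _ | ⟨u, v⟩
    · exact absurd (deriv_const _ _) h0
    have hr := P.r_pos v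
    have hH := P.height_pos u v
    have hτ := P.le_τ_V u
    refine ⟨v, u, hw, ?_, ?_⟩
    · rw [cutoff_deriv hf] at h0
      have h0' : deriv f ((P.corner (u :: v) P.V - x P.V) / (P.r v * (P.τ u P.V - 1))) ≠ 0 := by
        intro h; rw [h] at h0; simp at h0
      obtain ⟨t1, t2⟩ := hfd _ h0'
      rw [le_div_iff₀ hH] at t1
      rw [div_le_iff₀ hH] at t2
      have hzone : x ∉ P.zone (u :: v) := fun h => by linarith [h.2.1]
      rcases i with v' | ⟨v', u', k, hk⟩
      · exact absurd (zone_subset_of_suffix hwi (box_chamber_subset v' hi)) hzone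
      rcases List.suffix_cons_iff.1 hwi with h | h
      · simp only [List.cons.injEq] at h
        obtain ⟨rfl, rfl⟩ := h
        obtain ⟨e1, e2, e3⟩ := mem_box_corridor.1 hi
        have hδ := P.δ_le
        have hθ := P.θ_le
        have hh := P.h_le_δ u _ k hk
        -- Pieces wider than `w` lie within `2 * δ` of an end of the corridor, and there the
        -- argument of `f` is outside `[1/4, 3/4]`.
        have hwk : P.h u v.length k = P.w v.length := by
          by_contra hne
          rcases P.h_eq_w u _ k hk hne with h | h
          · have : P.r v * (P.y u v.length (k + 1) + P.h u v.length k / 8) ≤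
              P.r v * ((P.τ u P.V - 1) / 4) := by gcongr; linarith
            linarith
          · have : P.r v * ((P.τ u P.V - 1) * (3 / 4)) ≤
              P.r v * (P.y u v.length k - P.h u v.length k / 8) := by gcongr; linarith
            linarith
        intro m
        by_cases hm : m = P.V
        · subst hm
          simp only [if_true]
          constructor <;> linarith
        · simp only [hm, if_false, ← hwk]
          exact e1 m hm
      · exact absurd (zone_subset_of_suffix h (branch_subset_zone _ _
          (box_corridor_subset _ _ hk hi))) hzone
    · rw [hG, norm_smul, PiLp.norm_single, norm_one, mul_one, cutoff_deriv hf, norm_div, norm_neg,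
        Real.norm_eq_abs, Real.norm_eq_abs, abs_of_pos hH, div_le_div_iff₀ hH hr]
      have := hfC ((P.corner (u :: v) P.V - x P.V) / (P.r v * (P.τ u P.V - 1)))
      have h4 : P.r v ≤ 4 * (P.r v * (P.τ u P.V - 1)) := by nlinarith
      calc |deriv f ((P.corner (u :: v) P.V - x P.V) / (P.r v * (P.τ u P.V - 1)))| * P.r v
          ≤ C * (4 * (P.r v * (P.τ u P.V - 1))) := by gcongr
        _ = _ := by ring
  · push Not at h
    left
    have hev : P.testFun f A =ᶠ[𝓝 x] fun y => (fun _ => (1 : ℝ)) (y P.V) := by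
      filter_upwards [box_mem_nhds hi] with y hy using testFun_of_not_suffix hf1 h hy
    rw [classicalGradient_coord (f := fun _ => (1 : ℝ)) (k := P.V) (by fun_prop) hev, deriv_const, zero_smul]

/-- The energy is at most the number of tubes, times the volume `r * (2 * r * w) ^ (n - 1)` of a
tube, times `(4 * C / r) ^ p`. Words of length `j + 1` are reached through corridors of generation
`j`, hence the shift of index. -/
theorem exists_capacity_core_le {p : ℝ} (hp : 0 < p) : ∃ C : ℝ, 0 ≤ C ∧
    ∀ (L : ℕ → Finset U) (j : ℕ) (Q : Set (EuclideanSpace ℝ (Fin n))),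
      (∀ x ∈ Q, ∀ w ∈ words L (j + 1), x ∉ P.limb w) →
      capacity p (P.core L (j + 1)) Q P.domain ≤ ENNReal.ofReal (C * (words L (j + 1)).card *
        ((P.θ ^ j * (P.θ ^ j * P.w j) ^ (n - 1)) / (P.θ ^ j) ^ p)) := by
  obtain ⟨f, C, hf, hf0, hf1, hfC, hfd⟩ := exists_smooth_step
  have hC : 0 ≤ C := (abs_nonneg _).trans (hfC 0)
  refine ⟨(4 * C) ^ p * 2 ^ (n - 1), by positivity, fun L j Q hQ => ?_⟩
  set A := words L (j + 1) with hAdef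
  have hA : ∀ w ∈ A, w.length = j + 1 := fun w hw => length_of_mem_words hw
  have hu := contDiffOn_testFun (P := P) hf hf1 hA
  have hθ := pow_pos P.θ_pos j
  refine (iInf_le_of_le (P.testFun f A) (iInf_le_of_le (classicalGradient (P.testFun f A))
    (iInf_le_of_le ⟨hu.continuousOn, memW1pLoc_of_contDiffOn isOpen_domain hu p, ?_, ?_⟩ ?_)))
  · intro x hx
    obtain ⟨w, hw, hxw⟩ := mem_iUnion₂.1 hx
    have hxb := closedBall_subset_box w hxw
    rw [testFun_of_suffix (i := .chamber w) hA hw List.suffix_rfl hxb]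
    rcases w with _ | ⟨u, v⟩
    · exact absurd (hA _ hw) (by simp)
    · exact (cutoff_eq_zero hf0 (mem_box_chamber.1 hxb P.V).1.le).le
  · intro x hx
    rw [testFun_of_notMem (hQ x hx)]
  · set G := classicalGradient (P.testFun f A) with hG
    set T : List U → Set (EuclideanSpace ℝ (Fin n)) := fun w =>
      match w with
      | [] => ∅
      | u :: v => P.tube v u with hT
    set M : ℝ≥0∞ := ENNReal.ofReal (4 * C / P.θ ^ j) ^ p with hM
    have hTm : ∀ w, MeasurableSet (T w) := by
      rintro (_ | ⟨u, v⟩)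
      · exact MeasurableSet.empty
      · exact (isOpen_openBox _ _).measurableSet
    have hpt : ∀ x ∈ P.domain, ‖G x‖ₑ ^ p ≤ M * (⋃ w ∈ A, T w).indicator 1 x := by
      intro x hx
      rcases norm_gradient_testFun hf hf1 hfC hfd hA hx with h | ⟨v, u, huv, hxt, hle⟩
      · rw [hG, h, enorm_zero, ENNReal.zero_rpow_of_pos hp]
        exact zero_le
      · have hmem : x ∈ ⋃ w ∈ A, T w := mem_iUnion₂.2 ⟨u :: v, huv, hxt⟩
        rw [indicator_of_mem hmem, Pi.one_apply, mul_one, hM]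
        have hl := hA _ huv
        simp only [List.length_cons, Nat.add_right_cancel_iff] at hl
        rw [r, hl] at hle
        gcongr
        rw [← ofReal_norm]
        exact ENNReal.ofReal_le_ofReal hle
    have hvolT : ∀ w ∈ A, volume (T w) ≤
        ENNReal.ofReal (P.θ ^ j * (2 * (P.θ ^ j * P.w j)) ^ (n - 1)) := by
      rintro (_ | ⟨u, v⟩) hw
      · simp [hT]
      · have hl := hA _ hw
        simp only [List.length_cons, Nat.add_right_cancel_iff] at hl
        have := P.volume_tube_le v u
        rwa [r, hl] at this
    have hm : MeasurableSet (⋃ w ∈ A, T w) := Finset.measurableSet_biUnion _ fun w _ => hTm w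
    calc ∫⁻ x in P.domain, ‖G x‖ₑ ^ p
        ≤ ∫⁻ x in P.domain, M * (⋃ w ∈ A, T w).indicator 1 x :=
          setLIntegral_mono' isOpen_domain.measurableSet hpt
      _ ≤ ∫⁻ x, M * (⋃ w ∈ A, T w).indicator 1 x := setLIntegral_le_lintegral _ _
      _ = M * volume (⋃ w ∈ A, T w) := by
          rw [lintegral_const_mul _ (measurable_one.indicator hm), lintegral_indicator_one hm]
      _ ≤ M * ∑ _w ∈ A, ENNReal.ofReal (P.θ ^ j * (2 * (P.θ ^ j * P.w j)) ^ (n - 1)) := by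
          gcongr
          exact (measure_biUnion_finset_le _ _).trans (Finset.sum_le_sum hvolT)
      _ = _ := by
          rw [Finset.sum_const, nsmul_eq_mul, hM, ENNReal.ofReal_rpow_of_nonneg (by positivity) hp.le,
            ← ENNReal.ofReal_natCast, ← ENNReal.ofReal_mul (by positivity),
            ← ENNReal.ofReal_mul (by positivity)]
          congr 1
          rw [Real.div_rpow (by positivity) hθ.le, mul_pow]
          ring

end Pattern

/-! ### Existence of patterns with many letters -/

theorem exists_pattern {n m : ℕ} (hn : 2 ≤ n) (hm : 0 < m) {s : ℝ} (hs : 1 ≤ s) :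
    ∃ P : Pattern n (Fin n → Fin m), P.θ = 1 / (8 * m) ∧
      ∀ l, P.δ / 2 * (P.θ ^ l) ^ (s - 1) ≤ P.w l ∧ P.w l ≤ P.δ * (P.θ ^ l) ^ (s - 1) := by
  have hm0 : (0 : ℝ) < m := by exact_mod_cast hm
  have hm1 : (1 : ℝ) ≤ m := by exact_mod_cast hm
  set θ : ℝ := 1 / (8 * m) with hθ
  have hθ0 : 0 < θ := by positivity
  have hθm : θ * m = 1 / 8 := by rw [hθ]; field_simp
  have hθ8 : 8 * θ ≤ 1 := by nlinarith
  set ε : ℝ := θ / m with hε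
  have hε0 : 0 < ε := by positivity
  have hεm : ε * m = θ := by rw [hε]; field_simp
  have hεθ : ε ≤ θ := by nlinarith
  set δ : ℝ := ε / 8 with hδ
  have hδ0 : 0 < δ := by positivity
  set V : Fin n := ⟨0, by omega⟩ with hV
  set F : Fin n := ⟨1, by omega⟩ with hF
  have hFV : F ≠ V := by simp [hV, hF]
  -- Cubes that differ only in the vertical letter form a staircase: each level is shifted by `ε` in
  -- the direction `F`, which exposes a strip of width `ε` beside all lower cubes of the stack. The
  -- corridor runs in the middle of that strip. The `m` shifts add up to at most `θ`, so a pitch of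
  -- `3 * θ` keeps different stacks apart.
  set τ : (Fin n → Fin m) → Fin n → ℝ := fun u i => if i = V then 5 / 4 + 3 * θ * (u V : ℕ) else
    if i = F then 3 * θ * (u F : ℕ) + ε * (u V : ℕ) else 2 * θ * (u i : ℕ) with hτ
  set χ : (Fin n → Fin m) → Fin n → ℝ := fun u i =>
    if i = F then τ u F + θ - ε / 2 else τ u i + θ / 2 with hχ
  have hu0 : ∀ (u : Fin n → Fin m) i, (0 : ℝ) ≤ (u i : ℕ) := fun u i => Nat.cast_nonneg _
  have hu1 : ∀ (u : Fin n → Fin m) i, ((u i : ℕ) : ℝ) + 1 ≤ m := fun u i => by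
    exact_mod_cast (u i).2
  have hθu : ∀ (u : Fin n → Fin m) i, θ * (u i : ℕ) + θ ≤ 1 / 8 := fun u i => by
    have := mul_le_mul_of_nonneg_left (hu1 u i) hθ0.le
    linarith
  have hεu : ∀ (u : Fin n → Fin m) i, ε * (u i : ℕ) + ε ≤ θ := fun u i => by
    have := mul_le_mul_of_nonneg_left (hu1 u i) hε0.le
    linarith
  have hθu0 : ∀ (u : Fin n → Fin m) i, 0 ≤ θ * (u i : ℕ) := fun u i => mul_nonneg hθ0.le (hu0 u i)
  have hεu0 : ∀ (u : Fin n → Fin m) i, 0 ≤ ε * (u i : ℕ) := fun u i => mul_nonneg hε0.le (hu0 u i)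
  have hτV : ∀ u, τ u V = 5 / 4 + 3 * (θ * (u V : ℕ)) := fun u => by simp [hτ, mul_assoc]
  have hτF : ∀ u, τ u F = 3 * (θ * (u F : ℕ)) + ε * (u V : ℕ) := fun u => by
    simp [hτ, hFV, mul_assoc]
  have hτi : ∀ u i, i ≠ V → i ≠ F → τ u i = 2 * (θ * (u i : ℕ)) := fun u i h1 h2 => by
    simp [hτ, h1, h2, mul_assoc]
  have hχF : ∀ u, χ u F = τ u F + θ - ε / 2 := fun u => by simp [hχ]
  have hχi : ∀ u i, i ≠ F → χ u i = τ u i + θ / 2 := fun u i h => by simp [hχ, h]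
  -- The profile only reaches dyadic fractions of `δ`, so the width is matched up to a factor 2.
  have hN : ∀ l : ℕ, ∃ N : ℕ, δ / 2 * (θ ^ l) ^ (s - 1) ≤ δ / 2 ^ N ∧
      δ / 2 ^ N ≤ δ * (θ ^ l) ^ (s - 1) := by
    intro l
    have hx0 : 0 < (θ ^ l) ^ (s - 1) := by positivity
    have hx1 : (θ ^ l) ^ (s - 1) ≤ 1 :=
      Real.rpow_le_one (by positivity) (pow_le_one₀ hθ0.le (by linarith)) (by linarith)
    obtain ⟨N, h1, h2⟩ := exists_nat_pow_near_of_lt_one hx0 hx1 (show (0 : ℝ) < 1 / 2 by norm_num)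
      (by norm_num)
    have e : δ / 2 ^ (N + 1) = δ * (1 / 2) ^ (N + 1) := by rw [one_div, inv_pow]; rfl
    refine ⟨N + 1, ?_, ?_⟩
    · rw [e, pow_succ]
      have := mul_le_mul_of_nonneg_left h2 hδ0.le
      linarith
    · rw [e]
      gcongr
  choose N hN1 hN2 using hN
  have hprof := fun (u : Fin n → Fin m) (l : ℕ) => exists_profile (N l) (τ u V - 1) δ hδ0 (by
    rw [hτV]; linarith [hθu0 u V])
  choose K y h hK y0 yK h0 hl hlen hadj hb hw using hprof
  have hlt : ∀ u u' : Fin n → Fin m, ∀ i, u i < u' i →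
      θ * (u i : ℕ) + θ ≤ θ * (u' i : ℕ) ∧ ε * (u i : ℕ) + ε ≤ ε * (u' i : ℕ) := by
    intro u u' i hlt
    have : ((u i : ℕ) : ℝ) + 1 ≤ (u' i : ℕ) := by exact_mod_cast hlt
    have h1 := mul_le_mul_of_nonneg_left this hθ0.le
    have h2 := mul_le_mul_of_nonneg_left this hε0.le
    constructor <;> linarith
  have hsepV : ∀ u u' : Fin n → Fin m, (∀ i, i ≠ V → u i = u' i) → u V < u' V →
      τ u V + 3 * θ ≤ τ u' V ∧ ∃ i, i ≠ V ∧ τ u i + θ + 2 * δ ≤ χ u' i := by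
    intro u u' heq h
    have h1 := hlt u u' V h
    refine ⟨by rw [hτV, hτV]; linarith [h1.1], F, hFV, ?_⟩
    rw [hχF, hτF, hτF, heq F hFV]
    linarith [h1.2]
  refine ⟨⟨V, F, hFV, θ, δ, τ, χ, K, y, h, fun l => δ / 2 ^ N l, hθ0, hθ8, hδ0, by linarith,
    fun u => by rw [hτV]; linarith [hθu0 u V], fun u => by rw [hτV]; linarith [hθu u V], ?_, ?_,
    ?_, ?_, ?_, hK, y0, yK, h0, hl, fun u l k hk => (hlen u l k hk).1,
    fun u l k hk => (hlen u l k hk).2, fun u l k hk => (hadj u l k hk).1,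
    fun u l k hk => (hadj u l k hk).2, fun l => by positivity, fun u l k hk => (hb u l k hk).1,
    fun u l k hk => (hb u l k hk).2, hw⟩, rfl, fun l => ⟨hN1 l, hN2 l⟩⟩
  · intro u i hi
    by_cases h : i = F
    · rw [h, hτF]; linarith [hθu0 u F, hεu0 u V]
    · rw [hτi u i hi h]; linarith [hθu0 u i]
  · intro u i hi
    by_cases h : i = F
    · rw [h, hτF]; linarith [hθu u F, hεu u V]
    · rw [hτi u i hi h]; linarith [hθu u i]
  · intro u i hi
    by_cases h : i = F
    · rw [h, hχF]; linarith
    · rw [hχi u i h]; linarith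
  · intro u i hi
    by_cases h : i = F
    · rw [h, hχF]; linarith
    · rw [hχi u i h]; linarith
  · intro u u' huu
    by_cases heq : ∀ i, i ≠ V → u i = u' i
    · have hne : u V ≠ u' V := fun h => huu (funext fun i => by
        by_cases hi : i = V
        · rw [hi, h]
        · exact heq i hi)
      rcases lt_or_gt_of_ne hne with h | h
      · exact Or.inr (Or.inl (hsepV u u' heq h))
      · exact Or.inr (Or.inr (hsepV u' u (fun i hi => (heq i hi).symm) h))
    · push Not at heq
      obtain ⟨i, hi, hne⟩ := heq
      refine Or.inl ⟨i, hi, ?_⟩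
      by_cases hiF : i = F
      · subst hiF
        rw [hτF, hτF]
        rcases lt_or_gt_of_ne hne with h | h
        · refine le_trans ?_ (neg_le_abs _)
          linarith [(hlt u u' _ h).1, hεu u V, hεu0 u' V]
        · refine le_trans ?_ (le_abs_self _)
          linarith [(hlt u' u _ h).1, hεu u' V, hεu0 u V]
      · rw [hτi u i hi hiF, hτi u' i hi hiF]
        rcases lt_or_gt_of_ne hne with h | h
        · refine le_trans ?_ (neg_le_abs _)
          linarith [(hlt u u' _ h).1]
        · refine le_trans ?_ (le_abs_self _)
          linarith [(hlt u' u _ h).1]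

/-- There are arbitrarily dense patterns: for `lam < n` the number `m ^ n` of letters exceeds the
power `lam` of the inverse scale `8 * m`. -/
theorem exists_letter_count {n : ℕ} {lam : ℝ} (h0 : 0 < lam) (hlam : lam < n) :
    ∃ m : ℕ, 0 < m ∧ 2 ≤ (8 * m : ℝ) ^ lam ∧ (8 * m : ℝ) ^ lam ≤ (m : ℝ) ^ n := by
  have h1 : Tendsto (fun m : ℕ => (m : ℝ) ^ ((n : ℝ) - lam)) atTop atTop :=
    (tendsto_rpow_atTop (by linarith)).comp tendsto_natCast_atTop_atTop
  have h2 : Tendsto (fun m : ℕ => (m : ℝ) ^ lam) atTop atTop :=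
    (tendsto_rpow_atTop h0).comp tendsto_natCast_atTop_atTop
  obtain ⟨m, hm1, hm2, hm3⟩ := ((h1.eventually_ge_atTop ((8 : ℝ) ^ lam)).and
    ((h2.eventually_ge_atTop 2).and (eventually_gt_atTop 0))).exists
  have hm0 : (0 : ℝ) < m := by exact_mod_cast hm3
  refine ⟨m, hm3, ?_, ?_⟩
  · exact hm2.trans (Real.rpow_le_rpow hm0.le (by linarith) h0.le)
  · calc (8 * m : ℝ) ^ lam = 8 ^ lam * (m : ℝ) ^ lam := Real.mul_rpow (by norm_num) hm0.le
      _ ≤ (m : ℝ) ^ ((n : ℝ) - lam) * (m : ℝ) ^ lam := by gcongr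
      _ = (m : ℝ) ^ n := by rw [← Real.rpow_add hm0, sub_add_cancel, Real.rpow_natCast]

theorem IsClosedCube.isCompact {n : ℕ} {Q : Set (EuclideanSpace ℝ (Fin n))} (hQ : IsClosedCube Q) :
    IsCompact Q := by
  obtain ⟨a, l, hl, rfl⟩ := hQ
  refine Metric.isCompact_of_isClosed_isBounded ?_ ?_
  · have : {x : EuclideanSpace ℝ (Fin n) | ∀ i, x i ∈ Icc (a i) (a i + l)} =
        ⋂ i, {x | x i ∈ Icc (a i) (a i + l)} := by ext x; simp
    rw [this]
    exact isClosed_iInter fun i => isClosed_Icc.preimage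
      (EuclideanSpace.proj i : EuclideanSpace ℝ (Fin n) →L[ℝ] ℝ).continuous
  · refine (Metric.isBounded_closedBall (x := a) (r := n * l)).subset fun x hx => ?_
    refine Pattern.dist_le_of_coord_le fun k => ?_
    have := hx k
    rw [abs_le]
    constructor <;> linarith [this.1, this.2]

/-! ### Growth of the number of words against scale, and the choice of the compact sets. -/

namespace Pattern

variable {n : ℕ} {U : Type*} {P : Pattern n U}

/-- A compact subset of the domain meets only finitely many generations. -/
theorem exists_forall_notMem_limb {Q : Set (EuclideanSpace ℝ (Fin n))} (hQ : IsCompact Q)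
    (hQP : Q ⊆ P.domain) : ∃ j₀ : ℕ, ∀ x ∈ Q, ∀ w : List U, j₀ < w.length → x ∉ P.limb w := by
  rcases Q.eq_empty_or_nonempty with rfl | hne
  · exact ⟨0, by simp⟩
  have hΛ := P.tree.Λ_pos
  obtain ⟨x₁, hx₁, hmin⟩ := hQ.exists_isMinOn hne
    (Metric.continuous_infDist_pt (frontier P.domain)).continuousOn
  have hpos : 0 < Metric.infDist x₁ (frontier P.domain) :=
    infDist_frontier_pos isOpen_domain P.tree.frontier_nonempty (hQP hx₁)
  obtain ⟨j₀, hj₀⟩ := exists_pow_lt_of_lt_one (show 0 < Metric.infDist x₁ (frontier P.domain) /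
    (2 * P.tree.Λ) by positivity) P.θ_lt_one
  rw [lt_div_iff₀ (by positivity)] at hj₀
  refine ⟨j₀, fun x hx w hw hxw => ?_⟩
  obtain ⟨i, hi, hxi⟩ := mem_iUnion₂.1 hxw
  rcases w with _ | ⟨u, v⟩
  · simp at hw
  have h1 : Metric.infDist x (frontier P.domain) ≤ 2 * P.tree.Λ * P.sz i := P.tree.infDist_le hxi
  have h2 := P.sz_le_of_suffix hi
  have h3 : P.r v ≤ P.θ ^ j₀ :=
    pow_le_pow_of_le_one P.θ_pos.le P.θ_lt_one.le (by simpa using Nat.lt_succ_iff.1 hw)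
  have h4 : Metric.infDist x₁ (frontier P.domain) ≤ Metric.infDist x (frontier P.domain) := hmin hx
  have h5 : 2 * P.tree.Λ * P.sz i ≤ 2 * P.tree.Λ * P.θ ^ j₀ := by gcongr; exact h2.trans h3
  linarith

end Pattern

/-- The second number in the minimum matters only through this inequality: the construction works
for every growth exponent below `n`. -/
theorem logb_two_pow_sub_one_lt {n : ℕ} (hn : 2 ≤ n) : Real.logb 2 (2 ^ n - 1) < n := by
  have h4 : (4 : ℝ) ≤ 2 ^ n := by
    calc (4 : ℝ) = 2 ^ 2 := by norm_num
      _ ≤ 2 ^ n := pow_le_pow_right₀ (by norm_num) hn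
  rw [Real.logb_lt_iff_lt_rpow (by norm_num) (by linarith), Real.rpow_natCast]
  linarith

namespace Pattern

variable {n : ℕ} {U : Type*} {P : Pattern n U}

/-- The content of the cores is bounded below for exponents below the growth exponent `lam`. -/
theorem exists_le_hausdorffContent_of_growth {L : ℕ → Finset U} {lam q D : ℝ} (hD : 0 < D)
    (hL : ∀ j, (P.θ⁻¹ ^ lam) ^ j / (j + 1) ≤ D * (words L j).card) (hq : 0 < q) (hqlam : q < lam)
    (hlam : lam ≤ n) :
    ∃ c : ℝ≥0, 0 < c ∧ ∀ j, (c : ℝ≥0∞) ≤ hausdorffContent q (P.core L j) := by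
  have hθ := P.θ_pos
  set b : ℝ := P.θ⁻¹ ^ lam * P.θ ^ q with hb
  have hb1 : 1 < b := by
    rw [hb, Real.inv_rpow hθ.le, ← Real.rpow_neg hθ.le, ← Real.rpow_add hθ]
    exact Real.one_lt_rpow_of_pos_of_lt_one_of_neg hθ P.θ_lt_one (by linarith)
  have hm : 0 < min 1 (b - 1) := lt_min one_pos (by linarith)
  refine exists_le_hausdorffContent L (C := D / min 1 (b - 1)) hq (by linarith) (by positivity)
    fun j => ?_
  -- By Bernoulli's inequality the exponential gain from `q < lam` absorbs the factor `j + 1` lost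
  -- in the number of words.
  have h1 : min 1 (b - 1) * (j + 1) ≤ b ^ j := by
    have h2 := one_add_mul_le_pow (show -2 ≤ b - 1 by linarith) j
    rw [add_sub_cancel] at h2
    have hj : (0 : ℝ) ≤ j := by positivity
    have h3 := mul_le_mul_of_nonneg_right (min_le_right 1 (b - 1)) hj
    have h4 := min_le_left 1 (b - 1)
    linarith
  have h2 : (P.θ⁻¹ ^ lam) ^ j * (P.θ ^ j) ^ q = b ^ j := by
    rw [hb, mul_pow, ← Real.rpow_natCast (P.θ ^ q), ← Real.rpow_natCast P.θ, ← Real.rpow_mul hθ.le,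
      ← Real.rpow_mul hθ.le, mul_comm q]
  have hj : (0 : ℝ) < j + 1 := by positivity
  have h3 := mul_le_mul_of_nonneg_right (hL j) (show 0 ≤ (P.θ ^ j) ^ q by positivity)
  rw [div_mul_eq_mul_div, h2, div_le_iff₀ hj] at h3
  rw [div_mul_eq_mul_div, div_mul_eq_mul_div, one_le_div hm]
  exact le_of_mul_le_mul_right (h1.trans h3) hj

/-- The capacities of the cores tend to zero if the number of words does not grow too fast. -/
theorem tendsto_capacity_core {L : ℕ → Finset U} {lam s p : ℝ} (hp : 0 < p) (hn : 1 ≤ n)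
    (hw : ∀ l, P.w l ≤ P.δ * (P.θ ^ l) ^ (s - 1))
    (hL : ∀ j : ℕ, ((words L j).card : ℝ) ≤ (P.θ⁻¹ ^ lam) ^ j / (j + 1))
    (hlam : lam ≤ ((n : ℝ) - 1) * s + 1 - p) {Q : Set (EuclideanSpace ℝ (Fin n))} {j₀ : ℕ}
    (hQ : ∀ x ∈ Q, ∀ w : List U, j₀ < w.length → x ∉ P.limb w) :
    Tendsto (fun j => capacity p (P.core L (j + j₀ + 1)) Q P.domain) atTop (𝓝 0) := by
  have hθ := P.θ_pos
  obtain ⟨C, hC, hcap⟩ := exists_capacity_core_le (P := P) hp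
  have hbound : ∀ j, capacity p (P.core L (j + j₀ + 1)) Q P.domain ≤
      ENNReal.ofReal (C * P.θ⁻¹ ^ lam * (1 / ((j : ℝ) + 1))) := by
    intro j
    refine (hcap L (j + j₀) Q fun x hx w hw => hQ x hx w ?_).trans (ENNReal.ofReal_le_ofReal ?_)
    · rw [length_of_mem_words hw]; omega
    set k := j + j₀ with hk
    set x := P.θ ^ k with hx
    have hx0 : 0 < x := by positivity
    have hx1 : x ≤ 1 := pow_le_one₀ hθ.le P.θ_lt_one.le
    have e1 : x * P.w k ≤ x ^ s := by
      calc x * P.w k ≤ x * (1 * x ^ (s - 1)) := by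
            gcongr
            exact (hw k).trans (by gcongr; exact P.δ_le_one)
        _ = x ^ s := by
            have := Real.rpow_add_one hx0.ne' (s - 1)
            rw [sub_add_cancel] at this
            rw [this]; ring
    have hwk := P.w_pos k
    have e2 : x * (x * P.w k) ^ (n - 1) / x ^ p ≤ x ^ lam := by
      calc x * (x * P.w k) ^ (n - 1) / x ^ p ≤ x * (x ^ s) ^ (n - 1) / x ^ p := by gcongr
        _ = x ^ (((n : ℝ) - 1) * s + 1 - p) := by
            rw [Real.rpow_sub hx0, Real.rpow_add_one hx0.ne', mul_comm (_ - _) s,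
              Real.rpow_mul hx0.le, ← Real.rpow_natCast (x ^ s), Nat.cast_sub hn]
            push_cast
            ring
        _ ≤ x ^ lam := Real.rpow_le_rpow_of_exponent_ge hx0 hx1 hlam
    -- The growth of the words cancels the decay of the energy up to one generation, so convergence
    -- rests on the factor `1 / (j + 1)` alone. This is what admits equality in `hlam`.
    have e3 : (P.θ⁻¹ ^ lam) ^ (k + 1) * x ^ lam = P.θ⁻¹ ^ lam := by
      have h1 : x ^ lam = (P.θ ^ lam) ^ k := by
        rw [hx, ← Real.rpow_natCast, ← Real.rpow_natCast, ← Real.rpow_mul hθ.le,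
          ← Real.rpow_mul hθ.le, mul_comm]
      rw [h1, pow_succ, mul_right_comm, ← mul_pow, Real.inv_rpow hθ.le, inv_mul_cancel₀
        (Real.rpow_pos_of_pos hθ _).ne', one_pow, one_mul]
    have e4 := hL (k + 1)
    have hx2 : 0 ≤ x * (x * P.w k) ^ (n - 1) / x ^ p := by positivity
    calc C * (words L (k + 1)).card * (x * (x * P.w k) ^ (n - 1) / x ^ p)
        ≤ C * ((P.θ⁻¹ ^ lam) ^ (k + 1) / ((k + 1 : ℕ) + 1)) * x ^ lam := by gcongr
      _ = C * ((P.θ⁻¹ ^ lam) ^ (k + 1) * x ^ lam) * (1 / ((k + 1 : ℕ) + 1)) := by ring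
      _ = C * P.θ⁻¹ ^ lam * (1 / ((k + 1 : ℕ) + 1)) := by rw [e3]
      _ ≤ C * P.θ⁻¹ ^ lam * (1 / ((j : ℝ) + 1)) := by
          have : (j : ℝ) ≤ ((k + 1 : ℕ) : ℝ) := by exact_mod_cast (by omega)
          gcongr
  refine tendsto_of_tendsto_of_tendsto_of_le_of_le tendsto_const_nhds ?_ (fun _ => zero_le) hbound
  have h := (tendsto_one_div_add_atTop_nhds_zero_nat (𝕜 := ℝ)).const_mul (C * P.θ⁻¹ ^ lam)
  rw [mul_zero] at h
  simpa using ENNReal.tendsto_ofReal h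

end Pattern

theorem mainTheorem3 (n : ℕ) (hn : 2 ≤ n) (s p : ℝ) (hs : 1 ≤ s) (hp₁ : 1 ≤ p) (hpn : p ≤ n) :
    ∃ (Ω : Set (EuclideanSpace ℝ (Fin n))) (x₀ : EuclideanSpace ℝ (Fin n)),
      IsSJohnDomain s Ω x₀ ∧ IsGromovHyperbolicDomain Ω ∧
      ∀ W : Set (Set (EuclideanSpace ℝ (Fin n))), IsWhitneyDecomposition Ω W →
        ∀ Q₀ ∈ W, x₀ ∈ Q₀ →
          ∃ E : ℕ → Set (EuclideanSpace ℝ (Fin n)),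
            (∀ j, IsCompact (E j) ∧ E j ⊆ Ω ∧ Disjoint (E j) Q₀) ∧
            ∀ q : ℝ, 0 < q → q < min (((n : ℝ) - 1) * s + 1 - p) (Real.logb 2 (2 ^ n - 1)) →
              (∃ c : ℝ≥0, 0 < c ∧ ∀ j, (c : ℝ≥0∞) ≤ hausdorffContent q (E j)) ∧
              Tendsto (fun j => capacity p (E j) Q₀ Ω) atTop (𝓝 0) := by
  set lam : ℝ := min (((n : ℝ) - 1) * s + 1 - p) (Real.logb 2 (2 ^ n - 1)) with hlam
  have hlam1 : lam ≤ ((n : ℝ) - 1) * s + 1 - p := min_le_left _ _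
  have hlamn : lam < n := (min_le_right _ _).trans_lt (logb_two_pow_sub_one_lt hn)
  rcases le_or_gt lam 0 with h0 | h0
  -- For `lam ≤ 0` no exponent `q` is admissible, and any pattern with empty sets will do.
  · obtain ⟨P, -, hw⟩ := exists_pattern hn one_pos hs
    refine ⟨P.domain, _, P.isSJohnDomain hs fun l => (hw l).1, P.isGromovHyperbolicDomain,
      fun W hW Q₀ hQ₀ hx₀ => ⟨fun _ => ∅, fun j => by simp, fun q hq hq' => ?_⟩⟩
    exact absurd (hq.trans hq') (not_lt.2 h0)
  obtain ⟨m, hm, hm2, hmn⟩ := exists_letter_count h0 hlamn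
  obtain ⟨P, hθ, hw⟩ := exists_pattern hn hm hs
  have hθ' : P.θ⁻¹ = 8 * m := by rw [hθ, one_div, inv_inv]
  have : Nonempty (Fin m) := ⟨⟨0, hm⟩⟩
  obtain ⟨L, hL⟩ := exists_letters (U := Fin n → Fin m) hm2 (by simpa using hmn)
  rw [← hθ'] at hL
  refine ⟨P.domain, _, P.isSJohnDomain hs fun l => (hw l).1, P.isGromovHyperbolicDomain,
    fun W hW Q₀ hQ₀ hx₀ => ?_⟩
  obtain ⟨hcube, hsub⟩ := hW.1 Q₀ hQ₀
  -- Generations up to `j₀` are skipped, so that the later limbs miss `Q₀`: this makes the sets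
  -- disjoint from it and the test functions equal to one on it.
  obtain ⟨j₀, hj₀⟩ := Pattern.exists_forall_notMem_limb hcube.isCompact hsub
  refine ⟨fun j => P.core L (j + j₀ + 1), fun j => ⟨P.isCompact_core L _, P.core_subset_domain L _,
    Set.disjoint_left.2 fun x hx hxQ => ?_⟩, fun q hq hq' => ⟨?_, ?_⟩⟩
  · obtain ⟨w, hw, hxw⟩ := mem_iUnion₂.1 hx
    refine hj₀ x hxQ w (by rw [length_of_mem_words hw]; omega) ?_
    exact mem_iUnion₂.2 ⟨.chamber w, List.suffix_rfl, Pattern.closedBall_subset_box w hxw⟩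
  · obtain ⟨c, hc, h⟩ := P.exists_le_hausdorffContent_of_growth (D := Fintype.card (Fin n → Fin m))
      (by exact_mod_cast Fintype.card_pos) (fun j => (hL j).2) hq hq' hlamn.le
    exact ⟨c, hc, fun j => h _⟩
  · exact Pattern.tendsto_capacity_core (by linarith) (by omega) (fun l => (hw l).2)
      (fun j => (hL j).1) hlam1 hj₀
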